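/- Let $\mathcal A=\{1,\dots,m\}$ and let $\zeta:\mathcal A\to\mathcal A^+$ be a substitution, extended to words by concatenation, with substitution matrix $\mathsf S(i,j)=$ number of symbols $i$ in $\zeta(j)$. Let $X_\zeta\subset\mathcal A^{\mathbb Z}$ be the set of two-sided sequences $x$ such that every block $x[-n,n]$ occurs as a subword of some $\zeta^k(a)$, $k\in\mathbb N$, $a\in\mathcal A$, and let $T$ be the left shift on $X_\zeta$. Assume that * $\zeta$ is primitive (some power of $\mathsf S$ has only positive entries) and aperiodic ($X_\zeta$ contains no $T$-periodic point); * the characteristic polynomial of $\mathsf S$ is irreducible over $\mathbb Q$; * $|\theta_2|>1$, where $\theta_1>|\theta_2|\ge\cdots$ are the eigenvalues of $\mathsf S$ ordered by modulus. Let $\mu$ be the (unique) $T$-invariant Borel probability measure on $X_\zeta$. For $\vec s$ in the simplex $\Delta^{m-1}=\{\vec s\in\mathbb R^m: s_j>0 \text{ for all } j,\ \sum_j s_j=1\}$ let $(\mathfrak X_\zeta^{\vec s},\widetilde\mu,h_t)$ be the suspension flow over $(X_\zeta,\mu,T)$ with roof function equal to $s_j$ on $\{x: x_0=j\}$; here $\mathfrak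 X_\zeta^{\vec s}=\{(x,t): x\in X_\zeta,\ 0\le t\le s_{x_0}\}$ with $(x,s_{x_0})$ and $(Tx,0)$ identified, and $\widetilde\mu$ is the normalized restriction of $\mu\times\mathrm{Leb}$. A Lip-cylindrical function is a function $f(x,t)=\psi_{x_0}(t)$, $0\le t<s_{x_0}$, with Lipschitz functions $\psi_a:[0,s_a]\to\mathbb C$, $a\in\mathcal A$; put $\|f\|_L=\max_a\|\psi_a\|_L$, where $\|\psi_a\|_L$ is the sum of the supremum norm and the best Lipschitz constant of $\psi_a$ on $[0,s_a]$. The spectral measure $\sigma_f$ is the finite positive Borel measure on $\mathbb R$ with $\int e^{2\pi i\omega t}\,d\sigma_f(\omega)=\int (f\circ h_t)\,\overline f\,d\widetilde\mu$ for all $t\in\mathbb R$. Then there is a constant $\gamma>0$, depending only on $\zeta$, such that for Lebesgue-almost every $\vec s\in\Delta^{m-1}$ there is $r_0=r_0(\vec s)>0$ such that for every Lip-cylindrical function $f$ with $\int f\,d\widetilde\mu=0$, $$\sigma_f([\omega-r,\omega+r])\le C\,r^{\gamma}\qquad\text{for all }\omega\in\mathbb R\text{ and }0<r\le r_0,$$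 where $C=C(\|f\|_L)>0$ depends only on $\|f\|_L$. -/

import Mathlib

open MeasureTheory Set
open scoped NNReal

/-- A substitution on the alphabet `Fin m`: every letter is mapped to a nonempty word. -/
structure Substitution (m : ℕ) where
  word : Fin m → List (Fin m)
  word_ne_nil : ∀ a, word a ≠ []

namespace Substitution

variable {m : ℕ}

/-- Extension of the substitution to finite words, by concatenation. -/
def onWords (ζ : Substitution m) (w : List (Fin m)) : List (Fin m) :=
  w.flatMap ζ.word

/-- The word `ζ^k(a)`. -/
def iter (ζ : Substitution m) (k : ℕ) (a : Fin m) : List (Fin m) :=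
  ζ.onWords^[k] [a]

/-- The substitution matrix: the entry `(i, j)` is the number of symbols `i` in `ζ(j)`. -/
def matrix (ζ : Substitution m) : Matrix (Fin m) (Fin m) ℕ :=
  Matrix.of fun i j => (ζ.word j).count i

/-- Some power of the substitution matrix has only positive entries. -/
def IsPrimitive (ζ : Substitution m) : Prop :=
  ∃ n : ℕ, 0 < n ∧ ∀ i j, 0 < (ζ.matrix ^ n) i j

/-- The block `x[-n, n]` of a two-sided sequence. -/
def centralBlock (x : ℤ → Fin m) (n : ℕ) : List (Fin m) :=
  List.ofFn fun j : Fin (2 * n + 1) => x ((j : ℤ) - (n : ℤ))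

/-- The substitution space `X_ζ`: all two-sided sequences each of whose blocks `x[-n, n]`
occurs as a subword (of consecutive letters) in some `ζ^k(a)`. -/
def space (ζ : Substitution m) : Set (ℤ → Fin m) :=
  {x | ∀ n : ℕ, ∃ (k : ℕ) (a : Fin m), centralBlock x n <:+: ζ.iter k a}

/-- The `n`-th power of the left shift on two-sided sequences. -/
def shift (n : ℤ) (x : ℤ → Fin m) : ℤ → Fin m :=
  fun k => x (k + n)

/-- The substitution dynamical system has no periodic points. -/
def IsAperiodic (ζ : Substitution m) : Prop :=
  ∀ x ∈ ζ.space, ∀ n : ℕ, 0 < n → shift (n : ℤ) x ≠ x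

/-- The characteristic polynomial of the substitution matrix is irreducible (over `ℚ`). -/
def HasIrreducibleCharpoly (ζ : Substitution m) : Prop :=
  Irreducible (ζ.matrix.map (fun k : ℕ => (k : ℚ))).charpoly

/-- The moduli of the complex eigenvalues of the substitution matrix, with multiplicity,
listed in decreasing order. -/
noncomputable def eigenvalueModuli (ζ : Substitution m) : List ℝ :=
  ((ζ.matrix.map (fun k : ℕ => (k : ℂ))).charpoly.roots.map fun z => ‖z‖).sort (· ≥ ·)

/-- `|θ₂|`, the modulus of the second eigenvalue (`0` if there are fewer than two). -/
noncomputable def secondEigenvalueModulus (ζ : Substitution m) : ℝ :=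
  ζ.eigenvalueModuli.getD 1 0

/-- `μ` is a Borel probability measure on `X_ζ` (regarded as a measure on all two-sided
sequences that is carried by `X_ζ`) which is invariant under the left shift. -/
structure IsInvariantMeasure (ζ : Substitution m) (μ : Measure (ℤ → Fin m)) : Prop where
  isProbabilityMeasure : IsProbabilityMeasure μ
  carried : μ ζ.spaceᶜ = 0
  invariant : MeasurePreserving (shift 1) μ μ

/-- The suspension space over `X_ζ` with roof function equal to `s_j` on the cylinder set `[j]`;
the points `(x, s_{x_0})` and `(T x, 0)` are identified, and represented by the latter. -/
def suspensionSpace (ζ : Substitution m) (s : Fin m → ℝ) : Set ((ℤ → Fin m) × ℝ) :=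
  {p | p.1 ∈ ζ.space ∧ 0 ≤ p.2 ∧ p.2 < s (p.1 0)}

/-- The invariant probability measure of the suspension flow: the restriction of the product of
`μ` and Lebesgue measure to the suspension space, normalized. -/
noncomputable def suspensionMeasure (ζ : Substitution m) (s : Fin m → ℝ)
    (μ : Measure (ℤ → Fin m)) : Measure ((ℤ → Fin m) × ℝ) :=
  ((μ.prod volume) (ζ.suspensionSpace s))⁻¹ • (μ.prod volume).restrict (ζ.suspensionSpace s)

end Substitution

section Suspension

variable {m : ℕ}

/-- The Birkhoff sum of the roof function over the orbit of `x`: it is `s_{x_0} + ⋯ + s_{x_{n-1}}`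
for `n ≥ 0`, and `-(s_{x_n} + ⋯ + s_{x_{-1}})` for `n < 0`. -/
noncomputable def roofSum (s : Fin m → ℝ) (x : ℤ → Fin m) (n : ℤ) : ℝ :=
  ∑ j ∈ Finset.Ico 0 n, s (x j) - ∑ j ∈ Finset.Ico n 0, s (x j)

/-- For positive `s`, the unique `n` with `roofSum s x n ≤ τ < roofSum s x (n + 1)`. -/
noncomputable def roofIndex (s : Fin m → ℝ) (x : ℤ → Fin m) (τ : ℝ) : ℤ :=
  sSup {n : ℤ | roofSum s x n ≤ τ}

/-- The suspension flow `h_t`: move upwards with unit speed, and pass from `(x, s_{x_0})` to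
`(T x, 0)`. -/
noncomputable def suspensionFlow (s : Fin m → ℝ) (t : ℝ) (p : (ℤ → Fin m) × ℝ) :
    (ℤ → Fin m) × ℝ :=
  (Substitution.shift (roofIndex s p.1 (p.2 + t)) p.1,
    p.2 + t - roofSum s p.1 (roofIndex s p.1 (p.2 + t)))

/-- The cylindrical function `f(x, t) = ψ_{x_0}(t)`. -/
def cylindrical (ψ : Fin m → ℝ → ℂ) (p : (ℤ → Fin m) × ℝ) : ℂ :=
  ψ (p.1 0) p.2

/-- `ψ_a` is Lipschitz on `[0, s_a]` for every letter `a`. -/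
def IsLipCylindrical (s : Fin m → ℝ) (ψ : Fin m → ℝ → ℂ) : Prop :=
  ∀ a, ∃ K : ℝ≥0, LipschitzOnWith K (ψ a) (Icc 0 (s a))

/-- The Lipschitz norm of a function on `[0, ℓ]`: supremum norm plus best Lipschitz constant. -/
noncomputable def lipNorm (ℓ : ℝ) (φ : ℝ → ℂ) : ℝ :=
  (⨆ t : Icc (0 : ℝ) ℓ, ‖φ t‖) + (sInf {K : ℝ≥0 | LipschitzOnWith K φ (Icc 0 ℓ)} : ℝ≥0)

/-- `‖f‖_L = max_a ‖ψ_a‖_L`. -/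
noncomputable def cylLipNorm (s : Fin m → ℝ) (ψ : Fin m → ℝ → ℂ) : ℝ :=
  ⨆ a, lipNorm (s a) (ψ a)

/-- The strictly positive vectors with sum of coordinates one. -/
def positiveSimplex (m : ℕ) : Set (Fin m → ℝ) :=
  {s | (∀ i, 0 < s i) ∧ ∑ i, s i = 1}

/-- Lebesgue measure on the simplex, as the `(m - 1)`-dimensional Hausdorff measure. (The distance
on `Fin m → ℝ` is the maximum distance; on the hyperplane that contains the simplex the resulting
Hausdorff measure is a positive finite multiple of Lebesgue measure, so the null sets are the
same.) -/
noncomputable def simplexMeasure (m : ℕ) : Measure (Fin m → ℝ) :=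
  (Measure.hausdorffMeasure ((m : ℝ) - 1)).restrict (positiveSimplex m)

end Suspension

/-- `σ` is the spectral measure of `f` for the measure-preserving flow `h` on `(Ω, ν)`: the finite
positive Borel measure on `ℝ` with `∫ e^{2πiωt} dσ(ω) = ⟨f ∘ h_t, f⟩` for all `t`. (Finite measures
on `ℝ` are determined by their Fourier transforms.) -/
structure IsSpectralMeasure {Ω : Type*} [MeasurableSpace Ω] (ν : Measure Ω) (h : ℝ → Ω → Ω)
    (f : Ω → ℂ) (σ : Measure ℝ) : Prop where
  isFiniteMeasure : IsFiniteMeasure σ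
  fourier : ∀ t : ℝ, ∫ ω : ℝ, Complex.exp (2 * Real.pi * Complex.I * ω * t) ∂σ =
    ∫ y, f (h t y) * (starRingEnd ℂ) (f y) ∂ν

namespace Substitution

variable {m : ℕ} (ζ : Substitution m)

/-! ### Iterates of the substitution -/

/-! The mass of `σ` near `ω` is controlled by twisted integrals `∫₀^u e^{-2πiωt} f(h_t y) dt`, `u ≤
R = 1/(2r)`, through a Fejér kernel (`spectral_measureReal_Icc_le`). Up to bounded end pieces such
an integral is a twisted sum over a block of `x`, and the block is a concatenation of words `ζ^n(b)`
up to two ends of length at most `Λ^n`. It therefore suffices that `twistedRate`, the largest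
twisted sum over `ζ^n(b)` per letter, decays exponentially in `n`.

Cancellation comes from a return word `c :: v` occurring, followed by `c`, in every `ζ^q(b)`. Inside
`ζ^(n+q)(b)` there are then two copies of `ζ^n(c)` whose starting points differ by the `s`-length of
`ζ^n(c :: v)`. If `ω` times this length is at distance at least `ρ` from the integers, the two
contributions partly cancel and the rate drops by a fixed factor within `q` steps
(`twistedRate_add_le`). What is needed is a positive proportion of such `n`.

This is an Erdős–Kahane argument (`erdos_kahane`). The lengths times `ω` satisfy the integer
recurrence given by the characteristic polynomial. While they stay close to integers, the nearest
integers satisfy the same recurrence exactly, so sequences with few bad moments are determined by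
initial values and a sparse string of defects, and there are few of them. Each such integer sequence
fixes `ω⟨w₁, s⟩` and `ω⟨w₂, s⟩` up to `O(ν^{-M})` for two eigenvectors with eigenvalues of modulus
at least `ν > 1`. Eliminating `ω` confines `s` to a thin slab, so one estimate covers all `ω` in the
range. The measures are summable and Borel–Cantelli applies. Irreducibility ensures that the return
word's letter counts have nonzero component along both eigenvectors.

The argument covers `e^{-κM} ≤ |ω| ≤ e^{κM}`. Larger frequencies are handled by the tail of `σ`,
which is small because `f` is Lipschitz along the flow off the roof. Smaller ones are handled by
comparison with `ω = 0`, where mean zero and primitivity make ordinary averages over `ζ^n(b)`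
exponentially small. -/

lemma iter_succ' (n : ℕ) (a : Fin m) : ζ.iter (n + 1) a = ζ.onWords^[n] (ζ.word a) := by
  simp [iter, onWords]

lemma iterate_onWords (n : ℕ) (w : List (Fin m)) :
    ζ.onWords^[n] w = w.flatMap (ζ.iter n) := by
  induction n generalizing w with
  | zero =>
    have : ζ.iter 0 = fun a => [a] := rfl
    simp [this]
  | succ n ih =>
    rw [Function.iterate_succ_apply, ih, onWords, List.flatMap_assoc]
    congr 1
    funext a
    rw [iter_succ', ih]

lemma iter_add (n k : ℕ) (b : Fin m) : ζ.iter (n + k) b = (ζ.iter k b).flatMap (ζ.iter n) := by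
  rw [iter, Function.iterate_add_apply, iterate_onWords]
  rfl

lemma iter_zero (b : Fin m) : ζ.iter 0 b = [b] := rfl

lemma count_onWords (w : List (Fin m)) (i : Fin m) :
    (ζ.onWords w).count i = (ζ.matrix.mulVec fun j => w.count j) i := by
  induction w with
  | nil => simp [onWords, Matrix.mulVec, dotProduct]
  | cons a w ih =>
    have h : ζ.onWords (a :: w) = ζ.word a ++ ζ.onWords w := by simp [onWords]
    rw [h, List.count_append, ih]
    simp only [Matrix.mulVec, dotProduct, List.count_cons, mul_add, Finset.sum_add_distrib]
    simp [matrix, add_comm]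

lemma count_iterate_onWords (n : ℕ) (w : List (Fin m)) (i : Fin m) :
    (ζ.onWords^[n] w).count i = ((ζ.matrix ^ n).mulVec fun j => w.count j) i := by
  induction n generalizing i with
  | zero => simp
  | succ n ih =>
    rw [Function.iterate_succ_apply', count_onWords, pow_succ', ← Matrix.mulVec_mulVec]
    congr 2
    funext j
    exact ih j

lemma iter_ne_nil (n : ℕ) (a : Fin m) : ζ.iter n a ≠ [] := by
  induction n with
  | zero => simp [iter_zero]
  | succ n ih =>
    rw [add_comm, iter_add, Ne, List.flatMap_eq_nil_iff]
    obtain ⟨x, hx⟩ := List.exists_mem_of_ne_nil _ ih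
    intro h
    have h1 := h x hx
    rw [iter_succ'] at h1
    exact ζ.word_ne_nil x h1

lemma length_iter_pos (n : ℕ) (a : Fin m) : 0 < (ζ.iter n a).length :=
  List.length_pos_iff.2 (ζ.iter_ne_nil n a)

lemma length_flatMap_le {α β : Type*} (g : α → List β) (L : ℕ) (hL : ∀ a, (g a).length ≤ L)
    (w : List α) : (w.flatMap g).length ≤ w.length * L := by
  induction w with
  | nil => simp
  | cons a w ih =>
    simp only [List.flatMap_cons, List.length_append, List.length_cons]
    have := hL a
    nlinarith

lemma exists_length_iter_le : ∃ Λ : ℕ, 2 ≤ Λ ∧ ∀ n a, (ζ.iter n a).length ≤ Λ ^ n := by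
  refine ⟨2 + ∑ a, (ζ.word a).length, by omega, fun n => ?_⟩
  induction n with
  | zero => simp [iter_zero]
  | succ n ih =>
    intro a
    rw [iter_succ', iterate_onWords, pow_succ']
    refine (length_flatMap_le _ _ ih _).trans (Nat.mul_le_mul_right _ ?_)
    have := Finset.single_le_sum (f := fun a => (ζ.word a).length) (fun _ _ => Nat.zero_le _)
      (Finset.mem_univ a)
    omega

variable {ζ}

lemma IsPrimitive.exists_mem_iter (h : ζ.IsPrimitive) : ∃ p, ∀ a b, a ∈ ζ.iter p b := by
  obtain ⟨p, -, hp⟩ := h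
  refine ⟨p, fun a b => ?_⟩
  have := ζ.count_iterate_onWords p [b] a
  rw [← List.count_pos_iff, iter, this, Matrix.mulVec, dotProduct]
  refine lt_of_lt_of_le (hp a b) ?_
  refine le_trans ?_ (Finset.single_le_sum (f := fun j => (ζ.matrix ^ p) a j * List.count j [b])
    (fun _ _ => Nat.zero_le _) (Finset.mem_univ b))
  simp

lemma length_iter_le_of_mem {n k : ℕ} {a b : Fin m} (h : a ∈ ζ.iter k b) :
    (ζ.iter n a).length ≤ (ζ.iter (n + k) b).length := by
  obtain ⟨P, Q, hPQ⟩ := List.append_of_mem h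
  rw [iter_add, hPQ]
  simp only [List.flatMap_append, List.flatMap_cons, List.length_append]
  omega

/-- For `n = k + p`, the longer word consists of at most `Λ^(p+q)` pieces `ζ^k(a)`, and each of
these sits inside `ζ^(k+p)(c)` because `a` occurs in `ζ^p(c)`. Uniformity in `n` guarantees that one
distinguished subword always fills a fixed fraction of the whole. -/
lemma IsPrimitive.exists_length_iter_le_mul (h : ζ.IsPrimitive) (q : ℕ) :
    ∃ K : ℕ, 0 < K ∧ ∀ n b c, (ζ.iter (n + q) b).length ≤ K * (ζ.iter n c).length := by
  obtain ⟨p, hp⟩ := h.exists_mem_iter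
  obtain ⟨Λ, hΛ, hlen⟩ := ζ.exists_length_iter_le
  refine ⟨Λ ^ (p + q), by positivity, fun n b c => ?_⟩
  have hc := ζ.length_iter_pos n c
  rcases lt_or_ge n p with hn | hn
  · calc _ ≤ Λ ^ (n + q) := hlen _ _
      _ ≤ Λ ^ (p + q) := Nat.pow_le_pow_right (by omega) (by omega)
      _ ≤ _ := Nat.le_mul_of_pos_right _ hc
  · obtain ⟨k, rfl⟩ := Nat.exists_eq_add_of_le' hn
    rw [add_assoc, iter_add]
    refine (length_flatMap_le _ _ (fun a => length_iter_le_of_mem (hp a c)) _).trans ?_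
    exact Nat.mul_le_mul_right _ (hlen _ _)

/-- A primitive substitution has a return word `c :: v` that occurs, followed by `c`, in
`ζ^q(b)` for every letter `b`. -/
lemma IsPrimitive.exists_returnWord (h : ζ.IsPrimitive) (hm : 2 ≤ m) :
    ∃ (q : ℕ) (c : Fin m) (v : List (Fin m)),
      ∀ b, ∃ P Q, ζ.iter q b = P ++ (c :: v) ++ (c :: Q) := by
  obtain ⟨p, hp⟩ := h.exists_mem_iter
  let c : Fin m := ⟨0, by omega⟩
  let d : Fin m := ⟨1, by omega⟩
  have hcd : c ≠ d := by simp [c, d]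
  obtain ⟨x, y, rest, hxy⟩ : ∃ x y rest, ζ.iter p c = x :: y :: rest := by
    have h1 := hp c c
    have h2 := hp d c
    match hw : ζ.iter p c with
    | [] => simp [hw] at h1
    | [x] =>
      rw [hw, List.mem_singleton] at h1 h2
      exact absurd (h1.trans h2.symm) hcd
    | x :: y :: rest => exact ⟨x, y, rest, rfl⟩
  obtain ⟨A, B, hA⟩ := List.append_of_mem (hp c x)
  obtain ⟨C, D, hC⟩ := List.append_of_mem (hp c y)
  refine ⟨p + p + p, c, B ++ C, fun b => ?_⟩
  obtain ⟨E, F, hE⟩ := List.append_of_mem (hp c b)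
  rw [iter_add, hE, List.flatMap_append, List.flatMap_cons, iter_add, hxy]
  simp only [List.flatMap_cons, hA, hC]
  refine ⟨E.flatMap (ζ.iter (p + p)) ++ A, D ++ rest.flatMap (ζ.iter p) ++
    F.flatMap (ζ.iter (p + p)), ?_⟩
  simp

/-! ### Decomposition of words into blocks -/

lemma exists_of_prefix_flatMap {α β : Type*} (g : α → List β) (L : ℕ)
    (hL : ∀ a, (g a).length ≤ L) (w : List α) (B : List β) (h : B <+: w.flatMap g) :
    ∃ (w' : List α) (v : List β), B = w'.flatMap g ++ v ∧ v.length ≤ L := by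
  induction w generalizing B with
  | nil => exact ⟨[], [], by simpa using h, by simp⟩
  | cons a w ih =>
    rw [List.flatMap_cons] at h
    obtain ⟨t, ht⟩ := h
    rcases List.append_eq_append_iff.1 ht with ⟨c, hc1, hc2⟩ | ⟨c, hc1, hc2⟩
    · refine ⟨[], B, by simp, ?_⟩
      have := hL a
      rw [hc1, List.length_append] at this
      omega
    · obtain ⟨w', v, hw', hv⟩ := ih c ⟨t, hc2.symm⟩
      exact ⟨a :: w', v, by simp [hc1, hw'], hv⟩

/-- A factor of a concatenation contains complete blocks except at its two ends, where at most one
partial block remains on each side. -/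
lemma exists_of_infix_flatMap {α β : Type*} (g : α → List β) (L : ℕ)
    (hL : ∀ a, (g a).length ≤ L) (w : List α) (B : List β) (h : B <:+: w.flatMap g) :
    ∃ (u : List β) (w' : List α) (v : List β), B = u ++ w'.flatMap g ++ v ∧
      u.length ≤ L ∧ v.length ≤ L := by
  induction w with
  | nil => exact ⟨[], [], [], by simpa using h, by simp, by simp⟩
  | cons a w ih =>
    rw [List.flatMap_cons] at h
    rcases List.infix_append_iff.1 h with h | h | ⟨u, B', rfl, hu, hB⟩
    · exact ⟨B, [], [], by simp, h.length_le.trans (hL a), by simp⟩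
    · exact ih h
    · obtain ⟨w', v, rfl, hv⟩ := exists_of_prefix_flatMap g L hL w B' hB
      exact ⟨u, w', v, by simp, hu.length_le.trans (hL a), hv⟩

/-- The block `x[0, J)` of a two-sided sequence. -/
def initialBlock (x : ℤ → Fin m) (J : ℕ) : List (Fin m) :=
  (List.range J).map fun j : ℕ => x (j : ℤ)

lemma initialBlock_succ (x : ℤ → Fin m) (J : ℕ) :
    initialBlock x (J + 1) = initialBlock x J ++ [x J] := by
  simp [initialBlock, List.range_succ]

lemma length_initialBlock (x : ℤ → Fin m) (J : ℕ) : (initialBlock x J).length = J := by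
  simp [initialBlock]

lemma initialBlock_infix (x : ℤ → Fin m) (J : ℕ) : initialBlock x J <:+: centralBlock x J := by
  refine List.IsInfix.trans ?_ (List.drop_suffix J _).isInfix
  refine List.IsPrefix.isInfix ?_
  rw [List.prefix_iff_getElem?]
  intro i hi
  rw [length_initialBlock] at hi
  rw [List.getElem?_drop, centralBlock, List.getElem?_ofFn, dif_pos (by omega)]
  simp [initialBlock]

lemma exists_block_decomposition {Λ : ℕ} (hΛ : 1 ≤ Λ)
    (hlen : ∀ n a, (ζ.iter n a).length ≤ Λ ^ n) {x : ℤ → Fin m} (hx : x ∈ ζ.space) (n J : ℕ) :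
    ∃ u w v : List (Fin m), initialBlock x J = u ++ w.flatMap (ζ.iter n) ++ v ∧
      u.length ≤ Λ ^ n ∧ v.length ≤ Λ ^ n := by
  obtain ⟨k, a, hk⟩ := hx J
  have h := (initialBlock_infix x J).trans hk
  rcases le_total n k with hnk | hnk
  · obtain ⟨l, rfl⟩ := Nat.exists_eq_add_of_le hnk
    rw [iter_add] at h
    exact exists_of_infix_flatMap _ _ (hlen n) _ _ h
  -- When the surrounding word has level at most `n`, the block itself is no longer than `Λ^n` and
  -- counts entirely as an end piece.
  · exact ⟨initialBlock x J, [], [], by simp,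
      h.length_le.trans ((hlen k a).trans (Nat.pow_le_pow_right hΛ hnk)), by simp⟩

end Substitution

/-! ### Twisted sums over words -/

/-- The phase factor `e^{-2πix}`. -/
noncomputable def phase (x : ℝ) : ℂ := Complex.exp (-(2 * Real.pi * x : ℝ) * Complex.I)

lemma phase_zero : phase 0 = 1 := by simp [phase]

lemma phase_add (x y : ℝ) : phase (x + y) = phase x * phase y := by
  rw [phase, phase, phase, ← Complex.exp_add]
  congr 1
  push_cast
  ring

lemma norm_phase (x : ℝ) : ‖phase x‖ = 1 := by
  rw [phase, ← Complex.ofReal_neg, Complex.norm_exp_ofReal_mul_I]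

lemma phase_re (x : ℝ) : (phase x).re = Real.cos (2 * Real.pi * x) := by
  rw [phase, ← Complex.ofReal_neg, Complex.exp_ofReal_mul_I_re, Real.cos_neg]

lemma continuous_phase : Continuous phase := by
  unfold phase
  fun_prop

/-- With `y` the signed distance to the nearest integer, `|1 + e^{-2πix}|² = 2 + 2 cos 2πy ≤ 4 -
16y²`, by the quadratic bound for the cosine on `[-π, π]`. This is at most `(2 - 4ρ²)²`. -/
lemma norm_one_add_phase_le {x ρ : ℝ} (hρ : 0 ≤ ρ) (hx : ρ ≤ |x - round x|) :
    ‖1 + phase x‖ ≤ 2 - 4 * ρ ^ 2 := by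
  have h1 : |x - round x| ≤ 1 / 2 := abs_sub_round x
  set y := x - round x with hy
  have hcos : Real.cos (2 * Real.pi * x) = Real.cos (2 * Real.pi * y) := by
    have : 2 * Real.pi * x = 2 * Real.pi * y + (round x : ℤ) * (2 * Real.pi) := by
      rw [hy]; ring
    rw [this, Real.cos_add_int_mul_two_pi]
  have hpi := Real.pi_pos
  have hq : Real.cos (2 * Real.pi * y) ≤ 1 - 8 * y ^ 2 := by
    have := Real.cos_le_one_sub_mul_cos_sq (x := 2 * Real.pi * y) (by
      rw [abs_mul, abs_of_pos (by positivity)]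
      nlinarith)
    refine this.trans (le_of_eq ?_)
    field_simp
    ring
  have hy2 : ρ ^ 2 ≤ y ^ 2 := by
    rw [← sq_abs y]
    exact pow_le_pow_left₀ hρ hx 2
  have hρ2 : ρ ^ 2 ≤ 1 / 4 := by nlinarith
  have hsq : ‖1 + phase x‖ ^ 2 = 2 + 2 * Real.cos (2 * Real.pi * x) := by
    have h := norm_phase x
    rw [Complex.sq_norm, Complex.normSq_add, map_one, ← Complex.sq_norm, h]
    simp [phase_re]
    ring
  refine abs_le_of_sq_le_sq' ?_ (by nlinarith) |>.2
  rw [hsq, hcos]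
  nlinarith [sq_nonneg (ρ ^ 2)]

section TwistedSum

variable {m : ℕ}

/-- The length of a word when the letter `a` has length `s a`. -/
noncomputable def wordLength (s : Fin m → ℝ) (w : List (Fin m)) : ℝ := (w.map s).sum

lemma wordLength_eq_sum (s : Fin m → ℝ) (w : List (Fin m)) :
    wordLength s w = ∑ i, (w.count i : ℝ) * s i := by
  rw [wordLength, Finset.sum_list_map_count]
  simp only [nsmul_eq_mul]
  refine Finset.sum_subset (Finset.subset_univ _) fun i _ hi => ?_
  rw [List.mem_toFinset] at hi
  simp [List.count_eq_zero_of_not_mem hi]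

/-- The twisted sum of `c` over a word: each letter is weighted by the phase of the length of the
word before it. -/
noncomputable def twistedSum (s : Fin m → ℝ) (ω : ℝ) (c : Fin m → ℂ) : List (Fin m) → ℂ
  | [] => 0
  | a :: w => c a + phase (ω * s a) * twistedSum s ω c w

variable (s : Fin m → ℝ) (ω : ℝ) (c : Fin m → ℂ)

lemma twistedSum_append (u v : List (Fin m)) :
    twistedSum s ω c (u ++ v) =
      twistedSum s ω c u + phase (ω * wordLength s u) * twistedSum s ω c v := by
  induction u with
  | nil => simp [twistedSum, wordLength, phase_zero]
  | cons a u ih =>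
    have : wordLength s (a :: u) = s a + wordLength s u := by simp [wordLength]
    rw [List.cons_append, twistedSum, ih, twistedSum, this, mul_add ω, phase_add]
    ring

lemma norm_twistedSum_append_le (u v : List (Fin m)) :
    ‖twistedSum s ω c (u ++ v)‖ ≤ ‖twistedSum s ω c u‖ + ‖twistedSum s ω c v‖ := by
  rw [twistedSum_append]
  refine (norm_add_le _ _).trans ?_
  rw [norm_mul, norm_phase, one_mul]

lemma norm_twistedSum_le {M : ℝ} (hM : ∀ a, ‖c a‖ ≤ M) (w : List (Fin m)) :
    ‖twistedSum s ω c w‖ ≤ M * w.length := by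
  induction w with
  | nil => simp [twistedSum]
  | cons a w ih =>
    rw [twistedSum]
    refine (norm_add_le _ _).trans ?_
    rw [norm_mul, norm_phase, one_mul]
    have := hM a
    push_cast [List.length_cons]
    linarith

lemma norm_twistedSum_flatMap_le (g : Fin m → List (Fin m)) {ρ : ℝ}
    (hg : ∀ a, ‖twistedSum s ω c (g a)‖ ≤ ρ * (g a).length) (w : List (Fin m)) :
    ‖twistedSum s ω c (w.flatMap g)‖ ≤ ρ * (w.flatMap g).length := by
  induction w with
  | nil => simp [twistedSum]
  | cons a w ih =>
    rw [List.flatMap_cons]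
    refine (norm_twistedSum_append_le _ _ _ _ _).trans ?_
    have := hg a
    push_cast [List.length_append]
    linarith

variable (ζ : Substitution m)

/-- The largest twisted sum over a word `ζ^n(b)`, relative to the length of the word. -/
noncomputable def twistedRate (n : ℕ) : ℝ :=
  ⨆ b, ‖twistedSum s ω c (ζ.iter n b)‖ / (ζ.iter n b).length

lemma norm_twistedSum_iter_le (n : ℕ) (b : Fin m) :
    ‖twistedSum s ω c (ζ.iter n b)‖ ≤ twistedRate s ω c ζ n * (ζ.iter n b).length := by
  rw [← div_le_iff₀ (by exact_mod_cast ζ.length_iter_pos n b)]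
  exact le_ciSup (f := fun b => ‖twistedSum s ω c (ζ.iter n b)‖ / (ζ.iter n b).length)
    (Set.finite_range _).bddAbove b

lemma twistedRate_nonneg (n : ℕ) : 0 ≤ twistedRate s ω c ζ n :=
  Real.iSup_nonneg fun _ => by positivity

lemma twistedRate_le {n : ℕ} {B : ℝ} (hB : 0 ≤ B)
    (h : ∀ b, ‖twistedSum s ω c (ζ.iter n b)‖ ≤ B * (ζ.iter n b).length) :
    twistedRate s ω c ζ n ≤ B :=
  Real.iSup_le (fun b => (div_le_iff₀ (by exact_mod_cast ζ.length_iter_pos n b)).2 (h b)) hB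

lemma twistedRate_antitone : Antitone (twistedRate s ω c ζ) := by
  refine antitone_nat_of_succ_le fun n => ?_
  refine twistedRate_le _ _ _ _ (twistedRate_nonneg _ _ _ _ _) fun b => ?_
  rw [Substitution.iter_add]
  exact norm_twistedSum_flatMap_le _ _ _ _ (norm_twistedSum_iter_le s ω c ζ n) _

lemma twistedRate_zero_le {M : ℝ} (hM0 : 0 ≤ M) (hM : ∀ a, ‖c a‖ ≤ M) :
    twistedRate s ω c ζ 0 ≤ M :=
  twistedRate_le _ _ _ _ hM0 fun _ => norm_twistedSum_le _ _ _ hM _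

/-- A return word whose image under `ζ^n` has length far from a multiple of `1 / ω` makes the
twisted sums over the words `ζ^(n + q)(b)` smaller. -/
lemma twistedRate_add_le {q : ℕ} {a : Fin m} {v : List (Fin m)}
    (hv : ∀ b, ∃ P Q, ζ.iter q b = P ++ (a :: v) ++ (a :: Q)) {K : ℕ} (hK : 0 < K)
    (hlen : ∀ n b c, (ζ.iter (n + q) b).length ≤ K * (ζ.iter n c).length) {ρ : ℝ} (hρ : 0 ≤ ρ)
    (n : ℕ) (hn : ρ ≤ |ω * wordLength s (ζ.onWords^[n] (a :: v)) -
      round (ω * wordLength s (ζ.onWords^[n] (a :: v)))|) :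
    twistedRate s ω c ζ (n + q) ≤ (1 - 4 * ρ ^ 2 / K) * twistedRate s ω c ζ n := by
  have hK' : (0 : ℝ) < K := by exact_mod_cast hK
  have hK1 : (1 : ℝ) ≤ K := by exact_mod_cast hK
  have hρ1 := hn.trans (abs_sub_round _)
  have hnorm := norm_one_add_phase_le hρ hn
  have hr0 := twistedRate_nonneg s ω c ζ n
  set R := twistedRate s ω c ζ n
  have hfac : 0 ≤ 1 - 4 * ρ ^ 2 / K := by
    have : 4 * ρ ^ 2 / K ≤ 1 := by
      rw [div_le_one hK']
      nlinarith
    linarith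
  refine twistedRate_le _ _ _ _ (mul_nonneg hfac hr0) fun b => ?_
  obtain ⟨P, Q, hPQ⟩ := hv b
  have hb := norm_twistedSum_iter_le s ω c ζ n
  have hw := norm_twistedSum_flatMap_le s ω c (ζ.iter n) hb
  have hL := hlen n b a
  rw [Substitution.iter_add, hPQ] at hL ⊢
  rw [Substitution.iterate_onWords, List.flatMap_cons] at hnorm
  simp only [List.flatMap_append, List.flatMap_cons, List.append_assoc, List.length_append] at hL ⊢
  set p := P.flatMap (ζ.iter n)
  set α := ζ.iter n a
  set β := v.flatMap (ζ.iter n)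
  set γ := Q.flatMap (ζ.iter n)
  -- The two copies of `α` are collected: their phases differ by exactly the phase of the length of
  -- `α ++ β`, so the trivial coefficient 2 improves to `2 - 4ρ²`.
  have hsplit : twistedSum s ω c (α ++ (β ++ (α ++ γ))) =
      (1 + phase (ω * wordLength s (α ++ β))) * twistedSum s ω c α
      + (phase (ω * wordLength s α) * twistedSum s ω c β
      + phase (ω * wordLength s (α ++ β)) * phase (ω * wordLength s α) *
        twistedSum s ω c γ) := by
    rw [← List.append_assoc, twistedSum_append s ω c (α ++ β), twistedSum_append s ω c α β,
      twistedSum_append s ω c α γ]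
    ring
  have h1 : ‖twistedSum s ω c (α ++ (β ++ (α ++ γ)))‖ ≤
      (2 - 4 * ρ ^ 2) * ‖twistedSum s ω c α‖ + (‖twistedSum s ω c β‖ + ‖twistedSum s ω c γ‖) := by
    rw [hsplit]
    refine (norm_add_le _ _).trans (add_le_add ?_ ((norm_add_le _ _).trans ?_))
    · rw [norm_mul]
      exact mul_le_mul_of_nonneg_right hnorm (norm_nonneg _)
    · simp [norm_phase]
  have h2 := norm_twistedSum_append_le s ω c p (α ++ (β ++ (α ++ γ)))
  have hα := hb a
  have hβ := hw v
  have hγ := hw Q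
  have hp := hw P
  have h3 : (2 - 4 * ρ ^ 2) * ‖twistedSum s ω c α‖ ≤ (2 - 4 * ρ ^ 2) * (R * α.length) :=
    mul_le_mul_of_nonneg_left hα (by nlinarith)
  have hL' : (p.length + (α.length + (β.length + (α.length + γ.length))) : ℝ) ≤ K * α.length := by
    exact_mod_cast hL
  -- The copy of `α` makes up at least the fraction `1/K` of the word, so the gain on `α` is a gain
  -- of `4ρ²/K` relative to the total length.
  have h4 : 4 * ρ ^ 2 / K * R * (p.length + (α.length + (β.length + (α.length + γ.length))) : ℝ)
      ≤ 4 * ρ ^ 2 * R * α.length := by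
    calc _ ≤ 4 * ρ ^ 2 / K * R * (K * α.length) := by gcongr
      _ = _ := by field_simp
  push_cast
  linarith

/-- If `R` is antitone and each index of a set `T` causes, `q` steps later, a decrease by the
factor `κ`, then `R` decays geometrically in the number of elements of `T`. -/
lemma pow_le_of_antitone_of_mul_le {R : ℕ → ℝ} (hR : Antitone R) (h0 : ∀ n, 0 ≤ R n) {κ : ℝ}
    (hκ : 0 ≤ κ) {q : ℕ} (hq : 0 < q) (N : ℕ) (T : Finset ℕ)
    (hT : ∀ n ∈ T, R (n + q) ≤ κ * R n) (hTN : T ⊆ Finset.range N) :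
    R (N + q) ^ q ≤ R 0 ^ q * κ ^ T.card := by
  -- The product over a window of `q` consecutive values is tracked. Sliding the window by one
  -- replaces `R N` by `R (N + q)`, which gains `κ` for every `N ∈ T`; overlapping steps thus all
  -- count and no `q`-separated subset of `T` is selected. The price is the exponent `q` in the
  -- conclusion.
  have key : ∀ N, ∏ j ∈ Finset.range q, R (N + j) ≤
      R 0 ^ q * κ ^ (T.filter (· < N)).card := by
    intro N
    induction N with
    | zero =>
      simp only [zero_add, not_lt_zero, Finset.filter_false, Finset.card_empty, pow_zero, mul_one]
      calc _ ≤ ∏ j ∈ Finset.range q, R 0 :=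
            Finset.prod_le_prod (fun _ _ => h0 _) fun j _ => hR (Nat.zero_le j)
        _ = _ := by simp
    | succ N ih =>
      have hprod : R N * ∏ j ∈ Finset.range q, R (N + 1 + j) =
          R (N + q) * ∏ j ∈ Finset.range q, R (N + j) := by
        have h1 := Finset.prod_range_succ (fun j => R (N + j)) q
        rw [Finset.prod_range_succ'] at h1
        simp only [add_zero] at h1
        rw [mul_comm, mul_comm (R (N + q)), ← h1]
        congr 1
        refine Finset.prod_congr rfl fun j _ => ?_
        congr 1
        ring
      have hp0 : ∀ N, 0 ≤ ∏ j ∈ Finset.range q, R (N + j) :=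
        fun N => Finset.prod_nonneg fun _ _ => h0 _
      have hmono : ∏ j ∈ Finset.range q, R (N + 1 + j) ≤ ∏ j ∈ Finset.range q, R (N + j) :=
        Finset.prod_le_prod (fun _ _ => h0 _) fun j _ => hR (by omega)
      by_cases hN : N ∈ T
      · have hcard : (T.filter (· < N + 1)).card = (T.filter (· < N)).card + 1 := by
          have : T.filter (· < N + 1) = insert N (T.filter (· < N)) := by
            ext j
            simp only [Finset.mem_filter, Finset.mem_insert]
            grind
          rw [this, Finset.card_insert_of_notMem (by simp)]
        rw [hcard, pow_succ]
        have hle : ∏ j ∈ Finset.range q, R (N + 1 + j) ≤ κ * ∏ j ∈ Finset.range q, R (N + j) := by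
          -- Comparison of the windows divides by `R N`. If `R N = 0`, monotonicity makes the new
          -- window vanish.
          rcases (h0 N).eq_or_lt with hz | hpos
          · have : ∏ j ∈ Finset.range q, R (N + 1 + j) = 0 := by
              refine Finset.prod_eq_zero (Finset.mem_range.2 hq) ?_
              exact le_antisymm ((hR (by omega)).trans hz.ge) (h0 _)
            rw [this]
            exact mul_nonneg hκ (hp0 N)
          · refine le_of_mul_le_mul_left ?_ hpos
            rw [hprod]
            calc _ ≤ κ * R N * ∏ j ∈ Finset.range q, R (N + j) :=
                  mul_le_mul_of_nonneg_right (hT N hN) (hp0 N)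
              _ = _ := by ring
        calc _ ≤ _ := hle
          _ ≤ κ * _ := mul_le_mul_of_nonneg_left ih hκ
          _ = _ := by ring
      · have hcard : T.filter (· < N + 1) = T.filter (· < N) := by
          ext j
          simp only [Finset.mem_filter]
          grind
        rw [hcard]
        exact hmono.trans ih
  have hfil : T.filter (· < N) = T := Finset.filter_true_of_mem fun n hn =>
    Finset.mem_range.1 (hTN hn)
  have := key N
  rw [hfil] at this
  refine le_trans ?_ this
  calc _ = ∏ j ∈ Finset.range q, R (N + q) := by simp
    _ ≤ _ := Finset.prod_le_prod (fun _ _ => h0 _) fun j hj => hR (by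
      have := Finset.mem_range.1 hj
      omega)

end TwistedSum

/-! ### Averages over long words -/

section Average

variable {m : ℕ}

lemma wordLength_append (s : Fin m → ℝ) (u v : List (Fin m)) :
    wordLength s (u ++ v) = wordLength s u + wordLength s v := by
  simp [wordLength]

lemma wordLength_neg (s : Fin m → ℝ) (w : List (Fin m)) :
    wordLength (-s) w = -wordLength s w := by
  simp [wordLength_eq_sum]

lemma abs_wordLength_le {F : Fin m → ℝ} {M : ℝ} (hM : ∀ a, |F a| ≤ M) (w : List (Fin m)) :
    |wordLength F w| ≤ M * w.length := by
  induction w with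
  | nil => simp [wordLength]
  | cons a w ih =>
    have : wordLength F (a :: w) = F a + wordLength F w := by simp [wordLength]
    rw [this]
    refine (abs_add_le _ _).trans ?_
    have := hM a
    push_cast [List.length_cons]
    linarith

lemma wordLength_flatMap_le {F : Fin m → ℝ} (g : Fin m → List (Fin m)) {U : ℝ}
    (hg : ∀ a, wordLength F (g a) ≤ U * (g a).length) (w : List (Fin m)) :
    wordLength F (w.flatMap g) ≤ U * (w.flatMap g).length := by
  induction w with
  | nil => simp [wordLength]
  | cons a w ih =>
    rw [List.flatMap_cons, wordLength_append]
    have := hg a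
    push_cast [List.length_append]
    linarith

variable (F : Fin m → ℝ) (ζ : Substitution m)

/-- The largest average of `F` over a word `ζ^n(b)`. -/
noncomputable def maxAverage (n : ℕ) : ℝ :=
  ⨆ b, wordLength F (ζ.iter n b) / (ζ.iter n b).length

lemma wordLength_iter_le (n : ℕ) (b : Fin m) :
    wordLength F (ζ.iter n b) ≤ maxAverage F ζ n * (ζ.iter n b).length := by
  rw [← div_le_iff₀ (by exact_mod_cast ζ.length_iter_pos n b)]
  exact le_ciSup (f := fun b => wordLength F (ζ.iter n b) / (ζ.iter n b).length)
    (Set.finite_range _).bddAbove b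

lemma maxAverage_le [Nonempty (Fin m)] {n : ℕ} {B : ℝ}
    (h : ∀ b, wordLength F (ζ.iter n b) ≤ B * (ζ.iter n b).length) :
    maxAverage F ζ n ≤ B :=
  ciSup_le fun b => (div_le_iff₀ (by exact_mod_cast ζ.length_iter_pos n b)).2 (h b)

lemma abs_maxAverage_le [Nonempty (Fin m)] {M : ℝ} (hM : ∀ a, |F a| ≤ M) (n : ℕ) :
    |maxAverage F ζ n| ≤ M := by
  obtain ⟨b⟩ := ‹Nonempty (Fin m)›
  have hpos : (0 : ℝ) < (ζ.iter n b).length := by exact_mod_cast ζ.length_iter_pos n b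
  rw [abs_le]
  constructor
  · have h1 := wordLength_iter_le F ζ n b
    have h2 := (abs_le.1 (abs_wordLength_le hM (ζ.iter n b))).1
    nlinarith
  · have : Nonempty (Fin m) := ⟨b⟩
    exact maxAverage_le F ζ fun b => (abs_le.1 (abs_wordLength_le hM _)).2

lemma maxAverage_add_le [Nonempty (Fin m)] (n k : ℕ) :
    maxAverage F ζ (n + k) ≤ maxAverage F ζ n := by
  refine maxAverage_le F ζ fun b => ?_
  rw [Substitution.iter_add]
  exact wordLength_flatMap_le _ (wordLength_iter_le F ζ n) _

lemma exists_wordLength_iter_eq [Nonempty (Fin m)] (n : ℕ) :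
    ∃ b, wordLength F (ζ.iter n b) = maxAverage F ζ n * (ζ.iter n b).length := by
  obtain ⟨b, hb⟩ := exists_eq_ciSup_of_finite
    (f := fun b => wordLength F (ζ.iter n b) / (ζ.iter n b).length)
  refine ⟨b, ?_⟩
  have hpos : (0 : ℝ) < (ζ.iter n b).length := by exact_mod_cast ζ.length_iter_pos n b
  rw [maxAverage, ← hb]
  field_simp

/-- The oscillation of the averages over the words `ζ^n(b)`. -/
noncomputable def averageOsc (n : ℕ) : ℝ := maxAverage F ζ n + maxAverage (-F) ζ n

/-- Every `ζ^(n+p)(b)` contains the word `ζ^n(a)` with the smallest average, which fills at least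
the fraction `1/K`. This pulls the largest average down by `1/K` of the oscillation, while the
smallest average does not decrease. -/
lemma averageOsc_add_le [Nonempty (Fin m)] {p K : ℕ} (hp : ∀ a b, a ∈ ζ.iter p b) (hK : 0 < K)
    (hlen : ∀ n b c, (ζ.iter (n + p) b).length ≤ K * (ζ.iter n c).length) (n : ℕ) :
    averageOsc F ζ (n + p) ≤ (1 - (K : ℝ)⁻¹) * averageOsc F ζ n := by
  have hK' : (0 : ℝ) < K := by exact_mod_cast hK
  obtain ⟨a, ha⟩ := exists_wordLength_iter_eq (-F) ζ n
  rw [wordLength_neg] at ha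
  have hosc : 0 ≤ averageOsc F ζ n := by
    have hpos : (0 : ℝ) < (ζ.iter n a).length := by exact_mod_cast ζ.length_iter_pos n a
    have := wordLength_iter_le F ζ n a
    rw [averageOsc]
    nlinarith
  have h1 : maxAverage F ζ (n + p) ≤ maxAverage F ζ n - (K : ℝ)⁻¹ * averageOsc F ζ n := by
    refine maxAverage_le F ζ fun b => ?_
    obtain ⟨P, Q, hPQ⟩ := List.append_of_mem (hp a b)
    have hL := hlen n b a
    have hw := wordLength_flatMap_le (F := F) _ (wordLength_iter_le F ζ n)
    have hP := hw P
    have hQ := hw Q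
    rw [Substitution.iter_add, hPQ] at hL ⊢
    simp only [List.flatMap_append, List.flatMap_cons, List.length_append,
      wordLength_append] at hL ⊢
    set p := P.flatMap (ζ.iter n)
    set α := ζ.iter n a
    set γ := Q.flatMap (ζ.iter n)
    have hL' : (p.length + (α.length + γ.length) : ℝ) ≤ K * α.length := by exact_mod_cast hL
    have h4 : (K : ℝ)⁻¹ * averageOsc F ζ n * (p.length + (α.length + γ.length) : ℝ)
        ≤ averageOsc F ζ n * α.length := by
      calc _ ≤ (K : ℝ)⁻¹ * averageOsc F ζ n * (K * α.length) := by gcongr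
        _ = _ := by field_simp
    rw [averageOsc] at h4 ⊢
    push_cast
    linarith
  have h2 := maxAverage_add_le (-F) ζ n p
  rw [averageOsc] at h1 hosc ⊢
  rw [averageOsc]
  linarith

/-- Only the two end pieces are not averaged. They contribute at most `2MΛ^n`, and replacing the
length of the middle part by `J` costs as much again. -/
lemma wordLength_initialBlock_le [Nonempty (Fin m)] {Λ : ℕ} (hΛ : 1 ≤ Λ)
    (hlen : ∀ n a, (ζ.iter n a).length ≤ Λ ^ n) {M : ℝ} (hM : ∀ a, |F a| ≤ M)
    {x : ℤ → Fin m} (hx : x ∈ ζ.space) (n J : ℕ) :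
    wordLength F (Substitution.initialBlock x J) ≤
      maxAverage F ζ n * J + 4 * M * Λ ^ n := by
  obtain ⟨u, w, v, hB, hu, hv⟩ := Substitution.exists_block_decomposition hΛ hlen hx n J
  have hM0 : 0 ≤ M := (abs_nonneg _).trans (hM (Classical.arbitrary _))
  have hJ := Substitution.length_initialBlock x J
  rw [hB] at hJ ⊢
  simp only [List.length_append] at hJ
  rw [wordLength_append, wordLength_append, ← hJ]
  have h1 := (abs_le.1 (abs_wordLength_le hM u)).2
  have h2 := (abs_le.1 (abs_wordLength_le hM v)).2
  have h3 := wordLength_flatMap_le _ (wordLength_iter_le F ζ n) w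
  have h4 := (abs_le.1 (abs_maxAverage_le F ζ hM n)).1
  have hu' : (u.length : ℝ) ≤ (Λ : ℝ) ^ n := by exact_mod_cast hu
  have hv' : (v.length : ℝ) ≤ (Λ : ℝ) ^ n := by exact_mod_cast hv
  have hu0 : (0 : ℝ) ≤ u.length := Nat.cast_nonneg _
  have hv0 : (0 : ℝ) ≤ v.length := Nat.cast_nonneg _
  push_cast
  nlinarith

lemma measurable_comp_apply {β : Type*} [MeasurableSpace β] (g : Fin m → β) (k : ℤ) :
    Measurable fun x : ℤ → Fin m => g (x k) :=
  (measurable_of_finite g).comp (measurable_pi_apply k)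

variable {ζ} in
lemma Substitution.IsInvariantMeasure.integral_apply {μ : Measure (ℤ → Fin m)}
    (hμ : ζ.IsInvariantMeasure μ) (j : ℕ) :
    ∫ x, F (x j) ∂μ = ∫ x, F (x 0) ∂μ := by
  induction j with
  | zero => simp
  | succ j ih =>
    have h := integral_map hμ.invariant.measurable.aemeasurable
      (measurable_comp_apply F (j : ℤ)).aestronglyMeasurable (μ := μ)
    rw [hμ.invariant.map_eq] at h
    rw [← ih, h]
    simp [Substitution.shift]

variable {ζ} in
-- By invariance `J ∫ F` is the integral of a Birkhoff sum of length `J`, which is at most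
-- `maxAverage` times `J` plus a term independent of `J`; let `J → ∞`. This bound, for `F` and `-F`,
-- links mean zero for any invariant measure to averages over words.
lemma Substitution.IsInvariantMeasure.integral_le_maxAverage [Nonempty (Fin m)]
    {μ : Measure (ℤ → Fin m)} (hμ : ζ.IsInvariantMeasure μ) (n : ℕ) :
    ∫ x, F (x 0) ∂μ ≤ maxAverage F ζ n := by
  have := hμ.isProbabilityMeasure
  obtain ⟨Λ, hΛ, hlen⟩ := ζ.exists_length_iter_le
  obtain ⟨M, hM⟩ : ∃ M, ∀ a, |F a| ≤ M :=
    ⟨∑ a, |F a|, fun a => Finset.single_le_sum (f := fun a => |F a|) (fun _ _ => abs_nonneg _)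
      (Finset.mem_univ a)⟩
  have hint : ∀ j : ℕ, Integrable (fun x : ℤ → Fin m => F (x j)) μ := fun j =>
    Integrable.of_bound
      (measurable_comp_apply F _).aestronglyMeasurable M
      (Filter.Eventually.of_forall fun x => hM _)
  have hsum : ∀ (J : ℕ) (x : ℤ → Fin m), wordLength F (Substitution.initialBlock x J) =
      ∑ j ∈ Finset.range J, F (x j) := by
    intro J x
    induction J with
    | zero => simp [Substitution.initialBlock, wordLength]
    | succ J ih =>
      rw [Substitution.initialBlock_succ, wordLength_append, ih, Finset.sum_range_succ]
      simp [wordLength]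
  have hJ : ∀ J : ℕ, J * ∫ x, F (x 0) ∂μ ≤ maxAverage F ζ n * J + 4 * M * Λ ^ n := by
    intro J
    have h1 : ∫ x, ∑ j ∈ Finset.range J, F (x j) ∂μ = J * ∫ x, F (x 0) ∂μ := by
      rw [integral_finsetSum _ fun j _ => hint j]
      simp only [hμ.integral_apply F]
      simp
    rw [← h1]
    have h2 : ∫ _x : ℤ → Fin m, (maxAverage F ζ n * J + 4 * M * Λ ^ n) ∂μ =
        maxAverage F ζ n * J + 4 * M * Λ ^ n := by simp
    rw [← h2]
    refine integral_mono_ae (integrable_finsetSum _ fun j _ => hint j) (integrable_const _) ?_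
    have hx : ∀ᵐ x ∂μ, x ∈ ζ.space := by
      rw [ae_iff]
      exact hμ.carried
    filter_upwards [hx] with x hx
    rw [← hsum]
    exact wordLength_initialBlock_le F ζ (by omega) hlen hM hx n J
  by_contra! hcon
  obtain ⟨J, hJ'⟩ := exists_nat_gt (4 * M * Λ ^ n / (∫ x, F (x 0) ∂μ - maxAverage F ζ n))
  rw [div_lt_iff₀ (by linarith)] at hJ'
  have := hJ J
  nlinarith

end Average

section TwistedAverage

variable {m : ℕ} {ζ : Substitution m}

/-- For a function of mean zero, the averages over the words `ζ^n(b)` are exponentially small. -/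
lemma Substitution.IsPrimitive.exists_abs_wordLength_iter_le [Nonempty (Fin m)]
    (h : ζ.IsPrimitive) : ∃ (p : ℕ) (κ : ℝ), 0 ≤ κ ∧ κ < 1 ∧
      ∀ (F : Fin m → ℝ) (M : ℝ), (∀ a, |F a| ≤ M) → ∀ μ, ζ.IsInvariantMeasure μ →
        ∫ x, F (x 0) ∂μ = 0 → ∀ k b,
          |wordLength F (ζ.iter (p * k) b)| ≤ 2 * M * κ ^ k * (ζ.iter (p * k) b).length := by
  obtain ⟨p, hp⟩ := h.exists_mem_iter
  obtain ⟨K, hK, hlen⟩ := h.exists_length_iter_le_mul p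
  have hK' : (1 : ℝ) ≤ K := by exact_mod_cast hK
  refine ⟨p, 1 - (K : ℝ)⁻¹, by simpa using inv_le_one_of_one_le₀ hK',
    by simp; positivity, fun F M hM μ hμ h0 k b => ?_⟩
  have hM' : ∀ a, |(-F) a| ≤ M := by simpa using hM
  have hosc : averageOsc F ζ (p * k) ≤ 2 * M * (1 - (K : ℝ)⁻¹) ^ k := by
    induction k with
    | zero =>
      have h1 := (abs_le.1 (abs_maxAverage_le F ζ hM 0)).2
      have h2 := (abs_le.1 (abs_maxAverage_le (-F) ζ hM' 0)).2
      simp only [mul_zero, averageOsc, pow_zero, mul_one]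
      linarith
    | succ k ih =>
      have := averageOsc_add_le F ζ hp hK hlen (p * k)
      rw [mul_add, mul_one, pow_succ]
      refine this.trans ?_
      have h1 : 0 ≤ 1 - (K : ℝ)⁻¹ := by simpa using inv_le_one_of_one_le₀ hK'
      calc _ ≤ (1 - (K : ℝ)⁻¹) * (2 * M * (1 - (K : ℝ)⁻¹) ^ k) := mul_le_mul_of_nonneg_left ih h1
        _ = _ := by ring
  -- Mean zero makes the maximal averages of `F` and of `-F` both nonnegative, so each is bounded by
  -- their sum, the oscillation.
  have h1 := hμ.integral_le_maxAverage F (p * k)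
  have h2 := hμ.integral_le_maxAverage (-F) (p * k)
  simp only [Pi.neg_apply, integral_neg, h0, neg_zero] at h1 h2
  have h3 := wordLength_iter_le F ζ (p * k) b
  have h4 := wordLength_iter_le (-F) ζ (p * k) b
  rw [wordLength_neg] at h4
  have hpos : (0 : ℝ) < (ζ.iter (p * k) b).length := by exact_mod_cast ζ.length_iter_pos _ b
  rw [averageOsc] at hosc
  rw [abs_le]
  constructor <;> nlinarith

lemma twistedSum_zero_re (s : Fin m → ℝ) (c : Fin m → ℂ) (w : List (Fin m)) :
    (twistedSum s 0 c w).re = wordLength (fun a => (c a).re) w := by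
  induction w with
  | nil => simp [twistedSum, wordLength]
  | cons a w ih =>
    rw [twistedSum, zero_mul, phase_zero, one_mul, Complex.add_re, ih]
    simp [wordLength]

lemma twistedSum_zero_im (s : Fin m → ℝ) (c : Fin m → ℂ) (w : List (Fin m)) :
    (twistedSum s 0 c w).im = wordLength (fun a => (c a).im) w := by
  induction w with
  | nil => simp [twistedSum, wordLength]
  | cons a w ih =>
    rw [twistedSum, zero_mul, phase_zero, one_mul, Complex.add_im, ih]
    simp [wordLength]

/-- At `ω = 0` all phases are 1 and twisted sums are ordinary sums. The real estimate is applied to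
the real and imaginary parts, which doubles the constant. -/
lemma Substitution.IsPrimitive.exists_twistedRate_zero_le [Nonempty (Fin m)]
    (h : ζ.IsPrimitive) : ∃ (p : ℕ) (κ : ℝ), 0 ≤ κ ∧ κ < 1 ∧
      ∀ (s : Fin m → ℝ) (c : Fin m → ℂ) (M : ℝ), 0 ≤ M → (∀ a, ‖c a‖ ≤ M) →
        ∀ μ, ζ.IsInvariantMeasure μ → ∫ x, c (x 0) ∂μ = 0 → ∀ k,
          twistedRate s 0 c ζ (p * k) ≤ 4 * M * κ ^ k := by
  obtain ⟨p, κ, hκ0, hκ1, H⟩ := h.exists_abs_wordLength_iter_le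
  refine ⟨p, κ, hκ0, hκ1, fun s c M hM0 hM μ hμ h0 k => ?_⟩
  have := hμ.isProbabilityMeasure
  have hint : Integrable (fun x : ℤ → Fin m => c (x 0)) μ :=
    Integrable.of_bound
      (measurable_comp_apply c _).aestronglyMeasurable M
      (Filter.Eventually.of_forall fun x => hM _)
  have hre : ∫ x, (c (x 0)).re ∂μ = 0 := by
    have := integral_re hint
    rw [h0] at this
    simpa using this
  have him : ∫ x, (c (x 0)).im ∂μ = 0 := by
    have := integral_im hint
    rw [h0] at this
    simpa using this
  refine twistedRate_le _ _ _ _ (by positivity) fun b => ?_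
  have h1 := H (fun a => (c a).re) M (fun a => (Complex.abs_re_le_norm _).trans (hM a)) μ hμ hre k b
  have h2 := H (fun a => (c a).im) M (fun a => (Complex.abs_im_le_norm _).trans (hM a)) μ hμ him k b
  refine (Complex.norm_le_abs_re_add_abs_im _).trans ?_
  rw [twistedSum_zero_re, twistedSum_zero_im]
  linarith

lemma norm_twistedSum_initialBlock_le {Λ : ℕ} (hΛ : 1 ≤ Λ)
    (hlen : ∀ n a, (ζ.iter n a).length ≤ Λ ^ n) (s : Fin m → ℝ) (ω : ℝ) {c : Fin m → ℂ} {M : ℝ}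
    (hM0 : 0 ≤ M) (hM : ∀ a, ‖c a‖ ≤ M) {x : ℤ → Fin m} (hx : x ∈ ζ.space) (n J : ℕ) :
    ‖twistedSum s ω c (Substitution.initialBlock x J)‖ ≤
      2 * M * Λ ^ n + twistedRate s ω c ζ n * J := by
  obtain ⟨u, w, v, hB, hu, hv⟩ := Substitution.exists_block_decomposition hΛ hlen hx n J
  have hJ := Substitution.length_initialBlock x J
  rw [hB] at hJ ⊢
  simp only [List.length_append] at hJ
  have h0 := norm_twistedSum_append_le s ω c (u ++ w.flatMap (ζ.iter n)) v
  have h0' := norm_twistedSum_append_le s ω c u (w.flatMap (ζ.iter n))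
  have h1 := norm_twistedSum_le s ω c hM u
  have h2 := norm_twistedSum_le s ω c hM v
  have h3 := norm_twistedSum_flatMap_le s ω c _ (norm_twistedSum_iter_le s ω c ζ n) w
  have hu' : (u.length : ℝ) ≤ (Λ : ℝ) ^ n := by exact_mod_cast hu
  have hv' : (v.length : ℝ) ≤ (Λ : ℝ) ^ n := by exact_mod_cast hv
  have hwJ : ((w.flatMap (ζ.iter n)).length : ℝ) ≤ J := by
    have : (w.flatMap (ζ.iter n)).length ≤ J := by omega
    exact_mod_cast this
  have h4 := mul_le_mul_of_nonneg_left hwJ (twistedRate_nonneg s ω c ζ n)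
  have h5 := mul_le_mul_of_nonneg_left hu' hM0
  have h6 := mul_le_mul_of_nonneg_left hv' hM0
  linarith

end TwistedAverage

/-! ### Slabs in the simplex -/

section Slab

/-- The shear that replaces the coordinate `u i` by the linear form has determinant `c i` and
carries the set into a box with one side `2ε` and all others 1. -/
lemma volume_slab_le {k : ℕ} (c₀ : ℝ) (c : Fin k → ℝ) (i : Fin k) (hi : c i ≠ 0) (ε : ℝ) :
    volume {u : Fin k → ℝ | u ∈ Icc (0 : Fin k → ℝ) 1 ∧ |c₀ + ∑ j, c j * u j| ≤ ε} ≤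
      ENNReal.ofReal (2 * ε / |c i|) := by
  let A : Matrix (Fin k) (Fin k) ℝ := (1 : Matrix (Fin k) (Fin k) ℝ).updateRow i c
  have hdet : LinearMap.det (Matrix.toLin' A) = c i := by
    rw [LinearMap.det_toLin', ← Matrix.cramer_transpose_apply, Matrix.transpose_one,
      Matrix.cramer_one]
    rfl
  have hA : ∀ u : Fin k → ℝ, Matrix.toLin' A u = Function.update u i (∑ j, c j * u j) := by
    intro u
    rw [Matrix.toLin'_apply]
    ext j
    by_cases hj : j = i
    · subst hj
      simp [A, Matrix.mulVec, dotProduct]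
    · simp [A, Matrix.mulVec, dotProduct, hj, Matrix.one_apply]
  let a : Fin k → ℝ := Function.update 0 i (-c₀ - ε)
  let b : Fin k → ℝ := Function.update 1 i (-c₀ + ε)
  have hsub : {u : Fin k → ℝ | u ∈ Icc (0 : Fin k → ℝ) 1 ∧ |c₀ + ∑ j, c j * u j| ≤ ε} ⊆
      (Matrix.toLin' A) ⁻¹' Icc a b := by
    rintro u ⟨⟨hu0, hu1⟩, hu⟩
    rw [abs_le] at hu
    rw [mem_preimage, hA]
    constructor <;> intro j
    · by_cases hj : j = i
      · subst hj
        simp only [a, Function.update_self]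
        linarith
      · simpa [a, hj] using hu0 j
    · by_cases hj : j = i
      · subst hj
        simp only [b, Function.update_self]
        linarith
      · simpa [b, hj] using hu1 j
  refine (measure_mono hsub).trans ?_
  rw [Measure.addHaar_preimage_linearMap _ (by rw [hdet]; exact hi), hdet, Real.volume_Icc_pi,
    Finset.prod_eq_single i]
  · simp only [a, b, Function.update_self]
    rw [abs_inv, ENNReal.ofReal_inv_of_pos (abs_pos.2 hi), ENNReal.ofReal_div_of_pos (abs_pos.2 hi),
      div_eq_mul_inv, mul_comm]
    gcongr
    exact le_of_eq (by ring)
  · intro j _ hj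
    simp [a, b, hj]
  · simp

/-- The parametrization of the hyperplane that contains the simplex. -/
def hyperplaneParam (k : ℕ) (u : Fin k → ℝ) : Fin (k + 1) → ℝ := Fin.cons (1 - ∑ i, u i) u

lemma lipschitzWith_hyperplaneParam (k : ℕ) :
    LipschitzWith (k + 1 : ℝ≥0) (hyperplaneParam k) := by
  refine LipschitzWith.of_dist_le_mul fun u v => ?_
  have hd : 0 ≤ dist u v := dist_nonneg
  rw [dist_pi_le_iff (by positivity)]
  push_cast
  intro i
  refine Fin.cases ?_ (fun j => ?_) i
  · simp only [hyperplaneParam, Fin.cons_zero, Real.dist_eq]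
    have h1 : 1 - ∑ i, u i - (1 - ∑ i, v i) = ∑ i, (v i - u i) := by
      rw [Finset.sum_sub_distrib]
      ring
    rw [h1]
    have h2 : ∑ i, |v i - u i| ≤ ∑ _i : Fin k, dist u v := Finset.sum_le_sum fun i _ => by
      rw [dist_comm]
      exact dist_le_pi_dist v u i
    simp only [Finset.sum_const, Finset.card_univ, Fintype.card_fin, nsmul_eq_mul] at h2
    have := Finset.abs_sum_le_sum_abs (fun i => v i - u i) Finset.univ
    linarith
  · simp only [hyperplaneParam, Fin.cons_succ]
    have := dist_le_pi_dist u v j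
    have : 0 ≤ k * dist u v := by positivity
    linarith

lemma measurableSet_positiveSimplex (m : ℕ) : MeasurableSet (positiveSimplex m) := by
  have h : positiveSimplex m = (⋂ i, {s | 0 < s i}) ∩ {s | ∑ i, s i = 1} := by
    ext s
    simp [positiveSimplex]
  rw [h]
  exact (MeasurableSet.iInter fun i =>
    measurableSet_lt measurable_const (measurable_pi_apply i)).inter
    (measurableSet_eq_fun (by fun_prop) measurable_const)

/-- The simplex is a Lipschitz image of a subset of the unit cube, and Lipschitz maps increase
Hausdorff measure by a controlled factor. Only this direction is needed to show that sets are null.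
-/
lemma simplexMeasure_le (k : ℕ) (A : Set (Fin (k + 1) → ℝ)) :
    simplexMeasure (k + 1) A ≤ ((k + 1 : ℝ≥0) : ENNReal) ^ (k : ℝ) *
      volume {u : Fin k → ℝ | u ∈ Icc (0 : Fin k → ℝ) 1 ∧ ∑ i, u i < 1 ∧
        hyperplaneParam k u ∈ A} := by
  set B := {u : Fin k → ℝ | u ∈ Icc (0 : Fin k → ℝ) 1 ∧ ∑ i, u i < 1 ∧ hyperplaneParam k u ∈ A}
  have hsub : A ∩ positiveSimplex (k + 1) ⊆ hyperplaneParam k '' B := by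
    rintro s ⟨hs, hpos, hsum⟩
    rw [Fin.sum_univ_succ] at hsum
    have hP : hyperplaneParam k (Fin.tail s) = s := by
      have : 1 - ∑ i, Fin.tail s i = s 0 := by
        simp only [Fin.tail]
        linarith
      rw [hyperplaneParam, this, Fin.cons_self_tail]
    have h0 := hpos 0
    refine ⟨Fin.tail s, ⟨⟨fun i => (hpos _).le, fun i => ?_⟩, ?_, by rwa [hP]⟩, hP⟩
    · have := Finset.single_le_sum (f := fun i : Fin k => s i.succ) (fun i _ => (hpos _).le)
        (Finset.mem_univ i)
      simp only [Fin.tail, Pi.one_apply] at this ⊢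
      linarith
    · simp only [Fin.tail]
      linarith
  have hdim : ((k + 1 : ℕ) : ℝ) - 1 = (Fintype.card (Fin k) : ℕ) := by simp
  rw [simplexMeasure, Measure.restrict_apply' (measurableSet_positiveSimplex _), hdim]
  refine (measure_mono hsub).trans ?_
  refine ((lipschitzWith_hyperplaneParam k).hausdorffMeasure_image_le (by positivity) B).trans ?_
  rw [hausdorffMeasure_pi_real]
  simp

/-- In the parameters `u` the form becomes `g₀ + ∑ (g_j - g₀) u_j`. If some difference is at least
`‖g‖/4`, the shear estimate gives `8ε`. Otherwise `g` is nearly constant, `|g₀| ≥ 3‖g‖/4`, and since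
`∑ u_j < 1` the form is at least `‖g‖/2` in modulus: the slab is empty for `ε < 1/2`, and for `ε ≥
1/2` the bound is trivial. -/
lemma exists_simplexMeasure_slab_le (k : ℕ) : ∃ C : ℝ, 0 ≤ C ∧
    ∀ (g : Fin (k + 1) → ℝ) (ε : ℝ), g ≠ 0 → 0 ≤ ε →
      simplexMeasure (k + 1) {s | |∑ i, g i * s i| ≤ ε * ‖g‖} ≤ ENNReal.ofReal (C * ε) := by
  refine ⟨((k + 1 : ℝ)) ^ (k : ℝ) * 8, by positivity, fun g ε hg hε => ?_⟩
  have hgpos : 0 < ‖g‖ := norm_pos_iff.2 hg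
  refine (simplexMeasure_le k _).trans ?_
  have hsum : ∀ u, ∑ i, g i * hyperplaneParam k u i =
      g 0 + ∑ j : Fin k, (g j.succ - g 0) * u j := by
    intro u
    simp only [Fin.sum_univ_succ, hyperplaneParam, Fin.cons_zero, Fin.cons_succ, sub_mul,
      Finset.sum_sub_distrib, ← Finset.mul_sum]
    ring
  have hvol : volume {u : Fin k → ℝ | u ∈ Icc (0 : Fin k → ℝ) 1 ∧ ∑ i, u i < 1 ∧
      hyperplaneParam k u ∈ {s | |∑ i, g i * s i| ≤ ε * ‖g‖}} ≤ ENNReal.ofReal (8 * ε) := by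
    simp only [mem_ofPred_eq, hsum]
    by_cases hex : ∃ i : Fin k, ‖g‖ / 4 ≤ |g i.succ - g 0|
    · obtain ⟨i, hi⟩ := hex
      have hi0 : 0 < |g i.succ - g 0| := by linarith
      refine le_trans (measure_mono ?_) ((volume_slab_le (g 0) (fun j => g j.succ - g 0) i
        (abs_pos.1 hi0) (ε * ‖g‖)).trans (ENNReal.ofReal_le_ofReal ?_))
      · rintro u ⟨h1, -, h2⟩
        exact ⟨h1, h2⟩
      · rw [div_le_iff₀ hi0]
        nlinarith
    · push Not at hex
      have hg0 : 3 / 4 * ‖g‖ ≤ |g 0| := by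
        have : ‖g‖ ≤ |g 0| + ‖g‖ / 4 := by
          refine (pi_norm_le_iff_of_nonneg (by positivity)).2 fun i => ?_
          refine Fin.cases ?_ (fun j => ?_) i
          · rw [Real.norm_eq_abs]
            linarith
          · have h1 := hex j
            have h2 := abs_add_le (g 0) (g j.succ - g 0)
            rw [add_sub_cancel] at h2
            rw [Real.norm_eq_abs]
            linarith
        linarith
      rcases lt_or_ge ε (1 / 2) with hε2 | hε2
      · refine le_of_eq_of_le ?_ zero_le
        convert measure_empty (μ := volume)
        rw [eq_empty_iff_forall_notMem]
        rintro u ⟨⟨h0, -⟩, h1, h2⟩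
        have h3 : |∑ j : Fin k, (g j.succ - g 0) * u j| ≤ ‖g‖ / 4 := by
          refine (Finset.abs_sum_le_sum_abs _ _).trans ?_
          calc _ ≤ ∑ j : Fin k, ‖g‖ / 4 * u j := Finset.sum_le_sum fun j _ => by
                rw [abs_mul, abs_of_nonneg (h0 j)]
                exact mul_le_mul_of_nonneg_right (hex j).le (h0 j)
            _ = ‖g‖ / 4 * ∑ j, u j := by rw [Finset.mul_sum]
            _ ≤ _ := by nlinarith
        have h4 := abs_sub_abs_le_abs_add (g 0) (∑ j : Fin k, (g j.succ - g 0) * u j)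
        nlinarith
      · calc _ ≤ volume (Icc (0 : Fin k → ℝ) 1) := measure_mono fun u hu => hu.1
          _ = ENNReal.ofReal 1 := by simp [Real.volume_Icc_pi]
          _ ≤ _ := ENNReal.ofReal_le_ofReal (by linarith)
  rw [mul_assoc, ENNReal.ofReal_mul (by positivity)]
  refine mul_le_mul' (le_of_eq ?_) hvol
  rw [← ENNReal.ofReal_rpow_of_nonneg (by positivity) (by positivity)]
  congr 1
  rw [ENNReal.ofReal_add (by positivity) (by positivity)]
  simp

/-- At a coordinate where `‖g i‖` is maximal, the real or the imaginary part is at least half of it.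
Passing to the corresponding real form loses a factor 2. -/
lemma exists_simplexMeasure_complex_slab_le {m : ℕ} (hm : 0 < m) : ∃ C : ℝ, 0 ≤ C ∧
    ∀ (g : Fin m → ℂ) (ε : ℝ), g ≠ 0 → 0 ≤ ε →
      simplexMeasure m {s | ‖∑ i, g i * (s i : ℂ)‖ ≤ ε * ‖g‖} ≤ ENNReal.ofReal (C * ε) := by
  obtain ⟨k, rfl⟩ := Nat.exists_eq_add_of_lt hm
  rw [zero_add]
  obtain ⟨C, hC, H⟩ := exists_simplexMeasure_slab_le k
  refine ⟨C * 2, by positivity, fun g ε hg hε => ?_⟩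
  have hgpos : 0 < ‖g‖ := norm_pos_iff.2 hg
  have key : ∀ h : Fin (k + 1) → ℝ, ‖g‖ ≤ 2 * ‖h‖ →
      (∀ s : Fin (k + 1) → ℝ, |∑ i, h i * s i| ≤ ‖∑ i, g i * (s i : ℂ)‖) →
      simplexMeasure (k + 1) {s | ‖∑ i, g i * (s i : ℂ)‖ ≤ ε * ‖g‖} ≤
        ENNReal.ofReal (C * 2 * ε) := by
    intro h hgh hs
    have h0 : h ≠ 0 := by
      rintro rfl
      simp only [norm_zero, mul_zero] at hgh
      linarith
    have := H h (2 * ε) h0 (by positivity)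
    rw [mul_assoc]
    refine le_trans (measure_mono ?_) this
    intro s hs'
    rw [mem_ofPred_eq] at hs' ⊢
    refine (hs s).trans (hs'.trans ?_)
    nlinarith
  obtain ⟨i, hi⟩ : ∃ i, ‖g‖ = ‖g i‖ := by
    by_contra! hcon
    have : ‖g‖ < ‖g‖ := (pi_norm_lt_iff hgpos).2 fun i =>
      lt_of_le_of_ne (norm_le_pi_norm g i) (hcon i).symm
    exact lt_irrefl _ this
  have hri := Complex.norm_le_abs_re_add_abs_im (g i)
  rcases le_total |(g i).re| |(g i).im| with hle | hle
  · refine key (fun i => (g i).im) ?_ fun s => ?_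
    · have := norm_le_pi_norm (fun i => (g i).im) i
      rw [Real.norm_eq_abs] at this
      linarith
    · have : ∑ i, (g i).im * s i = (∑ i, g i * (s i : ℂ)).im := by simp
      rw [this]
      exact Complex.abs_im_le_norm _
  · refine key (fun i => (g i).re) ?_ fun s => ?_
    · have := norm_le_pi_norm (fun i => (g i).re) i
      rw [Real.norm_eq_abs] at this
      linarith
    · have : ∑ i, (g i).re * s i = (∑ i, g i * (s i : ℂ)).re := by simp
      rw [this]
      exact Complex.abs_re_le_norm _

end Slab

/-! ### Eigenvectors from a cyclic vector -/

section Eigenvector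

open Polynomial

lemma aeval_mulVec_eq_sum {R : Type*} [CommRing R] {m N : ℕ}
    (A : Matrix (Fin m) (Fin m) R) (q : R[X])
    (hq : q.natDegree < N) (v : Fin m → R) :
    (aeval A q).mulVec v = ∑ j ∈ Finset.range N, q.coeff j • (A ^ j).mulVec v := by
  rw [aeval_eq_sum_range' hq, Matrix.sum_mulVec]
  simp only [Matrix.smul_mulVec]

/-- Irreducibility makes every nonzero rational vector cyclic. A nonzero rational polynomial of
degree below `m` is coprime to the characteristic polynomial, so by Bézout and Cayley–Hamilton it
cannot annihilate `v`. Hence `v, Av, …, A^(m-1)v` are independent over `ℚ`; the nonzero determinant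
expressing this carries over to `ℂ`. -/
lemma eq_zero_of_aeval_mulVec_eq_zero {m : ℕ} {A : Matrix (Fin m) (Fin m) ℚ}
    (hA : Irreducible A.charpoly) {v : Fin m → ℚ} (hv : v ≠ 0) {q : ℂ[X]} (hq : q.natDegree < m)
    (h : (aeval (A.map (algebraMap ℚ ℂ)) q).mulVec (fun i => (algebraMap ℚ ℂ) (v i)) = 0) :
    q = 0 := by
  let B : Matrix (Fin m) (Fin m) ℚ := Matrix.of fun j i => ((A ^ (j : ℕ)).mulVec v) i
  have hdet : B.det ≠ 0 := by
    rw [Ne, ← Matrix.exists_vecMul_eq_zero_iff]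
    rintro ⟨x, hx0, hx⟩
    let g : ℚ[X] := ∑ j : Fin m, C (x j) * X ^ (j : ℕ)
    have hcoeff : ∀ j : Fin m, g.coeff j = x j := by
      intro j
      simp only [g, finsetSum_coeff, coeff_C_mul_X_pow]
      rw [Finset.sum_eq_single j]
      · simp
      · intro b _ hb
        rw [if_neg (fun h => hb (Fin.ext h.symm))]
      · simp
    have hg0 : g ≠ 0 := by
      rintro hg
      refine hx0 (funext fun j => ?_)
      rw [← hcoeff j, hg]
      simp
    have hdeg : g.degree < m := by
      refine (degree_sum_le _ _).trans_lt ?_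
      rw [Finset.sup_lt_iff (by simp)]
      intro j _
      refine (degree_C_mul_X_pow_le _ _).trans_lt ?_
      exact_mod_cast j.2
    have hgv : (aeval A g).mulVec v = 0 := by
      rw [aeval_mulVec_eq_sum A g ((natDegree_lt_iff_degree_lt hg0).2 hdeg), Finset.sum_range]
      simp only [hcoeff]
      ext i
      have := congrFun hx i
      simpa [B, Matrix.vecMul, dotProduct] using this
    have hcop : IsCoprime A.charpoly g := by
      rw [hA.coprime_iff_not_dvd]
      intro hdvd
      have := degree_le_of_dvd hdvd hg0
      rw [Matrix.charpoly_degree_eq_dim, Fintype.card_fin] at this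
      exact absurd hdeg (not_lt.2 this)
    obtain ⟨a, b, hab⟩ := hcop
    have h1 := congrArg (aeval A) hab
    rw [map_add, map_mul, map_mul, Matrix.aeval_self_charpoly, mul_zero, zero_add, map_one] at h1
    apply hv
    rw [← Matrix.one_mulVec v, ← h1, ← Matrix.mulVec_mulVec, hgv, Matrix.mulVec_zero]
  let y : Fin m → ℂ := fun j => q.coeff j
  have hy : y = 0 := by
    have hdet' : (B.map (algebraMap ℚ ℂ)).det ≠ 0 := by
      have := RingHom.map_det (algebraMap ℚ ℂ) B
      rw [RingHom.mapMatrix_apply] at this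
      rw [← this]
      simpa using hdet
    refine Matrix.eq_zero_of_vecMul_eq_zero hdet' ?_
    rw [aeval_mulVec_eq_sum _ q hq, Finset.sum_range] at h
    rw [← h]
    ext i
    have hpow : ∀ j : ℕ, ((A.map (algebraMap ℚ ℂ)) ^ j).mulVec (fun i => (algebraMap ℚ ℂ) (v i)) i
        = (algebraMap ℚ ℂ) ((A ^ j).mulVec v i) := by
      intro j
      have h1 : (A.map (algebraMap ℚ ℂ)) ^ j = (A ^ j).map (algebraMap ℚ ℂ) :=
        (map_pow (algebraMap ℚ ℂ).mapMatrix A j).symm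
      rw [h1, RingHom.map_mulVec]
      rfl
    simp only [Matrix.vecMul, dotProduct, Finset.sum_apply, Pi.smul_apply, smul_eq_mul, hpow]
    rfl
  ext j
  rcases lt_or_ge j m with hj | hj
  · exact congrFun hy ⟨j, hj⟩
  · rw [coeff_eq_zero_of_natDegree_lt (by omega), coeff_zero]

namespace Substitution

variable {m : ℕ} {ζ : Substitution m}

/-- The substitution matrix with complex entries. -/
def complexMatrix (ζ : Substitution m) : Matrix (Fin m) (Fin m) ℂ :=
  ζ.matrix.map (fun k : ℕ => (k : ℂ))

lemma complexMatrix_eq_map (ζ : Substitution m) :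
    ζ.complexMatrix = (ζ.matrix.map (fun k : ℕ => (k : ℚ))).map (algebraMap ℚ ℂ) := by
  ext i j
  simp [complexMatrix]

/-- With `q = charpoly / (X - θ)`, Cayley–Hamilton makes `q(A)ℓ` an eigenvector, nonzero because `ℓ`
is cyclic and `deg q < m`. The last clause expresses it through the integer vectors `A^(n+j) ℓ`,
whose pairings with `s` are the lengths that are observed. -/
lemma HasIrreducibleCharpoly.exists_eigenvector (h : ζ.HasIrreducibleCharpoly)
    {ℓ : Fin m → ℕ} (hℓ : ℓ ≠ 0) {θ : ℂ} (hθ : ζ.complexMatrix.charpoly.IsRoot θ) :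
    ∃ (w : Fin m → ℂ) (q : ℂ[X]), w ≠ 0 ∧ ζ.complexMatrix.mulVec w = θ • w ∧
      ∀ n, θ ^ n • w =
        ∑ j ∈ Finset.range m, q.coeff j •
          (ζ.complexMatrix ^ (n + j)).mulVec fun i => (ℓ i : ℂ) := by
  have hm : 0 < m := by
    rcases Nat.eq_zero_or_pos m with rfl | hm
    · exact absurd (Subsingleton.elim _ _) hℓ
    · exact hm
  set A := ζ.complexMatrix
  obtain ⟨q, hq⟩ := dvd_iff_isRoot.2 hθ
  have hp0 : A.charpoly ≠ 0 := A.charpoly_monic.ne_zero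
  have hq0 : q ≠ 0 := by
    rintro rfl
    exact hp0 (by rw [hq, mul_zero])
  have hdeg : q.natDegree < m := by
    have h1 := A.charpoly_natDegree_eq_dim
    rw [hq, natDegree_mul (X_sub_C_ne_zero θ) hq0, natDegree_X_sub_C, Fintype.card_fin] at h1
    omega
  let w := (aeval A q).mulVec fun i => (ℓ i : ℂ)
  have hAw : A.mulVec w = θ • w := by
    have h1 := A.aeval_self_charpoly
    rw [hq, map_mul, map_sub, aeval_X, aeval_C] at h1
    have h2 := congrArg (fun M => M.mulVec fun i => (ℓ i : ℂ)) h1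
    simp only [← Matrix.mulVec_mulVec, Matrix.zero_mulVec, Matrix.sub_mulVec] at h2
    rw [sub_eq_zero] at h2
    rw [h2, Algebra.algebraMap_eq_smul_one, Matrix.smul_mulVec, Matrix.one_mulVec]
  have hpow : ∀ n, (A ^ n).mulVec w = θ ^ n • w := by
    intro n
    induction n with
    | zero => simp
    | succ n ih =>
      rw [pow_succ, ← Matrix.mulVec_mulVec, hAw, Matrix.mulVec_smul, ih, smul_smul, pow_succ']
  refine ⟨w, q, ?_, hAw, fun n => ?_⟩
  · intro hw
    refine hq0 (eq_zero_of_aeval_mulVec_eq_zero h (v := fun i => (ℓ i : ℚ)) ?_ hdeg ?_)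
    · intro h0
      refine hℓ (funext fun i => ?_)
      have := congrFun h0 i
      simpa using this
    · rw [← complexMatrix_eq_map]
      simpa using hw
  · rw [← hpow n]
    change (A ^ n).mulVec ((aeval A q).mulVec _) = _
    rw [aeval_mulVec_eq_sum A q hdeg, Matrix.mulVec_sum]
    refine Finset.sum_congr rfl fun j _ => ?_
    rw [Matrix.mulVec_smul, Matrix.mulVec_mulVec, pow_add]

/-- An irreducible polynomial over `ℚ` is separable, so the roots counted by the two leading moduli
are distinct numbers, even should the moduli agree. -/
lemma HasIrreducibleCharpoly.exists_two_roots (h : ζ.HasIrreducibleCharpoly)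
    (h2 : 1 < ζ.secondEigenvalueModulus) :
    ∃ (θ₁ θ₂ : ℂ) (ν : ℝ), θ₁ ≠ θ₂ ∧ 1 < ν ∧ ν ≤ ‖θ₁‖ ∧ ν ≤ ‖θ₂‖ ∧
      ζ.complexMatrix.charpoly.IsRoot θ₁ ∧ ζ.complexMatrix.charpoly.IsRoot θ₂ := by
  have hnodup : ζ.complexMatrix.charpoly.roots.Nodup := by
    refine nodup_roots ?_
    rw [complexMatrix_eq_map, Matrix.charpoly_map]
    exact (Irreducible.separable h).map
  have hp0 : ζ.complexMatrix.charpoly ≠ 0 := ζ.complexMatrix.charpoly_monic.ne_zero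
  have hsorted := Multiset.pairwise_sort
    (ζ.complexMatrix.charpoly.roots.map fun z => ‖z‖) (· ≥ ·)
  have hcoe := Multiset.sort_eq
    (ζ.complexMatrix.charpoly.roots.map fun z => ‖z‖) (· ≥ ·)
  change 1 < (((ζ.complexMatrix.charpoly.roots.map fun z => ‖z‖).sort (· ≥ ·)).getD 1 0) at h2
  match hL : (ζ.complexMatrix.charpoly.roots.map fun z => ‖z‖).sort (· ≥ ·) with
  | [] => simp [hL] at h2; linarith
  | [a] => simp [hL] at h2; linarith
  | a :: b :: t =>
    rw [hL] at h2 hsorted hcoe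
    have hab : b ≤ a := (List.pairwise_cons.1 hsorted).1 b (by simp)
    have hb : 1 < b := by simpa using h2
    rw [← Multiset.cons_coe, ← Multiset.cons_coe] at hcoe
    obtain ⟨θ₁, hθ₁, hn₁, hrest⟩ := Multiset.map_eq_cons _ _ _ _ |>.2 hcoe.symm
    obtain ⟨θ₂, hθ₂, hn₂, -⟩ := Multiset.map_eq_cons _ _ _ _ |>.2 hrest
    refine ⟨θ₁, θ₂, b, ?_, hb, by rw [hn₁]; exact hab, hn₂.ge, (mem_roots hp0).1 hθ₁,
      (mem_roots hp0).1 (Multiset.mem_of_mem_erase hθ₂)⟩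
    rintro rfl
    exact hnodup.notMem_erase hθ₂

lemma HasIrreducibleCharpoly.two_le (h : ζ.HasIrreducibleCharpoly)
    (h2 : 1 < ζ.secondEigenvalueModulus) : 2 ≤ m := by
  obtain ⟨θ₁, θ₂, -, hne, -, -, -, h1, h2⟩ := h.exists_two_roots h2
  have hp0 : ζ.complexMatrix.charpoly ≠ 0 := ζ.complexMatrix.charpoly_monic.ne_zero
  have hcard := ζ.complexMatrix.charpoly.card_roots'
  rw [Matrix.charpoly_natDegree_eq_dim, Fintype.card_fin] at hcard
  refine le_trans ?_ hcard
  have hle : ({θ₁, θ₂} : Finset ℂ).val ≤ ζ.complexMatrix.charpoly.roots := by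
    rw [Finset.val_le_iff_val_subset]
    intro z hz
    rw [mem_roots hp0]
    rw [Finset.mem_val, Finset.mem_insert, Finset.mem_singleton] at hz
    rcases hz with rfl | rfl <;> assumption
  have := Multiset.card_le_card hle
  rwa [Finset.card_val, Finset.card_pair hne] at this

end Substitution

end Eigenvector

/-! ### Counting integer sequences that almost satisfy a recurrence -/

section Counting

/-- A Chernoff bound: each counted `e` has weight `z^(number of nonzero entries) ≥ z^d`, and the
total weight of all `e` factors over the coordinates. -/
lemma card_sparse_mul_le {M : ℕ} (E : ℕ) {z d : ℝ} (hz0 : 0 < z) (hz1 : z ≤ 1) :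
    (((Fintype.piFinset fun _ : Fin M => Finset.Icc (-(E : ℤ)) E).filter fun e =>
      ((Finset.univ.filter fun n => e n ≠ 0).card : ℝ) ≤ d).card : ℝ) * z ^ d ≤
      (1 + 2 * E * z) ^ M := by
  have h1 : ∑ t ∈ Finset.Icc (-(E : ℤ)) E, (if t = 0 then 1 else z) = 1 + 2 * E * z := by
    have h0 : (0 : ℤ) ∈ Finset.Icc (-(E : ℤ)) E := by simp
    rw [← Finset.add_sum_erase _ _ h0, if_pos rfl, Finset.sum_congr rfl (g := fun _ => z)]
    · rw [Finset.sum_const, Finset.card_erase_of_mem h0, Int.card_Icc]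
      have : ((E : ℤ) + 1 - -(E : ℤ)).toNat - 1 = 2 * E := by omega
      rw [this]
      simp
    · intro t ht
      rw [if_neg (Finset.ne_of_mem_erase ht)]
  calc _ = ∑ e ∈ (Fintype.piFinset fun _ : Fin M => Finset.Icc (-(E : ℤ)) E).filter fun e =>
        ((Finset.univ.filter fun n => e n ≠ 0).card : ℝ) ≤ d, z ^ d := by
        rw [Finset.sum_const, nsmul_eq_mul]
    _ ≤ ∑ e ∈ (Fintype.piFinset fun _ : Fin M => Finset.Icc (-(E : ℤ)) E).filter fun e =>
        ((Finset.univ.filter fun n => e n ≠ 0).card : ℝ) ≤ d,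
          ∏ n, (if e n = 0 then 1 else z) := by
        refine Finset.sum_le_sum fun e he => ?_
        rw [Finset.prod_ite, Finset.prod_const_one, one_mul, Finset.prod_const,
          ← Real.rpow_natCast]
        exact Real.rpow_le_rpow_of_exponent_ge hz0 hz1 (Finset.mem_filter.1 he).2
    _ ≤ ∑ e ∈ Fintype.piFinset fun _ : Fin M => Finset.Icc (-(E : ℤ)) E,
          ∏ n, (if e n = 0 then 1 else z) :=
        Finset.sum_le_sum_of_subset_of_nonneg (Finset.filter_subset _ _) fun e _ _ =>
          Finset.prod_nonneg fun n _ => by split_ifs <;> positivity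
    _ = ∏ _n : Fin M, ∑ t ∈ Finset.Icc (-(E : ℤ)) E, (if t = 0 then 1 else z) :=
        (Finset.prod_univ_sum (fun _ : Fin M => Finset.Icc (-(E : ℤ)) E)
          (fun _ t => if t = 0 then 1 else z)).symm
    _ = _ := by simp [h1]

lemma exists_card_sparse_le (E : ℕ) {ν : ℝ} (hν : 1 < ν) : ∃ δ : ℝ, 0 < δ ∧ ∀ M : ℕ,
    (((Fintype.piFinset fun _ : Fin M => Finset.Icc (-(E : ℤ)) E).filter fun e =>
      ((Finset.univ.filter fun n => e n ≠ 0).card : ℝ) ≤ δ * M).card : ℝ) ≤ ν ^ M := by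
  set b := Real.sqrt ν with hb
  have hb1 : 1 < b := by
    rw [hb, Real.lt_sqrt] <;> linarith
  have hbb : b * b = ν := Real.mul_self_sqrt (by linarith)
  set z := min 1 ((b - 1) / (2 * E + 1)) with hz
  have hz0 : 0 < z := lt_min one_pos (div_pos (by linarith) (by positivity))
  have hz1 : z ≤ 1 := min_le_left _ _
  have hz2 : 1 + 2 * E * z ≤ b := by
    have h1 : z ≤ (b - 1) / (2 * E + 1) := min_le_right _ _
    rw [le_div_iff₀ (by positivity)] at h1
    nlinarith
  have hlogz : Real.log z ≤ 0 := Real.log_nonpos hz0.le hz1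
  have hlogb : 0 < Real.log b := Real.log_pos hb1
  -- With `b = √ν`, `z` was chosen so that `1 + 2Ez ≤ b`; `δ` is chosen so that `z^(-δ) ≤ b`. The
  -- summand 1 in the denominator covers `z = 1`, where `log z = 0`.
  refine ⟨Real.log b / (1 - Real.log z), div_pos hlogb (by linarith), fun M => ?_⟩
  set δ := Real.log b / (1 - Real.log z)
  have h := card_sparse_mul_le (M := M) E (d := δ * M) hz0 hz1
  have hδ : -(Real.log b) ≤ Real.log z * δ := by
    have h1 : δ * (1 - Real.log z) = Real.log b := div_mul_cancel₀ _ (by linarith)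
    have h2 : 0 ≤ δ := (div_pos hlogb (by linarith)).le
    linarith
  have hzd : (b ^ M)⁻¹ ≤ z ^ (δ * M) := by
    rw [Real.rpow_def_of_pos hz0]
    have : (b ^ M)⁻¹ = Real.exp (-(Real.log b) * M) := by
      rw [neg_mul, Real.exp_neg, mul_comm, Real.exp_nat_mul, Real.exp_log (by linarith)]
    rw [this, Real.exp_le_exp, ← mul_assoc]
    exact mul_le_mul_of_nonneg_right hδ (Nat.cast_nonneg M)
  have hbM : 0 < b ^ M := by positivity
  set c := (((Fintype.piFinset fun _ : Fin M => Finset.Icc (-(E : ℤ)) E).filter fun e =>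
      ((Finset.univ.filter fun n => e n ≠ 0).card : ℝ) ≤ δ * M).card : ℝ)
  have hc : 0 ≤ c := Nat.cast_nonneg _
  have h3 : c * (b ^ M)⁻¹ ≤ b ^ M :=
    (mul_le_mul_of_nonneg_left hzd hc).trans (h.trans (pow_le_pow_left₀ (by positivity) hz2 M))
  rw [← div_eq_mul_inv, div_le_iff₀ hbM] at h3
  rwa [← hbb, mul_pow]

/-- The initial values of an integer sequence, and its defects in the recurrence with
coefficients `p`. -/
def recurrenceCode (p : ℕ → ℤ) (m M : ℕ) (K : ℕ → ℤ) : (Fin m → ℤ) × (Fin M → ℤ) :=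
  (fun i => K i, fun n => ∑ j ∈ Finset.range (m + 1), p j * K (n + j))

/-- The leading coefficient is 1, so each term is recovered from the preceding `m` terms and one
defect. -/
lemma eq_of_recurrenceCode_eq {p : ℕ → ℤ} {m M : ℕ} (hp : p m = 1) {K K' : ℕ → ℤ}
    (h : recurrenceCode p m M K = recurrenceCode p m M K') (n : ℕ) (hn : n < M + m) :
    K n = K' n := by
  induction n using Nat.strong_induction_on with
  | _ n ih =>
    rcases lt_or_ge n m with hnm | hnm
    · exact congrFun (congrArg Prod.fst h) ⟨n, hnm⟩
    · obtain ⟨k, rfl⟩ := Nat.exists_eq_add_of_le' hnm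
      have hk : k < M := by omega
      have h1 := congrFun (congrArg Prod.snd h) ⟨k, hk⟩
      simp only [recurrenceCode, Finset.sum_range_succ, hp, one_mul] at h1
      have h2 : ∑ j ∈ Finset.range m, p j * K (k + j) = ∑ j ∈ Finset.range m, p j * K' (k + j) := by
        refine Finset.sum_congr rfl fun j hj => ?_
        have := Finset.mem_range.1 hj
        rw [ih (k + j) (by omega) (by omega)]
      linarith

variable {p : ℕ → ℤ} {m : ℕ} {a : ℕ → ℝ}

/-- The sequence `a` satisfies the recurrence exactly, so the defect of its roundings is a
combination of rounding errors alone. -/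
lemma abs_defect_le (ha : ∀ n, ∑ j ∈ Finset.range (m + 1), (p j : ℝ) * a (n + j) = 0) (n : ℕ)
    {η : ℝ} (hη : ∀ j ≤ m, |a (n + j) - round (a (n + j))| ≤ η) :
    |((∑ j ∈ Finset.range (m + 1), p j * round (a (n + j)) : ℤ) : ℝ)| ≤
      (∑ j ∈ Finset.range (m + 1), |(p j : ℝ)|) * η := by
  have h1 : ((∑ j ∈ Finset.range (m + 1), p j * round (a (n + j)) : ℤ) : ℝ) =
      -∑ j ∈ Finset.range (m + 1), (p j : ℝ) * (a (n + j) - round (a (n + j))) := by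
    simp only [mul_sub, Finset.sum_sub_distrib, ha n]
    push_cast
    ring
  rw [h1, abs_neg, Finset.sum_mul]
  refine (Finset.abs_sum_le_sum_abs _ _).trans (Finset.sum_le_sum fun j hj => ?_)
  rw [abs_mul]
  exact mul_le_mul_of_nonneg_left (hη j (by have := Finset.mem_range.1 hj; omega)) (abs_nonneg _)

/-- A defect is an integer, and it is below 1 when all `m + 1` rounding errors involved are below
`1/(2D)`. A nonzero defect thus points to a large error among `m + 1` consecutive indices, and each
such index is charged at most `m + 1` times. -/
lemma card_defect_ne_zero_le {D : ℕ} (hD : 0 < D)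
    (hpD : ∑ j ∈ Finset.range (m + 1), |(p j : ℝ)| ≤ D)
    (ha : ∀ n, ∑ j ∈ Finset.range (m + 1), (p j : ℝ) * a (n + j) = 0) (M : ℕ) :
    (Finset.univ.filter fun n : Fin M =>
      (recurrenceCode p m M fun n => round (a n)).2 n ≠ 0).card ≤
    (m + 1) * ((Finset.range (M + m)).filter fun n =>
      (1 : ℝ) / (2 * D) ≤ |a n - round (a n)|).card := by
  set T := (Finset.range (M + m)).filter fun n => (1 : ℝ) / (2 * D) ≤ |a n - round (a n)|
  have hD' : (0 : ℝ) < D := by exact_mod_cast hD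
  have hsub : (Finset.univ.filter fun n : Fin M =>
      (recurrenceCode p m M fun n => round (a n)).2 n ≠ 0) ⊆
      (Finset.range (m + 1)).biUnion fun j =>
        Finset.univ.filter fun n : Fin M => (n : ℕ) + j ∈ T := by
    intro n hn
    rw [Finset.mem_filter] at hn
    simp only [Finset.mem_biUnion, Finset.mem_filter, Finset.mem_univ, true_and]
    by_contra! hcon
    apply hn.2
    have hlt : ∀ j ≤ m, |a (n + j) - round (a (n + j))| ≤ 1 / (2 * D) := by
      intro j hj
      have h1 := hcon j (Finset.mem_range.2 (by omega))
      simp only [T, Finset.mem_filter, Finset.mem_range, not_and, not_le] at h1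
      exact (h1 (by have := n.2; omega)).le
    have h2 := abs_defect_le ha n hlt
    have h3 : (∑ j ∈ Finset.range (m + 1), |(p j : ℝ)|) * (1 / (2 * D)) ≤ 1 / 2 := by
      calc _ ≤ (D : ℝ) * (1 / (2 * D)) := by gcongr
        _ = 1 / 2 := by field_simp
    have h4 : |((∑ j ∈ Finset.range (m + 1), p j * round (a (n + j)) : ℤ) : ℝ)| < 1 := by
      linarith
    rw [← Int.cast_abs, ← Int.cast_one, Int.cast_lt, Int.abs_lt_one_iff] at h4
    exact h4
  refine (Finset.card_le_card hsub).trans ?_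
  refine (Finset.card_biUnion_le_card_mul _ _ T.card fun j _ => ?_).trans (by simp)
  refine Finset.card_le_card_of_injOn (fun n : Fin M => (n : ℕ) + j) ?_ ?_
  · intro n hn
    simpa using hn
  · intro n _ n' _ h
    simp only at h
    exact Fin.ext (by omega)

end Counting

/-- Points of the lines `ℝ s` that lie in a small neighbourhood of a subspace of codimension two
have `s` in a slab. -/
lemma exists_slab_of_linearIndependent {m : ℕ} {w₁ w₂ : Fin m → ℂ}
    (hw : LinearIndependent ℂ ![w₁, w₂]) : ∃ C : ℝ, 0 ≤ C ∧ ∀ (α β : ℂ) (η : ℝ), ∃ g : Fin m → ℂ,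
      g ≠ 0 ∧ ∀ (s : Fin m → ℝ) (ω : ℝ), ω ≠ 0 →
        ‖ω * ∑ i, w₁ i * (s i : ℂ) - α‖ ≤ η → ‖ω * ∑ i, w₂ i * (s i : ℂ) - β‖ ≤ η →
        ‖∑ i, g i * (s i : ℂ)‖ ≤ C * η / |ω| * ‖g‖ := by
  let f : (Fin 2 → ℂ) →ₗ[ℂ] (Fin m → ℂ) := Fintype.linearCombination ℂ ![w₁, w₂]
  have hf : ∀ x, f x = x 0 • w₁ + x 1 • w₂ := fun x => by
    simp [f, Fintype.linearCombination_apply, Fin.sum_univ_two]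
  have hker : LinearMap.ker f = ⊥ := by
    rw [LinearMap.ker_eq_bot]
    exact linearIndependent_iff_injective_fintypeLinearCombination.1 hw
  obtain ⟨K, hK, hanti⟩ := f.exists_antilipschitzWith hker
  -- Linear independence keeps `‖f x‖` comparable to `‖x‖`, which makes the slab constant
  -- independent of `α` and `β`.
  have hbound : ∀ x, ‖x‖ ≤ K * ‖f x‖ := fun x => by
    simpa using hanti.le_mul_dist x 0
  have hw1 : w₁ ≠ 0 := hw.ne_zero 0
  have hw1' : 0 < ‖w₁‖ := norm_pos_iff.2 hw1
  refine ⟨2 * K + ‖w₁‖⁻¹, by positivity, fun α β η => ?_⟩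
  by_cases h0 : α = 0 ∧ β = 0
  · obtain ⟨rfl, rfl⟩ := h0
    refine ⟨w₁, hw1, fun s ω hω h1 h2 => ?_⟩
    have hω' := abs_pos.2 hω
    have hη : 0 ≤ η := (norm_nonneg _).trans h1
    rw [sub_zero, norm_mul, Complex.norm_real, Real.norm_eq_abs] at h1
    have : ‖∑ i, w₁ i * (s i : ℂ)‖ ≤ η / |ω| := by
      rw [le_div_iff₀ hω', mul_comm]
      exact h1
    refine this.trans ?_
    calc η / |ω| = ‖w₁‖⁻¹ * η / |ω| * ‖w₁‖ := by field_simp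
      _ ≤ _ := by
        gcongr
        have : (0 : ℝ) ≤ 2 * K := by positivity
        linarith
  -- The combination `g = β w₁ - α w₂` eliminates the unknown `ω`: the values `α` and `β` cancel in
  -- `ω⟨g, s⟩`, leaving only the errors. When both vanish this `g` would be zero, and `w₁` served
  -- instead.
  · let x : Fin 2 → ℂ := ![β, -α]
    have hx0 : x ≠ 0 := by
      intro hx
      apply h0
      have h1 := congrFun hx 0
      have h2 := congrFun hx 1
      simp only [x, Matrix.cons_val_zero, Matrix.cons_val_one, Pi.zero_apply, neg_eq_zero] at h1 h2
      exact ⟨h2, h1⟩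
    refine ⟨f x, ?_, fun s ω hω h1 h2 => ?_⟩
    · intro hfx
      have := hbound x
      rw [hfx, norm_zero, mul_zero] at this
      exact hx0 (norm_le_zero_iff.1 this)
    have hω' := abs_pos.2 hω
    have hη : 0 ≤ η := (norm_nonneg _).trans h1
    have hα : ‖α‖ ≤ ‖x‖ := by
      have := norm_le_pi_norm x 1
      simpa [x] using this
    have hβ : ‖β‖ ≤ ‖x‖ := by
      have := norm_le_pi_norm x 0
      simpa [x] using this
    have hsum : ω * ∑ i, f x i * (s i : ℂ) =
        β * (ω * ∑ i, w₁ i * (s i : ℂ) - α) - α * (ω * ∑ i, w₂ i * (s i : ℂ) - β) := by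
      rw [hf]
      simp only [x, Matrix.cons_val_zero, Matrix.cons_val_one, Pi.add_apply, Pi.smul_apply,
        smul_eq_mul, add_mul, Finset.sum_add_distrib, mul_assoc, ← Finset.mul_sum]
      ring
    have h3 : |ω| * ‖∑ i, f x i * (s i : ℂ)‖ ≤ 2 * η * ‖x‖ := by
      rw [← Real.norm_eq_abs, ← Complex.norm_real, ← norm_mul, hsum]
      refine (norm_sub_le _ _).trans ?_
      rw [norm_mul, norm_mul]
      have := mul_le_mul hβ h1 (norm_nonneg _) (norm_nonneg _)
      have := mul_le_mul hα h2 (norm_nonneg _) (norm_nonneg _)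
      linarith
    have h4 : |ω| * ‖∑ i, f x i * (s i : ℂ)‖ ≤ 2 * K * η * ‖f x‖ := by
      refine h3.trans ?_
      calc 2 * η * ‖x‖ ≤ 2 * η * (K * ‖f x‖) := by
            gcongr
            exact hbound x
        _ = _ := by ring
    calc _ ≤ 2 * K * η * ‖f x‖ / |ω| := by
          rw [le_div_iff₀ hω', mul_comm]
          exact h4
      _ = 2 * K * η / |ω| * ‖f x‖ := by ring
      _ ≤ _ := by
        gcongr
        have := inv_nonneg.2 (norm_nonneg w₁)
        linarith

/-! ### The Erdős–Kahane argument -/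

namespace Substitution

variable {m : ℕ} (ζ : Substitution m)

lemma map_pow_mulVec {R : Type*} [CommRing R] (n : ℕ) (ℓ : Fin m → ℕ) (i : Fin m) :
    ((ζ.matrix.map fun k : ℕ => (k : R)) ^ n).mulVec (fun i => (ℓ i : R)) i =
      (((ζ.matrix ^ n).mulVec ℓ i : ℕ) : R) := by
  have h1 : (ζ.matrix.map fun k : ℕ => (k : R)) ^ n = (ζ.matrix ^ n).map (Nat.castRingHom R) :=
    (map_pow (Nat.castRingHom R).mapMatrix ζ.matrix n).symm
  have h2 := RingHom.map_mulVec (Nat.castRingHom R) (ζ.matrix ^ n) ℓ i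
  rw [h1]
  exact h2.symm

/-- The coefficients of the characteristic polynomial of the substitution matrix. -/
noncomputable def charCoeff (j : ℕ) : ℤ := (ζ.matrix.map fun k : ℕ => (k : ℤ)).charpoly.coeff j

lemma charCoeff_self : ζ.charCoeff m = 1 := by
  have h := (ζ.matrix.map fun k : ℕ => (k : ℤ)).charpoly_monic.coeff_natDegree
  rwa [Matrix.charpoly_natDegree_eq_dim, Fintype.card_fin] at h

lemma sum_charCoeff_mul (ℓ : Fin m → ℕ) (n : ℕ) (i : Fin m) :
    ∑ j ∈ Finset.range (m + 1), ζ.charCoeff j *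
      (((ζ.matrix ^ (n + j)).mulVec ℓ i : ℕ) : ℤ) = 0 := by
  set A := ζ.matrix.map fun k : ℕ => (k : ℤ) with hA
  have h1 := aeval_mulVec_eq_sum A A.charpoly (N := m + 1)
    (by rw [Matrix.charpoly_natDegree_eq_dim, Fintype.card_fin]; omega) (fun i => (ℓ i : ℤ))
  rw [Matrix.aeval_self_charpoly, Matrix.zero_mulVec] at h1
  have h2 := congrArg (fun v => (A ^ n).mulVec v i) h1.symm
  simp only [Matrix.mulVec_sum, Matrix.mulVec_smul, Matrix.mulVec_mulVec, ← pow_add,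
    Matrix.mulVec_zero, Finset.sum_apply, Pi.smul_apply, smul_eq_mul, Pi.zero_apply, hA,
    map_pow_mulVec] at h2
  exact h2

/-- The length `∑ᵢ (Sⁿ ℓ)ᵢ sᵢ`. -/
noncomputable def iterLength (ℓ : Fin m → ℕ) (s : Fin m → ℝ) (n : ℕ) : ℝ :=
  ∑ i, (((ζ.matrix ^ n).mulVec ℓ i : ℕ) : ℝ) * s i

lemma sum_charCoeff_mul_iterLength (ℓ : Fin m → ℕ) (s : Fin m → ℝ) (ω : ℝ) (n : ℕ) :
    ∑ j ∈ Finset.range (m + 1), (ζ.charCoeff j : ℝ) * (ω * ζ.iterLength ℓ s (n + j)) = 0 := by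
  have h : ∀ i, ∑ j ∈ Finset.range (m + 1),
      (ζ.charCoeff j : ℝ) * (((ζ.matrix ^ (n + j)).mulVec ℓ i : ℕ) : ℝ) = 0 := by
    intro i
    exact_mod_cast ζ.sum_charCoeff_mul ℓ n i
  calc _ = ∑ i, (∑ j ∈ Finset.range (m + 1),
        (ζ.charCoeff j : ℝ) * (((ζ.matrix ^ (n + j)).mulVec ℓ i : ℕ) : ℝ)) * (ω * s i) := by
        simp only [iterLength, Finset.mul_sum, Finset.sum_mul]
        rw [Finset.sum_comm]
        refine Finset.sum_congr rfl fun i _ => Finset.sum_congr rfl fun j _ => ?_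
        ring
    _ = 0 := by simp [h]

variable {ζ}

/-- The eigenvector coordinates of `ω s` are determined by the integers next to the numbers
`ω ∑ᵢ (Sⁿ ℓ)ᵢ sᵢ`, up to an exponentially small error. -/
lemma HasIrreducibleCharpoly.exists_eigenvector_approx (h : ζ.HasIrreducibleCharpoly)
    {ℓ : Fin m → ℕ} (hℓ : ℓ ≠ 0) {θ : ℂ} (hθ : ζ.complexMatrix.charpoly.IsRoot θ) {ν : ℝ}
    (hν : 0 < ν) (hνθ : ν ≤ ‖θ‖) :
    ∃ (w : Fin m → ℂ) (Q : ℝ), w ≠ 0 ∧ ζ.complexMatrix.mulVec w = θ • w ∧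
      ∀ (M : ℕ) (K : ℕ → ℤ), ∃ α : ℂ, ∀ (s : Fin m → ℝ) (ω : ℝ),
        (∀ n < M + m, round (ω * ζ.iterLength ℓ s n) = K n) →
        ‖ω * ∑ i, w i * (s i : ℂ) - α‖ ≤ Q * (ν ^ M)⁻¹ := by
  obtain ⟨w, q, hw0, hw, hpow⟩ := h.exists_eigenvector hℓ hθ
  refine ⟨w, ∑ j ∈ Finset.range m, ‖q.coeff j‖, hw0, hw, fun M K =>
    ⟨(θ ^ M)⁻¹ * ∑ j ∈ Finset.range m, q.coeff j * (K (M + j) : ℂ), fun s ω hK => ?_⟩⟩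
  have hθ0 : θ ^ M ≠ 0 := pow_ne_zero _ (norm_pos_iff.1 (hν.trans_le hνθ))
  have h1 : θ ^ M * (ω * ∑ i, w i * (s i : ℂ)) =
      ∑ j ∈ Finset.range m, q.coeff j * ((ω * ζ.iterLength ℓ s (M + j) : ℝ) : ℂ) := by
    have h2 : ∀ i, θ ^ M * w i = ∑ j ∈ Finset.range m,
        q.coeff j * (((ζ.matrix ^ (M + j)).mulVec ℓ i : ℕ) : ℂ) := by
      intro i
      have := congrFun (hpow M) i
      simpa only [Pi.smul_apply, smul_eq_mul, Finset.sum_apply, complexMatrix,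
        map_pow_mulVec] using this
    calc _ = ∑ i, (θ ^ M * w i) * (ω * s i) := by
          simp only [Finset.mul_sum]
          exact Finset.sum_congr rfl fun i _ => by ring
      _ = _ := by
          simp only [h2, iterLength, Finset.sum_mul, Finset.mul_sum]
          rw [Finset.sum_comm]
          refine Finset.sum_congr rfl fun j _ => ?_
          push_cast
          rw [Finset.mul_sum]
          exact Finset.sum_congr rfl fun i _ => by ring
  have h3 : ω * ∑ i, w i * (s i : ℂ) -
      (θ ^ M)⁻¹ * ∑ j ∈ Finset.range m, q.coeff j * (K (M + j) : ℂ) =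
      (θ ^ M)⁻¹ * ∑ j ∈ Finset.range m, q.coeff j *
        ((ω * ζ.iterLength ℓ s (M + j) - K (M + j) : ℝ) : ℂ) := by
    have : ω * ∑ i, w i * (s i : ℂ) = (θ ^ M)⁻¹ * (θ ^ M * (ω * ∑ i, w i * (s i : ℂ))) := by
      rw [inv_mul_cancel_left₀ hθ0]
    rw [this, h1, ← mul_sub, ← Finset.sum_sub_distrib]
    congr 1
    refine Finset.sum_congr rfl fun j _ => ?_
    push_cast
    ring
  rw [h3, norm_mul, mul_comm, norm_inv, norm_pow]
  refine mul_le_mul ?_ ?_ (by positivity) (Finset.sum_nonneg fun _ _ => norm_nonneg _)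
  · refine (norm_sum_le _ _).trans (Finset.sum_le_sum fun j hj => ?_)
    rw [norm_mul, Complex.norm_real, Real.norm_eq_abs]
    refine mul_le_of_le_one_right (norm_nonneg _) ?_
    have := hK (M + j) (by have := Finset.mem_range.1 hj; omega)
    rw [← this]
    exact (abs_sub_round _).trans (by norm_num)
  · gcongr

/-- For almost every `s`, and uniformly for `ω` in exponentially growing ranges, a positive
proportion of the numbers `ω ∑ᵢ (Sⁿ ℓ)ᵢ sᵢ` is bounded away from the integers. -/
theorem HasIrreducibleCharpoly.erdos_kahane (h : ζ.HasIrreducibleCharpoly)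
    (h2 : 1 < ζ.secondEigenvalueModulus) {ℓ : Fin m → ℕ} (hℓ : ℓ ≠ 0) :
    ∃ ρ δ κ : ℝ, 0 < ρ ∧ 0 < δ ∧ 0 < κ ∧ ∀ᵐ s ∂(simplexMeasure m), ∀ᶠ M : ℕ in Filter.atTop,
      ∀ ω : ℝ, Real.exp (-(κ * M)) ≤ |ω| → |ω| ≤ Real.exp (κ * M) →
        δ * M ≤ ((Finset.range (M + m)).filter fun n =>
          ρ ≤ |ω * ζ.iterLength ℓ s n - round (ω * ζ.iterLength ℓ s n)|).card := by
  have hm : 2 ≤ m := h.two_le h2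
  obtain ⟨θ₁, θ₂, ν, hne, hν, hν₁, hν₂, hr₁, hr₂⟩ := h.exists_two_roots h2
  have hν0 : 0 < ν := by linarith
  obtain ⟨w₁, Q₁, hw₁0, hw₁, happ₁⟩ := h.exists_eigenvector_approx hℓ hr₁ hν0 hν₁
  obtain ⟨w₂, Q₂, hw₂0, hw₂, happ₂⟩ := h.exists_eigenvector_approx hℓ hr₂ hν0 hν₂
  have hind : LinearIndependent ℂ ![w₁, w₂] := by
    refine Module.End.eigenvectors_linearIndependent' (Matrix.toLin' ζ.complexMatrix) ![θ₁, θ₂]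
      ?_ _ ?_
    · intro i j hij
      fin_cases i <;> fin_cases j <;> simp_all
    · intro i
      fin_cases i
      · exact ⟨Module.End.mem_eigenspace_iff.2 (by simpa using hw₁), hw₁0⟩
      · exact ⟨Module.End.mem_eigenspace_iff.2 (by simpa using hw₂), hw₂0⟩
  obtain ⟨C₁, hC₁, hslab⟩ := exists_slab_of_linearIndependent hind
  obtain ⟨C₂, hC₂, hvol⟩ := exists_simplexMeasure_complex_slab_le (m := m) (by omega)
  set P : ℝ := ∑ j ∈ Finset.range (m + 1), |(ζ.charCoeff j : ℝ)|
  set D : ℕ := ⌈P⌉₊ + 1 with hD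
  have hPD : P ≤ D := by
    have := Nat.le_ceil P
    rw [hD]
    push_cast
    linarith
  have hD0 : 0 < D := by omega
  -- Budget in powers of `b^M`, where `ν^M = b^(4M)`: one for the sparse defects, one for the `m`
  -- initial integers together with the division by `|ω|` (hence `(m + 1)κ = log b`). The slab width
  -- `ν^(-M)` leaves `b^(-2M)`, which is summable.
  set b : ℝ := ν ^ (1 / 4 : ℝ) with hb
  have hb1 : 1 < b := Real.one_lt_rpow hν (by norm_num)
  have hb4 : b ^ 4 = ν := by
    rw [hb, ← Real.rpow_natCast, ← Real.rpow_mul hν0.le]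
    norm_num
  have hb0 : 0 < b := by linarith
  obtain ⟨δ', hδ', hcount⟩ := exists_card_sparse_le D hb1
  have hm1 : (0 : ℝ) < m + 1 := by positivity
  set κ : ℝ := Real.log b / (m + 1) with hκ
  have hκ0 : 0 < κ := div_pos (Real.log_pos hb1) hm1
  set A₀ : ℝ := ∑ j ∈ Finset.range m, ∑ i, (((ζ.matrix ^ j).mulVec ℓ i : ℕ) : ℝ) with hA₀
  have hA₀0 : 0 ≤ A₀ := Finset.sum_nonneg fun _ _ => Finset.sum_nonneg fun _ _ => Nat.cast_nonneg _
  refine ⟨1 / (2 * D), δ' / (m + 1), κ, by positivity, by positivity, hκ0, ?_⟩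
  let bad : ℕ → (Fin m → ℝ) → Prop := fun M s => s ∈ positiveSimplex m ∧
    ∃ ω : ℝ, Real.exp (-(κ * M)) ≤ |ω| ∧ |ω| ≤ Real.exp (κ * M) ∧
      (((Finset.range (M + m)).filter fun n => 1 / (2 * (D : ℝ)) ≤
        |ω * ζ.iterLength ℓ s n - round (ω * ζ.iterLength ℓ s n)|).card : ℝ) < δ' / (m + 1) * M
  let H : ℕ → ℕ := fun M => ⌊(A₀ + 1) * Real.exp (κ * M)⌋₊
  let codes : ∀ M : ℕ, Finset ((Fin m → ℤ) × (Fin M → ℤ)) := fun M =>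
    (Fintype.piFinset fun _ : Fin m => Finset.Icc (-(H M : ℤ)) (H M)) ×ˢ
    ((Fintype.piFinset fun _ : Fin M => Finset.Icc (-(D : ℤ)) D).filter fun e =>
      ((Finset.univ.filter fun n => e n ≠ 0).card : ℝ) ≤ δ' * M)
  set Q : ℝ := |Q₁| + |Q₂| with hQ
  have hQ0 : 0 ≤ Q := by positivity
  set C₃ : ℝ := C₂ * (C₁ * Q) with hC₃
  have hC₃0 : 0 ≤ C₃ := by positivity
  -- A code fixes the integers `K n` for `n < M + m`, hence `α` and `β` and the slab, independently
  -- of `s` and `ω`. The union over uncountably many `ω` therefore costs nothing beyond the factor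
  -- `1/|ω| ≤ e^{κM}`.
  have hclass : ∀ (M : ℕ) (x : (Fin m → ℤ) × (Fin M → ℤ)),
      simplexMeasure m {s | ∃ ω : ℝ, Real.exp (-(κ * M)) ≤ |ω| ∧
        recurrenceCode ζ.charCoeff m M (fun n => round (ω * ζ.iterLength ℓ s n)) = x} ≤
      ENNReal.ofReal (C₃ * ((ν ^ M)⁻¹ * Real.exp (κ * M))) := by
    intro M x
    by_cases hx : ∃ K : ℕ → ℤ, recurrenceCode ζ.charCoeff m M K = x
    · obtain ⟨K, hK⟩ := hx
      obtain ⟨α, hα⟩ := happ₁ M K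
      obtain ⟨β, hβ⟩ := happ₂ M K
      obtain ⟨g, hg, hgs⟩ := hslab α β (Q * (ν ^ M)⁻¹)
      have hε : 0 ≤ C₁ * (Q * (ν ^ M)⁻¹) * Real.exp (κ * M) := by positivity
      refine le_trans (measure_mono ?_) ((hvol g _ hg hε).trans (le_of_eq ?_))
      · rintro s ⟨ω, hω, hcode⟩
        have hωpos : 0 < |ω| := (Real.exp_pos _).trans_le hω
        have hKn : ∀ n < M + m, round (ω * ζ.iterLength ℓ s n) = K n := fun n hn =>
          eq_of_recurrenceCode_eq ζ.charCoeff_self (hcode.trans hK.symm) n hn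
        have hν' : 0 ≤ (ν ^ M)⁻¹ := by positivity
        have h1 := hgs s ω (abs_pos.1 hωpos)
          ((hα s ω hKn).trans (mul_le_mul_of_nonneg_right
            (by linarith [le_abs_self Q₁, abs_nonneg Q₂]) hν'))
          ((hβ s ω hKn).trans (mul_le_mul_of_nonneg_right
            (by linarith [le_abs_self Q₂, abs_nonneg Q₁]) hν'))
        rw [mem_ofPred_eq]
        refine h1.trans (mul_le_mul_of_nonneg_right ?_ (norm_nonneg _))
        rw [div_le_iff₀ hωpos, mul_assoc _ (Real.exp _)]
        refine le_mul_of_one_le_right (by positivity) ?_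
        calc (1 : ℝ) = Real.exp (κ * M) * Real.exp (-(κ * M)) := by
              rw [← Real.exp_add, add_neg_cancel, Real.exp_zero]
          _ ≤ _ := by gcongr
      · congr 1
        rw [hC₃]
        ring
    · refine le_of_eq_of_le ?_ zero_le
      convert measure_empty (μ := simplexMeasure m)
      rw [eq_empty_iff_forall_notMem]
      rintro s ⟨ω, -, hcode⟩
      exact hx ⟨_, hcode⟩
  -- For bad `s` the code of some admissible `ω` lies in a small finite set: the initial integers
  -- are `O(e^{κM})`, every defect is at most `D`, and at most `δ'M` defects are nonzero.
  have hcover : ∀ M : ℕ, {s | bad M s} ⊆ ⋃ x ∈ codes M, {s | ∃ ω : ℝ,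
      Real.exp (-(κ * M)) ≤ |ω| ∧
        recurrenceCode ζ.charCoeff m M (fun n => round (ω * ζ.iterLength ℓ s n)) = x} := by
    rintro M s ⟨⟨hspos, hssum⟩, ω, hω1, hω2, hcard⟩
    rw [mem_iUnion₂]
    refine ⟨_, ?_, ω, hω1, rfl⟩
    have hrec := ζ.sum_charCoeff_mul_iterLength ℓ s ω
    rw [Finset.mem_product, Finset.mem_filter, Fintype.mem_piFinset, Fintype.mem_piFinset]
    refine ⟨fun i => ?_, fun n => ?_, ?_⟩
    · have hs1 : ∀ j, s j ≤ 1 := fun j => by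
        rw [← hssum]
        exact Finset.single_le_sum (f := s) (fun i _ => (hspos i).le) (Finset.mem_univ j)
      have hLi : |ζ.iterLength ℓ s i| ≤ A₀ := by
        have hnn : 0 ≤ ζ.iterLength ℓ s i :=
          Finset.sum_nonneg fun j _ => mul_nonneg (Nat.cast_nonneg _) (hspos j).le
        rw [abs_of_nonneg hnn]
        calc _ ≤ ∑ j, (((ζ.matrix ^ (i : ℕ)).mulVec ℓ j : ℕ) : ℝ) :=
              Finset.sum_le_sum fun j _ => mul_le_of_le_one_right (Nat.cast_nonneg _) (hs1 j)
          _ ≤ _ := Finset.single_le_sum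
              (f := fun n => ∑ j, (((ζ.matrix ^ n).mulVec ℓ j : ℕ) : ℝ))
              (fun _ _ => Finset.sum_nonneg fun _ _ => Nat.cast_nonneg _)
              (Finset.mem_range.2 i.2)
      have hexp1 : 1 ≤ Real.exp (κ * M) := Real.one_le_exp (by positivity)
      have habs : |((round (ω * ζ.iterLength ℓ s i) : ℤ) : ℝ)| ≤ (A₀ + 1) * Real.exp (κ * M) := by
        have h1 := abs_sub_round (ω * ζ.iterLength ℓ s i)
        have h3 : |ω * ζ.iterLength ℓ s i| ≤ Real.exp (κ * M) * A₀ := by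
          rw [abs_mul]
          exact mul_le_mul hω2 hLi (abs_nonneg _) (by positivity)
        have h4 := abs_sub_abs_le_abs_sub ((round (ω * ζ.iterLength ℓ s i) : ℤ) : ℝ)
          (ω * ζ.iterLength ℓ s i)
        rw [abs_sub_comm] at h4
        linarith
      have hnat : (round (ω * ζ.iterLength ℓ s i)).natAbs ≤ H M := by
        rw [Nat.le_floor_iff (by positivity), Nat.cast_natAbs]
        exact_mod_cast habs
      rw [Finset.mem_Icc]
      simp only [recurrenceCode]
      omega
    · have h1 := abs_defect_le (a := fun n => ω * ζ.iterLength ℓ s n) hrec n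
        (η := 1) fun j _ => (abs_sub_round _).trans (by norm_num)
      rw [mul_one, ← Int.cast_abs] at h1
      have h3 : |∑ j ∈ Finset.range (m + 1),
          ζ.charCoeff j * round (ω * ζ.iterLength ℓ s (n + j))| ≤ (D : ℤ) := by
        exact_mod_cast h1.trans hPD
      rw [Finset.mem_Icc, ← abs_le]
      exact h3
    · have h1 := card_defect_ne_zero_le (a := fun n => ω * ζ.iterLength ℓ s n) hD0 hPD hrec M
      have h3 : (((Finset.univ.filter fun n : Fin M => (recurrenceCode ζ.charCoeff m M
          fun n => round (ω * ζ.iterLength ℓ s n)).2 n ≠ 0).card : ℕ) : ℝ) ≤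
          (m + 1) * ((Finset.range (M + m)).filter fun n => (1 : ℝ) / (2 * D) ≤
            |ω * ζ.iterLength ℓ s n - round (ω * ζ.iterLength ℓ s n)|).card := by
        exact_mod_cast h1
      refine h3.trans ?_
      calc _ ≤ (m + 1 : ℝ) * (δ' / (m + 1) * M) := by gcongr
        _ = _ := by field_simp
  have hcodes : ∀ M : ℕ, ((codes M).card : ℝ) ≤
      (2 * A₀ + 3) ^ m * (Real.exp (κ * M)) ^ m * b ^ M := by
    intro M
    rw [Finset.card_product, Nat.cast_mul]
    refine mul_le_mul ?_ (hcount M) (Nat.cast_nonneg _) (by positivity)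
    rw [Fintype.card_piFinset_const, Int.card_Icc]
    have hexp1 : 1 ≤ Real.exp (κ * M) := Real.one_le_exp (by positivity)
    have h1 : ((H M : ℤ) + 1 - -(H M : ℤ)).toNat = 2 * H M + 1 := by omega
    have h3 : (H M : ℝ) ≤ (A₀ + 1) * Real.exp (κ * M) := Nat.floor_le (by positivity)
    rw [h1, ← mul_pow]
    push_cast
    refine pow_le_pow_left₀ (by positivity) ?_ _
    nlinarith
  have hbound : ∀ M : ℕ, simplexMeasure m {s | bad M s} ≤
      ENNReal.ofReal ((2 * A₀ + 3) ^ m * C₃ * ((b ^ 2)⁻¹) ^ M) := by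
    intro M
    calc _ ≤ ∑ x ∈ codes M, ENNReal.ofReal (C₃ * ((ν ^ M)⁻¹ * Real.exp (κ * M))) :=
          (measure_mono (hcover M)).trans ((measure_biUnion_finset_le _ _).trans
            (Finset.sum_le_sum fun x _ => hclass M x))
      _ = ENNReal.ofReal ((codes M).card * (C₃ * ((ν ^ M)⁻¹ * Real.exp (κ * M)))) := by
          rw [Finset.sum_const, nsmul_eq_mul, ENNReal.ofReal_mul (Nat.cast_nonneg _),
            ENNReal.ofReal_natCast]
      _ ≤ _ := by
          refine ENNReal.ofReal_le_ofReal ?_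
          refine (mul_le_mul_of_nonneg_right (hcodes M) (by positivity)).trans (le_of_eq ?_)
          have hexp : Real.exp (κ * M) ^ m * Real.exp (κ * M) = b ^ M := by
            rw [← pow_succ, ← Real.exp_nat_mul]
            have : ((m + 1 : ℕ) : ℝ) * (κ * M) = M * Real.log b := by
              rw [hκ]
              push_cast
              field_simp
            rw [this, Real.exp_nat_mul, Real.exp_log hb0]
          calc _ = (2 * A₀ + 3) ^ m * C₃ *
                ((Real.exp (κ * M) ^ m * Real.exp (κ * M)) * b ^ M * (ν ^ M)⁻¹) := by ring
            _ = _ := by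
                rw [hexp, ← hb4, ← mul_pow, ← inv_pow, ← mul_pow]
                congr 2
                field_simp
  have hsum : ∑' M, simplexMeasure m {s | bad M s} ≠ ⊤ := by
    have hsummable : Summable fun M : ℕ => (2 * A₀ + 3) ^ m * C₃ * ((b ^ 2)⁻¹) ^ M := by
      refine Summable.mul_left _ (summable_geometric_of_lt_one (by positivity) ?_)
      exact inv_lt_one_of_one_lt₀ (one_lt_pow₀ hb1 (by norm_num))
    exact ne_top_of_le_ne_top hsummable.tsum_ofReal_ne_top (ENNReal.tsum_le_tsum hbound)
  -- Borel–Cantelli: almost every `s` is bad for only finitely many `M`.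
  have hBC := measure_setOfPred_frequently_eq_zero hsum
  have hae : ∀ᵐ s ∂(simplexMeasure m), s ∈ positiveSimplex m :=
    ae_restrict_mem (measurableSet_positiveSimplex m)
  have hBC' : ∀ᵐ s ∂(simplexMeasure m), ¬ ∃ᶠ M in Filter.atTop, bad M s := by
    rw [ae_iff]
    simpa only [not_not] using hBC
  filter_upwards [hae, hBC'] with s hs hnot
  rw [Filter.not_frequently] at hnot
  filter_upwards [hnot] with M hM ω hω1 hω2
  by_contra! hcon
  exact hM ⟨hs, ω, hω1, hω2, hcon⟩

end Substitution

/-! ### The suspension flow along an orbit -/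

section Tower

variable {m : ℕ} {s : Fin m → ℝ}

lemma roofSum_zero (s : Fin m → ℝ) (x : ℤ → Fin m) : roofSum s x 0 = 0 := by simp [roofSum]

lemma roofSum_add_one (s : Fin m → ℝ) (x : ℤ → Fin m) (n : ℤ) :
    roofSum s x (n + 1) = roofSum s x n + s (x n) := by
  rcases le_or_gt 0 n with hn | hn
  · have h1 : Finset.Ico (n + 1) 0 = ∅ := Finset.Ico_eq_empty (by omega)
    have h2 : Finset.Ico n 0 = ∅ := Finset.Ico_eq_empty (by omega)
    have h3 : Finset.Ico 0 (n + 1) = insert n (Finset.Ico 0 n) := by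
      ext j
      simp only [Finset.mem_Ico, Finset.mem_insert]
      omega
    rw [roofSum, roofSum, h1, h2, h3, Finset.sum_insert (by simp)]
    ring
  · have h1 : Finset.Ico 0 (n + 1) = ∅ := Finset.Ico_eq_empty (by omega)
    have h2 : Finset.Ico 0 n = ∅ := Finset.Ico_eq_empty (by omega)
    have h3 : Finset.Ico n 0 = insert n (Finset.Ico (n + 1) 0) := by
      ext j
      simp only [Finset.mem_Ico, Finset.mem_insert]
      omega
    rw [roofSum, roofSum, h1, h2, h3, Finset.sum_insert (by simp)]
    ring

lemma strictMono_roofSum (hs : ∀ i, 0 < s i) (x : ℤ → Fin m) : StrictMono (roofSum s x) :=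
  strictMono_int_of_lt_succ fun n => by
    rw [roofSum_add_one]
    linarith [hs (x n)]

lemma mul_le_roofSum {d : ℝ} (hd : ∀ i, d ≤ s i) (x : ℤ → Fin m) (n : ℕ) :
    n * d ≤ roofSum s x n := by
  induction n with
  | zero => simp [roofSum_zero]
  | succ n ih =>
    push_cast
    rw [roofSum_add_one]
    linarith [hd (x n)]

lemma roofSum_neg_le {d : ℝ} (hd : ∀ i, d ≤ s i) (x : ℤ → Fin m) (n : ℕ) :
    roofSum s x (-(n : ℤ)) ≤ -(n * d) := by
  induction n with
  | zero => simp [roofSum_zero]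
  | succ n ih =>
    have h1 := roofSum_add_one s x (-((n + 1 : ℕ) : ℤ))
    have h2 : -((n + 1 : ℕ) : ℤ) + 1 = -(n : ℤ) := by push_cast; ring
    rw [h2] at h1
    push_cast at h1 ⊢
    linarith [hd (x (-(n + 1 : ℤ)))]

variable {d : ℝ}

lemma exists_roofSum_le_lt (hd0 : 0 < d) (hd : ∀ i, d ≤ s i) (x : ℤ → Fin m) (v : ℝ) :
    ∃ n, roofSum s x n ≤ v ∧ v < roofSum s x (n + 1) := by
  have hmono := strictMono_roofSum (fun i => hd0.trans_le (hd i)) x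
  obtain ⟨k, hk⟩ := exists_nat_gt (|v| / d)
  rw [div_lt_iff₀ hd0] at hk
  have hv := abs_le.1 (le_refl |v|)
  obtain ⟨n, hn, hmax⟩ := Int.exists_greatest_of_bdd (P := fun n => roofSum s x n ≤ v)
    ⟨k, fun n hn => by
      by_contra! hkn
      have := hmono hkn
      have := mul_le_roofSum hd x k
      linarith⟩
    ⟨-(k : ℤ), by have := roofSum_neg_le hd x k; linarith⟩
  refine ⟨n, hn, ?_⟩
  by_contra! hcon
  have := hmax _ hcon
  omega

lemma roofIndex_eq (hs : ∀ i, 0 < s i) {x : ℤ → Fin m} {v : ℝ} {n : ℤ}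
    (h1 : roofSum s x n ≤ v) (h2 : v < roofSum s x (n + 1)) : roofIndex s x v = n := by
  have hmono := strictMono_roofSum hs x
  refine IsGreatest.csSup_eq ⟨h1, fun k hk => ?_⟩
  by_contra! hnk
  have h3 : roofSum s x (n + 1) ≤ roofSum s x k := hmono.monotone (by omega)
  have h4 : roofSum s x k ≤ v := hk
  linarith

lemma roofSum_roofIndex_le (hd0 : 0 < d) (hd : ∀ i, d ≤ s i) (x : ℤ → Fin m) (v : ℝ) :
    roofSum s x (roofIndex s x v) ≤ v ∧ v < roofSum s x (roofIndex s x v + 1) := by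
  obtain ⟨n, h1, h2⟩ := exists_roofSum_le_lt hd0 hd x v
  rw [roofIndex_eq (fun i => hd0.trans_le (hd i)) h1 h2]
  exact ⟨h1, h2⟩

/-- This Galois connection turns superlevel sets of the index into closed conditions on a finite
sum, which yields joint measurability. -/
lemma le_roofIndex_iff (hd0 : 0 < d) (hd : ∀ i, d ≤ s i) (x : ℤ → Fin m) (v : ℝ) (n : ℤ) :
    n ≤ roofIndex s x v ↔ roofSum s x n ≤ v := by
  have hmono := strictMono_roofSum (fun i => hd0.trans_le (hd i)) x
  obtain ⟨h1, h2⟩ := roofSum_roofIndex_le hd0 hd x v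
  constructor
  · intro h
    exact (hmono.monotone h).trans h1
  · intro h
    have := hmono.lt_iff_lt.1 (h.trans_lt h2)
    omega

lemma measurable_roofSum (s : Fin m → ℝ) (n : ℤ) :
    Measurable fun x : ℤ → Fin m => roofSum s x n := by
  unfold roofSum
  exact (Finset.measurable_fun_sum _ fun j _ => measurable_comp_apply s j).sub
    (Finset.measurable_fun_sum _ fun j _ => measurable_comp_apply s j)

lemma measurable_roofIndex (hd0 : 0 < d) (hd : ∀ i, d ≤ s i) :
    Measurable fun p : (ℤ → Fin m) × ℝ => roofIndex s p.1 p.2 := by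
  refine measurable_of_Ici fun n => ?_
  have : (fun p : (ℤ → Fin m) × ℝ => roofIndex s p.1 p.2) ⁻¹' Ici n =
      {p | roofSum s p.1 n ≤ p.2} := by
    ext p
    exact le_roofIndex_iff hd0 hd p.1 p.2 n
  rw [this]
  exact measurableSet_le ((measurable_roofSum s n).comp measurable_fst) measurable_snd

/-- The value of a cylindrical function at the time `v` of the orbit that starts at `(x, 0)`. -/
noncomputable def towerFun (s : Fin m → ℝ) (ψ : Fin m → ℝ → ℂ) (x : ℤ → Fin m) (v : ℝ) : ℂ :=
  ψ (x (roofIndex s x v)) (v - roofSum s x (roofIndex s x v))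

lemma cylindrical_suspensionFlow (s : Fin m → ℝ) (ψ : Fin m → ℝ → ℂ) (t : ℝ)
    (p : (ℤ → Fin m) × ℝ) :
    cylindrical ψ (suspensionFlow s t p) = towerFun s ψ p.1 (p.2 + t) := by
  simp [cylindrical, suspensionFlow, towerFun, Substitution.shift]

lemma towerFun_eq (hs : ∀ i, 0 < s i) (ψ : Fin m → ℝ → ℂ) {x : ℤ → Fin m} {v : ℝ} {n : ℤ}
    (h1 : roofSum s x n ≤ v) (h2 : v < roofSum s x (n + 1)) :
    towerFun s ψ x v = ψ (x n) (v - roofSum s x n) := by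
  rw [towerFun, roofIndex_eq hs h1 h2]

lemma sub_roofSum_roofIndex_mem (hd0 : 0 < d) (hd : ∀ i, d ≤ s i) (x : ℤ → Fin m) (v : ℝ) :
    v - roofSum s x (roofIndex s x v) ∈ Icc 0 (s (x (roofIndex s x v))) := by
  obtain ⟨h1, h2⟩ := roofSum_roofIndex_le hd0 hd x v
  rw [roofSum_add_one] at h2
  exact ⟨by linarith, by linarith⟩

lemma norm_towerFun_le (hd0 : 0 < d) (hd : ∀ i, d ≤ s i) {ψ : Fin m → ℝ → ℂ} {B : ℝ}
    (hB : ∀ a, ∀ t ∈ Icc 0 (s a), ‖ψ a t‖ ≤ B) (x : ℤ → Fin m) (v : ℝ) :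
    ‖towerFun s ψ x v‖ ≤ B :=
  hB _ _ (sub_roofSum_roofIndex_mem hd0 hd x v)

lemma measurable_towerFun (hd0 : 0 < d) (hd : ∀ i, d ≤ s i) {ψ : Fin m → ℝ → ℂ}
    (hψ : ∀ a, ContinuousOn (ψ a) (Icc 0 (s a))) :
    Measurable fun p : (ℤ → Fin m) × ℝ => towerFun s ψ p.1 p.2 := by
  classical
  -- `ψ a` is only controlled on `[0, s a]`. Extending it by zero makes it measurable, and the tower
  -- function never evaluates it elsewhere.
  let ψ' : Fin m → ℝ → ℂ := fun a => (Icc 0 (s a)).piecewise (ψ a) 0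
  have hψ' : ∀ a, Measurable (ψ' a) := fun a =>
    (hψ a).measurable_piecewise continuousOn_const measurableSet_Icc
  have heq : ∀ p : (ℤ → Fin m) × ℝ, towerFun s ψ p.1 p.2 = towerFun s ψ' p.1 p.2 := by
    intro p
    simp only [towerFun, ψ']
    rw [piecewise_eq_of_mem _ _ _ (sub_roofSum_roofIndex_mem hd0 hd p.1 p.2)]
  simp only [heq]
  have hψ2 : Measurable fun q : Fin m × ℝ => ψ' q.1 q.2 :=
    measurable_from_prod_countable_right hψ'
  have hG : Measurable fun q : ℤ × ((ℤ → Fin m) × ℝ) =>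
      ψ' (q.2.1 q.1) (q.2.2 - roofSum s q.2.1 q.1) := by
    refine measurable_from_prod_countable_right fun n => ?_
    exact hψ2.comp (((measurable_pi_apply n).comp measurable_fst).prodMk
      (measurable_snd.sub ((measurable_roofSum s n).comp measurable_fst)))
  exact hG.comp ((measurable_roofIndex hd0 hd).prodMk measurable_id)

lemma intervalIntegrable_of_measurable_of_bound {g : ℝ → ℂ} (hg : Measurable g) {B : ℝ}
    (hB : ∀ t, ‖g t‖ ≤ B) (a b : ℝ) : IntervalIntegrable g volume a b := by
  rw [intervalIntegrable_iff]
  exact Measure.integrableOn_of_bounded (M := B) (by simp) hg.aestronglyMeasurable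
    (Filter.Eventually.of_forall hB)

/-- The Fourier coefficients `∫₀^{s_a} e^{-2πiωt} ψ_a(t) dt`. -/
noncomputable def letterCoeff (s : Fin m → ℝ) (ψ : Fin m → ℝ → ℂ) (ω : ℝ) (a : Fin m) : ℂ :=
  ∫ t in (0 : ℝ)..s a, phase (ω * t) * ψ a t

lemma norm_letterCoeff_le (hs : ∀ i, 0 < s i) (hs1 : ∀ i, s i ≤ 1) {ψ : Fin m → ℝ → ℂ} {B : ℝ}
    (hB0 : 0 ≤ B) (hB : ∀ a, ∀ t ∈ Icc 0 (s a), ‖ψ a t‖ ≤ B) (ω : ℝ) (a : Fin m) :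
    ‖letterCoeff s ψ ω a‖ ≤ B := by
  have := intervalIntegral.norm_integral_le_of_norm_le_const (a := 0) (b := s a)
    (f := fun t => phase (ω * t) * ψ a t) (C := B) fun t ht => by
      rw [uIoc_of_le (hs a).le] at ht
      rw [norm_mul, norm_phase, one_mul]
      exact hB a t ⟨ht.1.le, ht.2⟩
  rw [sub_zero, abs_of_pos (hs a)] at this
  exact this.trans (mul_le_of_le_one_right hB0 (hs1 a))

lemma wordLength_initialBlock (s : Fin m → ℝ) (x : ℤ → Fin m) (J : ℕ) :
    wordLength s (Substitution.initialBlock x J) = roofSum s x J := by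
  induction J with
  | zero => simp [Substitution.initialBlock, wordLength, roofSum_zero]
  | succ J ih =>
    rw [Substitution.initialBlock_succ, wordLength_append, ih]
    push_cast
    rw [roofSum_add_one]
    simp [wordLength]

lemma integral_towerFun_letter (hs : ∀ i, 0 < s i) (ψ : Fin m → ℝ → ℂ) (ω : ℝ) (x : ℤ → Fin m)
    (n : ℤ) :
    ∫ v in roofSum s x n..roofSum s x (n + 1), phase (ω * v) * towerFun s ψ x v =
      phase (ω * roofSum s x n) * letterCoeff s ψ ω (x n) := by
  have h1 := intervalIntegral.integral_comp_add_left
    (fun v => phase (ω * v) * towerFun s ψ x v) (roofSum s x n) (a := 0) (b := s (x n))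
  rw [add_zero, ← roofSum_add_one] at h1
  rw [← h1, letterCoeff, ← intervalIntegral.integral_const_mul]
  refine intervalIntegral.integral_congr_ae ?_
  -- At the right endpoint the index already belongs to the next letter; this single point is null.
  have hne : ∀ᵐ t : ℝ, t ≠ s (x n) := by simp [ae_iff]
  filter_upwards [hne] with t ht ht'
  rw [uIoc_of_le (hs _).le] at ht'
  have ht2 : t < s (x n) := lt_of_le_of_ne ht'.2 ht
  rw [towerFun_eq hs ψ (n := n) (by linarith [ht'.1]) (by rw [roofSum_add_one]; linarith),
    mul_add, phase_add, add_sub_cancel_left]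
  ring

lemma integral_towerFun_roofSum (hd0 : 0 < d) (hd : ∀ i, d ≤ s i) {ψ : Fin m → ℝ → ℂ}
    (hψ : ∀ a, ContinuousOn (ψ a) (Icc 0 (s a))) {B : ℝ}
    (hB : ∀ a, ∀ t ∈ Icc 0 (s a), ‖ψ a t‖ ≤ B) (ω : ℝ) (x : ℤ → Fin m) (J : ℕ) :
    ∫ v in (0 : ℝ)..roofSum s x J, phase (ω * v) * towerFun s ψ x v =
      twistedSum s ω (letterCoeff s ψ ω) (Substitution.initialBlock x J) := by
  have hs : ∀ i, 0 < s i := fun i => hd0.trans_le (hd i)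
  have hmeas : Measurable fun v => phase (ω * v) * towerFun s ψ x v :=
    (continuous_phase.measurable.comp (measurable_const_mul ω)).mul
      ((measurable_towerFun hd0 hd hψ).comp measurable_prodMk_left)
  have hint := intervalIntegrable_of_measurable_of_bound hmeas (B := B) fun v => by
    rw [norm_mul, norm_phase, one_mul]
    exact norm_towerFun_le hd0 hd hB x v
  induction J with
  | zero => simp [roofSum_zero, Substitution.initialBlock, twistedSum]
  | succ J ih =>
    rw [← intervalIntegral.integral_add_adjacent_intervals (hint 0 (roofSum s x J)) (hint _ _), ih,
      Substitution.initialBlock_succ, twistedSum_append, wordLength_initialBlock]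
    push_cast
    rw [integral_towerFun_letter hs]
    simp [twistedSum]

/-- Twisted integrals along orbits are controlled by twisted sums over the words `ζ^n(b)`. -/
lemma norm_integral_towerFun_le {ζ : Substitution m} {Λ : ℕ} (hΛ : 1 ≤ Λ)
    (hlen : ∀ n a, (ζ.iter n a).length ≤ Λ ^ n) (hd0 : 0 < d) (hd : ∀ i, d ≤ s i)
    (hs1 : ∀ i, s i ≤ 1) {ψ : Fin m → ℝ → ℂ}
    (hψ : ∀ a, ContinuousOn (ψ a) (Icc 0 (s a))) {B : ℝ} (hB0 : 0 ≤ B)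
    (hB : ∀ a, ∀ t ∈ Icc 0 (s a), ‖ψ a t‖ ≤ B) (ω : ℝ) {x : ℤ → Fin m} (hx : x ∈ ζ.space)
    {τ : ℝ} (hτ0 : 0 ≤ τ) (hτ1 : τ ≤ 1) {u R : ℝ} (hu : 0 ≤ u) (huR : u ≤ R) (n : ℕ) :
    ‖∫ t in (0 : ℝ)..u, phase (ω * t) * towerFun s ψ x (τ + t)‖ ≤
      4 * B * Λ ^ n + twistedRate s ω (letterCoeff s ψ ω) ζ n * ((R + 1) / d) := by
  have hs : ∀ i, 0 < s i := fun i => hd0.trans_le (hd i)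
  set G : ℝ → ℂ := fun v => phase (ω * v) * towerFun s ψ x v with hG
  have hmeas : Measurable G :=
    (continuous_phase.measurable.comp (measurable_const_mul ω)).mul
      ((measurable_towerFun hd0 hd hψ).comp measurable_prodMk_left)
  have hGB : ∀ v, ‖G v‖ ≤ B := fun v => by
    rw [hG]
    simp only [norm_mul, norm_phase, one_mul]
    exact norm_towerFun_le hd0 hd hB x v
  have hint := intervalIntegrable_of_measurable_of_bound hmeas hGB
  have hΛ1 : (1 : ℝ) ≤ (Λ : ℝ) ^ n := one_le_pow₀ (by exact_mod_cast hΛ)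
  have h1 : ∫ t in (0 : ℝ)..u, phase (ω * t) * towerFun s ψ x (τ + t) =
      phase (ω * -τ) * ∫ v in τ..(τ + u), G v := by
    have h := intervalIntegral.integral_comp_add_left G τ (a := 0) (b := u)
    rw [add_zero] at h
    rw [← h, ← intervalIntegral.integral_const_mul]
    refine intervalIntegral.integral_congr fun t _ => ?_
    simp only [hG]
    rw [← mul_assoc, ← phase_add]
    congr 2
    ring
  set V := τ + u with hV
  have hV0 : 0 ≤ V := by positivity
  obtain ⟨J, hJ⟩ := Int.eq_ofNat_of_zero_le ((le_roofIndex_iff hd0 hd x V 0).2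
    (by rw [roofSum_zero]; exact hV0))
  obtain ⟨hV1, hV2⟩ := roofSum_roofIndex_le hd0 hd x V
  rw [hJ] at hV1 hV2
  rw [roofSum_add_one] at hV2
  have hJV : (J : ℝ) ≤ (R + 1) / d := by
    rw [le_div_iff₀ hd0]
    have := mul_le_roofSum hd x J
    linarith
  -- Complete letters over `[0, roofSum s x J]` give the twisted sum. The unfinished letter after it
  -- and the initial stretch `[0, τ]` have length at most 1, and their `2B` is absorbed by `Λ^n ≥
  -- 1`.
  have hsplit : ∫ v in τ..V, G v = (∫ v in (0 : ℝ)..roofSum s x J, G v) +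
      (∫ v in roofSum s x J..V, G v) - ∫ v in (0 : ℝ)..τ, G v := by
    rw [intervalIntegral.integral_add_adjacent_intervals (hint _ _) (hint _ _),
      eq_sub_iff_add_eq, add_comm,
      intervalIntegral.integral_add_adjacent_intervals (hint _ _) (hint _ _)]
  have hmain : ‖∫ v in (0 : ℝ)..roofSum s x J, G v‖ ≤
      2 * B * Λ ^ n + twistedRate s ω (letterCoeff s ψ ω) ζ n * J := by
    rw [integral_towerFun_roofSum hd0 hd hψ hB]
    exact norm_twistedSum_initialBlock_le hΛ hlen s ω hB0
      (norm_letterCoeff_le hs hs1 hB0 hB ω) hx n J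
  have hend : ‖∫ v in roofSum s x J..V, G v‖ ≤ B := by
    have := intervalIntegral.norm_integral_le_of_norm_le_const (a := roofSum s x J) (b := V)
      (f := G) (C := B) fun t _ => hGB t
    refine this.trans (mul_le_of_le_one_right hB0 ?_)
    rw [abs_of_nonneg (by linarith)]
    linarith [hs1 (x J)]
  have hstart : ‖∫ v in (0 : ℝ)..τ, G v‖ ≤ B := by
    have := intervalIntegral.norm_integral_le_of_norm_le_const (a := 0) (b := τ)
      (f := G) (C := B) fun t _ => hGB t
    refine this.trans (mul_le_of_le_one_right hB0 ?_)
    rw [sub_zero, abs_of_nonneg hτ0]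
    exact hτ1
  rw [h1, norm_mul, norm_phase, one_mul, hsplit]
  have h2 := norm_sub_le ((∫ v in (0 : ℝ)..roofSum s x J, G v) + ∫ v in roofSum s x J..V, G v)
    (∫ v in (0 : ℝ)..τ, G v)
  have h3 := norm_add_le (∫ v in (0 : ℝ)..roofSum s x J, G v) (∫ v in roofSum s x J..V, G v)
  have h4 := mul_le_mul_of_nonneg_left hJV (twistedRate_nonneg s ω (letterCoeff s ψ ω) ζ n)
  have h5 := mul_le_mul_of_nonneg_left hΛ1 hB0
  linarith

end Tower

/-! ### Spectral measures and twisted integrals -/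

section Spectral

lemma integrable_prod_of_measurable_of_bound {Ω E : Type*} [MeasurableSpace Ω]
    [NormedAddCommGroup E] {ν : Measure Ω} [IsFiniteMeasure ν]
    {g : ℝ → Ω → E} (hg : StronglyMeasurable (Function.uncurry g)) {C : ℝ}
    (hC : ∀ t y, ‖g t y‖ ≤ C) (a b : ℝ) :
    Integrable (Function.uncurry g) ((volume.restrict (Ioc a b)).prod ν) :=
  Integrable.of_bound hg.aestronglyMeasurable C (Filter.Eventually.of_forall fun p => hC p.1 p.2)

lemma intervalIntegral_integral_swap {Ω E : Type*} [MeasurableSpace Ω]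
    [NormedAddCommGroup E] [NormedSpace ℝ E] {ν : Measure Ω} [IsFiniteMeasure ν]
    {g : ℝ → Ω → E} (hg : StronglyMeasurable (Function.uncurry g)) {C : ℝ}
    (hC : ∀ t y, ‖g t y‖ ≤ C) {a b : ℝ} (hab : a ≤ b) :
    ∫ t in a..b, ∫ y, g t y ∂ν = ∫ y, (∫ t in a..b, g t y) ∂ν := by
  simp only [intervalIntegral.integral_of_le hab]
  exact integral_integral_swap (integrable_prod_of_measurable_of_bound hg hC a b)

/-- The kernel `∫₀^u cos(bt) dt`. -/
noncomputable def dirichletKernel (u b : ℝ) : ℝ := ∫ t in (0 : ℝ)..u, Real.cos (b * t)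

/-- The kernel `∫₀^R ∫₀^u cos(bt) dt du`. -/
noncomputable def fejerKernel (R b : ℝ) : ℝ := ∫ u in (0 : ℝ)..R, dirichletKernel u b

lemma dirichletKernel_zero (u : ℝ) : dirichletKernel u 0 = u := by simp [dirichletKernel]

lemma dirichletKernel_eq {b : ℝ} (hb : b ≠ 0) (u : ℝ) :
    dirichletKernel u b = Real.sin (b * u) / b := by
  rw [dirichletKernel, intervalIntegral.integral_comp_mul_left _ hb]
  simp
  ring

lemma fejerKernel_zero (R : ℝ) : fejerKernel R 0 = R ^ 2 / 2 := by
  simp [fejerKernel, dirichletKernel_zero]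

lemma fejerKernel_eq {b : ℝ} (hb : b ≠ 0) (R : ℝ) :
    fejerKernel R b = (1 - Real.cos (b * R)) / b ^ 2 := by
  simp only [fejerKernel, dirichletKernel_eq hb, intervalIntegral.integral_div]
  rw [intervalIntegral.integral_comp_mul_left _ hb]
  simp
  field_simp

lemma continuous_dirichletKernel : Continuous fun p : ℝ × ℝ => dirichletKernel p.1 p.2 := by
  unfold dirichletKernel
  exact intervalIntegral.continuous_parametric_intervalIntegral_of_continuous
    (f := fun (p : ℝ × ℝ) t => Real.cos (p.2 * t)) (by fun_prop) continuous_fst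

lemma continuous_fejerKernel (R : ℝ) : Continuous (fejerKernel R) := by
  unfold fejerKernel
  exact intervalIntegral.continuous_parametric_intervalIntegral_of_continuous'
    (f := fun b u => dirichletKernel u b)
    (continuous_dirichletKernel.comp continuous_swap) _ _

lemma abs_dirichletKernel_le {u : ℝ} (hu : 0 ≤ u) (b : ℝ) : |dirichletKernel u b| ≤ u := by
  have := intervalIntegral.norm_integral_le_of_norm_le_const (a := 0) (b := u)
    (f := fun t => Real.cos (b * t)) (C := 1) fun t _ => Real.abs_cos_le_one _
  rwa [sub_zero, abs_of_nonneg hu, one_mul] at this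

lemma fejerKernel_nonneg (R b : ℝ) : 0 ≤ fejerKernel R b := by
  by_cases hb : b = 0
  · rw [hb, fejerKernel_zero]
    positivity
  · rw [fejerKernel_eq hb]
    exact div_nonneg (by linarith [Real.cos_le_one (b * R)]) (by positivity)

lemma fejerKernel_le (R b : ℝ) (hR : 0 ≤ R) : fejerKernel R b ≤ R * R := by
  have := intervalIntegral.norm_integral_le_of_norm_le_const (a := 0) (b := R)
    (f := fun u => dirichletKernel u b) (C := R) fun u hu => by
      rw [uIoc_of_le hR] at hu
      exact (abs_dirichletKernel_le hu.1.le b).trans hu.2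
  rw [sub_zero, abs_of_nonneg hR] at this
  exact (le_abs_self _).trans this

lemma le_fejerKernel {R b : ℝ} (hb : |b * R| ≤ Real.pi) :
    2 / Real.pi ^ 2 * R ^ 2 ≤ fejerKernel R b := by
  by_cases h0 : b = 0
  · rw [h0, fejerKernel_zero, div_mul_eq_mul_div, div_le_div_iff₀ (by positivity) (by positivity)]
    nlinarith [Real.two_le_pi, sq_nonneg R, mul_nonneg (sq_nonneg R)
      (by nlinarith [Real.two_le_pi] : 0 ≤ Real.pi ^ 2 - 4)]
  · rw [fejerKernel_eq h0, le_div_iff₀ (by positivity)]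
    have := Real.cos_le_one_sub_mul_cos_sq hb
    nlinarith

variable {σ : Measure ℝ} [IsFiniteMeasure σ]

lemma integrable_phase (t : ℝ) : Integrable (fun x : ℝ => phase (-(x * t))) σ :=
  Integrable.of_bound
    (continuous_phase.comp (by fun_prop : Continuous fun x : ℝ => -(x * t))).aestronglyMeasurable 1
    (Filter.Eventually.of_forall fun x => (norm_phase _).le)

lemma re_phase_mul_integral (ω t : ℝ) :
    (phase (ω * t) * ∫ x, phase (-(x * t)) ∂σ).re =
      ∫ x, Real.cos (2 * Real.pi * (ω - x) * t) ∂σ := by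
  rw [← integral_const_mul]
  have h1 := integral_re ((integrable_phase (σ := σ) t).const_mul (phase (ω * t)))
  simp only [RCLike.re_eq_complex_re] at h1
  rw [← h1]
  refine integral_congr_ae (Filter.Eventually.of_forall fun x => ?_)
  simp only
  rw [← phase_add, phase_re]
  congr 1
  ring

variable {Ω : Type*} [MeasurableSpace Ω] {ν : Measure Ω} [IsProbabilityMeasure ν]
  {F : ℝ → Ω → ℂ} {B : ℝ}

/-- Bounds for twisted integrals give bounds for the spectral measure. -/
lemma spectral_measureReal_Icc_le (hF : Measurable (Function.uncurry F)) (hB : ∀ t y, ‖F t y‖ ≤ B)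
    (hσ : ∀ t, ∫ x, phase (-(x * t)) ∂σ = ∫ y, F t y * (starRingEnd ℂ) (F 0 y) ∂ν)
    {R S : ℝ} (hR : 0 < R) (ω : ℝ)
    (hS : ∀ᵐ y ∂ν, ∀ u, 0 ≤ u → u ≤ R → ‖∫ t in (0 : ℝ)..u, phase (ω * t) * F t y‖ ≤ S) :
    σ.real (Icc (ω - 1 / (2 * R)) (ω + 1 / (2 * R))) ≤ Real.pi ^ 2 / 2 * (B * S / R) := by
  obtain ⟨y₀⟩ := nonempty_of_isProbabilityMeasure ν
  have hB0 : 0 ≤ B := (norm_nonneg _).trans (hB 0 y₀)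
  set c : ℝ → ℂ := fun t => ∫ x, phase (-(x * t)) ∂σ with hc
  set G : ℝ → ℂ := fun u => ∫ t in (0 : ℝ)..u, phase (ω * t) * c t with hG
  have hGbound : ∀ u, 0 ≤ u → u ≤ R → ‖G u‖ ≤ S * B := by
    intro u hu huR
    have hmeas : Measurable (Function.uncurry fun (t : ℝ) (y : Ω) =>
        phase (ω * t) * (F t y * (starRingEnd ℂ) (F 0 y))) := by
      have h0 : Measurable fun p : ℝ × Ω => F 0 p.2 :=
        (hF.comp measurable_prodMk_left).comp measurable_snd
      exact ((continuous_phase.measurable.comp (measurable_const_mul ω)).comp measurable_fst).mul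
        (hF.mul (Complex.continuous_conj.measurable.comp h0))
    have hswap := intervalIntegral_integral_swap (ν := ν) hmeas.stronglyMeasurable
      (C := B * B) (fun t y => by
        rw [norm_mul, norm_phase, one_mul, norm_mul, RCLike.norm_conj]
        exact mul_le_mul (hB t y) (hB 0 y) (norm_nonneg _) hB0) hu
    -- Fubini turns the twisted integral of the correlations into the correlation of a twisted orbit
    -- integral with `F 0`. The second factor is bounded by `B`, so the estimate is linear in `S`.
    have hGu : G u = ∫ y, (∫ t in (0 : ℝ)..u, phase (ω * t) * F t y) *
        (starRingEnd ℂ) (F 0 y) ∂ν := by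
      calc G u = ∫ t in (0 : ℝ)..u, ∫ y, phase (ω * t) * (F t y * (starRingEnd ℂ) (F 0 y)) ∂ν := by
            simp only [hG, hc, hσ, integral_const_mul]
        _ = _ := by
            rw [hswap]
            simp only [← mul_assoc, intervalIntegral.integral_mul_const]
    rw [hGu]
    have := norm_integral_le_of_norm_le_const (μ := ν) (C := S * B)
      (f := fun y => (∫ t in (0 : ℝ)..u, phase (ω * t) * F t y) * (starRingEnd ℂ) (F 0 y)) (by
        filter_upwards [hS] with y hy
        rw [norm_mul, RCLike.norm_conj]
        have h1 := hy u hu huR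
        exact mul_le_mul h1 (hB 0 y) (norm_nonneg _) ((norm_nonneg _).trans h1))
    simpa using this
  have hGre : ∀ u, 0 ≤ u → (G u).re = ∫ x, dirichletKernel u (2 * Real.pi * (ω - x)) ∂σ := by
    intro u hu
    have hcont : Continuous fun t => phase (ω * t) * c t := by
      refine (continuous_phase.comp (by fun_prop)).mul ?_
      refine continuous_of_dominated (bound := fun _ => 1)
        (fun t => (integrable_phase t).aestronglyMeasurable)
        (fun t => Filter.Eventually.of_forall fun x => (norm_phase _).le) (integrable_const _)
        (Filter.Eventually.of_forall fun x => continuous_phase.comp (by fun_prop))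
    have h1 := Complex.reCLM.intervalIntegral_comp_comm (hcont.intervalIntegrable 0 u (μ := volume))
    simp only [Complex.reCLM_apply] at h1
    rw [← h1]
    simp only [hc, re_phase_mul_integral]
    have hm : Continuous (Function.uncurry fun (t x : ℝ) =>
        Real.cos (2 * Real.pi * (ω - x) * t)) := by fun_prop
    exact intervalIntegral_integral_swap hm.stronglyMeasurable (C := 1)
      (fun t x => Real.abs_cos_le_one _) hu
  have hK : ∫ u in (0 : ℝ)..R, (G u).re = ∫ x, fejerKernel R (2 * Real.pi * (ω - x)) ∂σ := by
    -- Clamping `u` to `[0, R]` changes nothing on the range of integration and supplies the bound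
    -- by `R` for all `u` that the exchange of integrals requires.
    have h1 : ∫ u in (0 : ℝ)..R, (G u).re =
        ∫ u in (0 : ℝ)..R, ∫ x, dirichletKernel (max 0 (min u R)) (2 * Real.pi * (ω - x)) ∂σ := by
      refine intervalIntegral.integral_congr fun u hu => ?_
      rw [uIcc_of_le hR.le] at hu
      rw [hGre u hu.1, min_eq_left hu.2, max_eq_right hu.1]
    have hm : Continuous (Function.uncurry fun (u x : ℝ) =>
        dirichletKernel (max 0 (min u R)) (2 * Real.pi * (ω - x))) :=
      continuous_dirichletKernel.comp (by fun_prop :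
        Continuous fun p : ℝ × ℝ => (max 0 (min p.1 R), 2 * Real.pi * (ω - p.2)))
    rw [h1, intervalIntegral_integral_swap hm.stronglyMeasurable (C := R)
      (fun u x => (abs_dirichletKernel_le (le_max_left _ _) _).trans
        (max_le hR.le (min_le_right _ _))) hR.le]
    refine integral_congr_ae (Filter.Eventually.of_forall fun x => ?_)
    refine intervalIntegral.integral_congr fun u hu => ?_
    rw [uIcc_of_le hR.le] at hu
    rw [min_eq_left hu.2, max_eq_right hu.1]
  have hupper : ∫ x, fejerKernel R (2 * Real.pi * (ω - x)) ∂σ ≤ S * B * R := by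
    rw [← hK]
    have := intervalIntegral.norm_integral_le_of_norm_le_const (a := 0) (b := R)
      (f := fun u => (G u).re) (C := S * B) fun u hu => by
        rw [uIoc_of_le hR.le] at hu
        exact (Complex.abs_re_le_norm _).trans (hGbound u hu.1.le hu.2)
    rw [sub_zero, abs_of_pos hR] at this
    exact (le_abs_self _).trans this
  have hpi := Real.pi_pos
  -- The Fejér kernel is nonnegative, and on an interval of half-width `1/(2R)` its argument
  -- satisfies `|bR| ≤ π`, where it is at least `2R²/π²`.
  have hlower : σ.real (Icc (ω - 1 / (2 * R)) (ω + 1 / (2 * R))) * (2 / Real.pi ^ 2 * R ^ 2) ≤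
      ∫ x, fejerKernel R (2 * Real.pi * (ω - x)) ∂σ := by
    have h1 : ∫ x, (Icc (ω - 1 / (2 * R)) (ω + 1 / (2 * R))).indicator
        (fun _ => 2 / Real.pi ^ 2 * R ^ 2) x ∂σ =
        σ.real (Icc (ω - 1 / (2 * R)) (ω + 1 / (2 * R))) * (2 / Real.pi ^ 2 * R ^ 2) := by
      rw [integral_indicator_const _ measurableSet_Icc, smul_eq_mul]
    rw [← h1]
    refine integral_mono ((integrable_const _).indicator measurableSet_Icc) ?_ fun x => ?_
    · exact Integrable.of_bound
        ((continuous_fejerKernel R).comp (by fun_prop)).aestronglyMeasurable (R * R)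
        (Filter.Eventually.of_forall fun x => by
          rw [Real.norm_eq_abs, abs_of_nonneg (fejerKernel_nonneg _ _)]
          exact fejerKernel_le _ _ hR.le)
    · rw [indicator_apply]
      split_ifs with hx
      swap
      · exact fejerKernel_nonneg _ _
      refine le_fejerKernel ?_
      have hx' : |ω - x| ≤ 1 / (2 * R) := abs_le.2 ⟨by linarith [hx.2], by linarith [hx.1]⟩
      rw [abs_mul, abs_mul, abs_of_pos hR, abs_of_pos (by positivity : 0 < 2 * Real.pi)]
      calc _ ≤ 2 * Real.pi * (1 / (2 * R)) * R := by gcongr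
        _ = Real.pi := by field_simp
  have h3 := hlower.trans hupper
  rw [← le_div_iff₀ (by positivity)] at h3
  refine h3.trans (le_of_eq ?_)
  field_simp

/-- If `F` is `L¹`-continuous at time zero, the spectral measure has small tails. -/
lemma spectral_measureReal_tail_le (hF : Measurable (Function.uncurry F))
    (hB : ∀ t y, ‖F t y‖ ≤ B)
    (hσ : ∀ t, ∫ x, phase (-(x * t)) ∂σ = ∫ y, F t y * (starRingEnd ℂ) (F 0 y) ∂ν)
    {h ε : ℝ} (hh : 0 < h)
    (hε : ∀ t, 0 ≤ t → t ≤ h → ∫ y, ‖F 0 y - F t y‖ ∂ν ≤ ε) :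
    σ.real {x | 1 / h ≤ |x|} ≤ 2 * (B * ε) := by
  obtain ⟨y₀⟩ := nonempty_of_isProbabilityMeasure ν
  have hB0 : 0 ≤ B := (norm_nonneg _).trans (hB 0 y₀)
  have hFm : ∀ t, Measurable (F t) := fun t => hF.comp measurable_prodMk_left
  have hFi : ∀ t, Integrable (fun y => F t y * (starRingEnd ℂ) (F 0 y)) ν := fun t =>
    Integrable.of_bound ((hFm t).mul
      (Complex.continuous_conj.measurable.comp (hFm 0))).aestronglyMeasurable (B * B)
      (Filter.Eventually.of_forall fun y => by
        rw [norm_mul, RCLike.norm_conj]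
        exact mul_le_mul (hB t y) (hB 0 y) (norm_nonneg _) hB0)
  have hre : ∀ t, (∫ x, phase (-(x * t)) ∂σ).re = ∫ x, Real.cos (2 * Real.pi * x * t) ∂σ := by
    intro t
    have := re_phase_mul_integral (σ := σ) 0 t
    rw [zero_mul, phase_zero, one_mul] at this
    rw [this]
    refine integral_congr_ae (Filter.Eventually.of_forall fun x => ?_)
    simp only
    rw [← Real.cos_neg]
    congr 1
    ring
  have hcosi : ∀ t, Integrable (fun x => Real.cos (2 * Real.pi * x * t)) σ := fun t =>
    Integrable.of_bound (Continuous.aestronglyMeasurable (by fun_prop)) 1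
      (Filter.Eventually.of_forall fun x => Real.abs_cos_le_one _)
  -- `∫ (1 - cos 2πxt) dσ` is the real part of `⟨F 0 - F t, F 0⟩`, so `L¹`-continuity in time bounds
  -- it.
  have hdiff : ∀ t, 0 ≤ t → t ≤ h → ∫ x, (1 - Real.cos (2 * Real.pi * x * t)) ∂σ ≤ B * ε := by
    intro t ht hth
    have h1 : ∫ x, (1 - Real.cos (2 * Real.pi * x * t)) ∂σ =
        (∫ y, (F 0 y - F t y) * (starRingEnd ℂ) (F 0 y) ∂ν).re := by
      have h0 := hre 0
      simp only [mul_zero, Real.cos_zero] at h0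
      simp only [sub_mul]
      rw [integral_sub (integrable_const _) (hcosi t), ← h0, ← hre t,
        integral_sub (hFi 0) (hFi t), Complex.sub_re, ← hσ t, ← hσ 0]
      simp
    rw [h1]
    refine (Complex.re_le_norm _).trans ((norm_integral_le_integral_norm _).trans ?_)
    have hint : Integrable (fun y => ‖F 0 y - F t y‖) ν :=
      Integrable.of_bound ((hFm 0).sub (hFm t)).norm.aestronglyMeasurable (B + B)
        (Filter.Eventually.of_forall fun y => by
          rw [norm_norm]
          exact (norm_sub_le _ _).trans (add_le_add (hB 0 y) (hB t y)))
    calc _ ≤ ∫ y, B * ‖F 0 y - F t y‖ ∂ν := by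
          refine integral_mono_of_nonneg (Filter.Eventually.of_forall fun y => norm_nonneg _)
            (hint.const_mul B) (Filter.Eventually.of_forall fun y => ?_)
          simp only
          rw [norm_mul, RCLike.norm_conj, mul_comm]
          exact mul_le_mul_of_nonneg_right (hB 0 y) (norm_nonneg _)
      _ ≤ _ := by
          rw [integral_const_mul]
          exact mul_le_mul_of_nonneg_left (hε t ht hth) hB0
  have hm : Continuous (Function.uncurry fun (t x : ℝ) =>
      1 - Real.cos (2 * Real.pi * x * t)) := by fun_prop
  have hswap := intervalIntegral_integral_swap (ν := σ) hm.stronglyMeasurable (C := 2)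
    (fun t x => by
      rw [Real.norm_eq_abs, abs_le]
      constructor <;> linarith [Real.cos_le_one (2 * Real.pi * x * t),
        Real.neg_one_le_cos (2 * Real.pi * x * t)]) hh.le
  have hinner : ∀ x, ∫ t in (0 : ℝ)..h, (1 - Real.cos (2 * Real.pi * x * t)) =
      h - dirichletKernel h (2 * Real.pi * x) := by
    intro x
    rw [intervalIntegral.integral_sub (by simp)
      (Continuous.intervalIntegrable (by fun_prop) _ _)]
    simp [dirichletKernel]
  simp only [hinner] at hswap
  have hupper : ∫ x, (h - dirichletKernel h (2 * Real.pi * x)) ∂σ ≤ B * ε * h := by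
    rw [← hswap]
    have := intervalIntegral.norm_integral_le_of_norm_le_const (a := 0) (b := h)
      (f := fun t => ∫ x, (1 - Real.cos (2 * Real.pi * x * t)) ∂σ) (C := B * ε) fun t ht => by
        rw [uIoc_of_le hh.le] at ht
        rw [Real.norm_eq_abs, abs_of_nonneg (integral_nonneg fun x => by
          simpa using Real.cos_le_one _)]
        exact hdiff t ht.1.le ht.2
    rw [sub_zero, abs_of_pos hh] at this
    exact (le_abs_self _).trans this
  have hset : MeasurableSet {x : ℝ | 1 / h ≤ |x|} :=
    measurableSet_le measurable_const continuous_abs.measurable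
  have hpi := Real.pi_pos
  -- Averaging `1 - cos` over `[0, h]` leaves a nonnegative function, at least half of `h` once `|x|
  -- ≥ 1/h`, since the sine term is then at most `h/(2π)`.
  have hlower : σ.real {x | 1 / h ≤ |x|} * (h / 2) ≤
      ∫ x, (h - dirichletKernel h (2 * Real.pi * x)) ∂σ := by
    have h1 : ∫ x, {x : ℝ | 1 / h ≤ |x|}.indicator (fun _ => h / 2) x ∂σ =
        σ.real {x | 1 / h ≤ |x|} * (h / 2) := by
      rw [integral_indicator_const _ hset, smul_eq_mul]
    rw [← h1]
    have hDb := fun x => abs_dirichletKernel_le hh.le (2 * Real.pi * x)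
    refine integral_mono ((integrable_const _).indicator hset) ?_ fun x => ?_
    · refine Integrable.of_bound (Continuous.aestronglyMeasurable ?_) (2 * h)
        (Filter.Eventually.of_forall fun x => ?_)
      · exact continuous_const.sub (continuous_dirichletKernel.comp
          (by fun_prop : Continuous fun x : ℝ => (h, 2 * Real.pi * x)))
      · rw [Real.norm_eq_abs, abs_le]
        have := abs_le.1 (hDb x)
        constructor <;> linarith
    · rw [indicator_apply]
      split_ifs with hx
      · have hx' : 1 / h ≤ |x| := hx
        have hx0 : x ≠ 0 := by
          rintro rfl
          have : 0 < 1 / h := by positivity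
          simp at hx'
          linarith
        rw [dirichletKernel_eq (by positivity)]
        have h3 : Real.sin (2 * Real.pi * x * h) / (2 * Real.pi * x) ≤ h / 2 := by
          refine (le_abs_self _).trans ?_
          rw [abs_div, abs_mul, abs_of_pos (by positivity : 0 < 2 * Real.pi)]
          have hxpos := abs_pos.2 hx0
          rw [div_le_iff₀ (by positivity)]
          have h4 := Real.abs_sin_le_one (2 * Real.pi * x * h)
          rw [div_le_iff₀ hh] at hx'
          nlinarith [Real.two_le_pi, mul_nonneg (sub_nonneg.2 Real.two_le_pi)
            (mul_nonneg hxpos.le hh.le)]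
        linarith
      · have := abs_le.1 (hDb x)
        linarith
  have h3 := hlower.trans hupper
  have h4 : σ.real {x | 1 / h ≤ |x|} * (h / 2) ≤ 2 * (B * ε) * (h / 2) := by linarith
  exact le_of_mul_le_mul_right h4 (by positivity)

end Spectral

/-! ### The suspension measure -/

section LipNorm

variable {m : ℕ} {s : Fin m → ℝ} {ψ : Fin m → ℝ → ℂ}

lemma IsLipCylindrical.continuousOn (hψ : IsLipCylindrical s ψ) (a : Fin m) :
    ContinuousOn (ψ a) (Icc 0 (s a)) :=
  (hψ a).choose_spec.continuousOn

lemma lipNorm_le_cylLipNorm (s : Fin m → ℝ) (ψ : Fin m → ℝ → ℂ) (a : Fin m) :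
    lipNorm (s a) (ψ a) ≤ cylLipNorm s ψ :=
  le_ciSup (f := fun a => lipNorm (s a) (ψ a)) (Set.finite_range _).bddAbove a

lemma cylLipNorm_nonneg (s : Fin m → ℝ) (ψ : Fin m → ℝ → ℂ) : 0 ≤ cylLipNorm s ψ :=
  Real.iSup_nonneg fun _ =>
    add_nonneg (Real.iSup_nonneg fun _ => norm_nonneg _) (NNReal.coe_nonneg _)

lemma IsLipCylindrical.norm_le (hψ : IsLipCylindrical s ψ) (a : Fin m) {t : ℝ}
    (ht : t ∈ Icc 0 (s a)) : ‖ψ a t‖ ≤ cylLipNorm s ψ := by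
  -- Boundedness has to be verified: a real supremum of an unbounded family would have the default
  -- value 0 and give no estimate.
  have hbdd : BddAbove (range fun t : Icc (0 : ℝ) (s a) => ‖ψ a t‖) := by
    obtain ⟨C, hC⟩ := isCompact_Icc.exists_bound_of_continuousOn (hψ.continuousOn a)
    exact ⟨C, by rintro _ ⟨t, rfl⟩; exact hC t t.2⟩
  refine le_trans ?_ (lipNorm_le_cylLipNorm s ψ a)
  exact (le_ciSup hbdd ⟨t, ht⟩).trans (le_add_of_nonneg_right (NNReal.coe_nonneg _))

lemma IsLipCylindrical.norm_sub_le (hψ : IsLipCylindrical s ψ) (a : Fin m) {t u : ℝ}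
    (ht : t ∈ Icc 0 (s a)) (hu : u ∈ Icc 0 (s a)) :
    ‖ψ a t - ψ a u‖ ≤ cylLipNorm s ψ * |t - u| := by
  have hK : ‖ψ a t - ψ a u‖ ≤
      ((sInf {K : ℝ≥0 | LipschitzOnWith K (ψ a) (Icc 0 (s a))} : ℝ≥0) : ℝ) * |t - u| := by
    rcases (abs_nonneg (t - u)).eq_or_lt with h0 | h0
    · have : t = u := by
        rw [eq_comm, abs_eq_zero] at h0
        linarith
      simp [this]
    · rw [← div_le_iff₀ h0]
      -- The infimum is itself a Lipschitz constant, because the difference quotient is a lower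
      -- bound for all of them.
      refine Real.toNNReal_le_iff_le_coe.1 (le_csInf (hψ a) fun K hK => ?_)
      rw [Real.toNNReal_le_iff_le_coe, div_le_iff₀ h0]
      have := LipschitzOnWith.dist_le_mul hK t ht u hu
      rwa [dist_eq_norm, Real.dist_eq] at this
  refine hK.trans (mul_le_mul_of_nonneg_right ?_ (abs_nonneg _))
  refine le_trans ?_ (lipNorm_le_cylLipNorm s ψ a)
  exact le_add_of_nonneg_left (Real.iSup_nonneg fun _ => norm_nonneg _)

end LipNorm

/-! ### Integration over the suspension space -/

section SuspensionMeasure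

variable {m : ℕ} {ζ : Substitution m} {s : Fin m → ℝ} {d : ℝ} {μ : Measure (ℤ → Fin m)}

lemma Substitution.measurableSet_space (ζ : Substitution m) : MeasurableSet ζ.space := by
  have : ζ.space = ⋂ n : ℕ, {x | ∃ (k : ℕ) (a : Fin m), centralBlock x n <:+: ζ.iter k a} := by
    ext x
    simp [space]
  rw [this]
  refine MeasurableSet.iInter fun n => ?_
  have hmeas : Measurable fun (x : ℤ → Fin m) (j : Fin (2 * n + 1)) => x ((j : ℤ) - (n : ℤ)) :=
    measurable_pi_lambda _ fun j => measurable_pi_apply _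
  exact hmeas (t := {y : Fin (2 * n + 1) → Fin m |
    ∃ (k : ℕ) (a : Fin m), List.ofFn y <:+: ζ.iter k a}) (Set.toFinite _).measurableSet

lemma Substitution.measurableSet_suspensionSpace (ζ : Substitution m) (s : Fin m → ℝ) :
    MeasurableSet (ζ.suspensionSpace s) := by
  have : ζ.suspensionSpace s = Prod.fst ⁻¹' ζ.space ∩ ({p | 0 ≤ p.2} ∩ {p | p.2 < s (p.1 0)}) := by
    ext p
    simp [suspensionSpace]
  rw [this]
  exact (measurable_fst ζ.measurableSet_space).inter
    ((measurableSet_le measurable_const measurable_snd).inter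
      (measurableSet_lt measurable_snd ((measurable_comp_apply s 0).comp measurable_fst)))

lemma Substitution.IsInvariantMeasure.ae_mem_space (hμ : ζ.IsInvariantMeasure μ) :
    ∀ᵐ x ∂μ, x ∈ ζ.space := by
  rw [ae_iff]
  exact hμ.carried

lemma prodMk_preimage_suspensionSpace {x : ℤ → Fin m} (hx : x ∈ ζ.space) :
    Prod.mk x ⁻¹' ζ.suspensionSpace s = Ico 0 (s (x 0)) := by
  ext τ
  simp [Substitution.suspensionSpace, hx]

lemma measure_suspensionSpace (hμ : ζ.IsInvariantMeasure μ) :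
    (μ.prod volume) (ζ.suspensionSpace s) = ∫⁻ x, ENNReal.ofReal (s (x 0)) ∂μ := by
  have := hμ.isProbabilityMeasure
  rw [Measure.prod_apply (ζ.measurableSet_suspensionSpace s)]
  refine lintegral_congr_ae ?_
  filter_upwards [hμ.ae_mem_space] with x hx
  rw [prodMk_preimage_suspensionSpace hx, Real.volume_Ico, sub_zero]

lemma le_measure_suspensionSpace (hμ : ζ.IsInvariantMeasure μ) (hd : ∀ i, d ≤ s i) :
    ENNReal.ofReal d ≤ (μ.prod volume) (ζ.suspensionSpace s) := by
  have := hμ.isProbabilityMeasure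
  rw [measure_suspensionSpace hμ]
  calc ENNReal.ofReal d = ∫⁻ _x, ENNReal.ofReal d ∂μ := by simp
    _ ≤ _ := lintegral_mono fun x => ENNReal.ofReal_le_ofReal (hd _)

lemma measure_suspensionSpace_lt_top (hμ : ζ.IsInvariantMeasure μ) (hs1 : ∀ i, s i ≤ 1) :
    (μ.prod volume) (ζ.suspensionSpace s) < ⊤ := by
  have := hμ.isProbabilityMeasure
  rw [measure_suspensionSpace hμ]
  calc _ ≤ ∫⁻ _x, ENNReal.ofReal 1 ∂μ := lintegral_mono fun x => ENNReal.ofReal_le_ofReal (hs1 _)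
    _ < ⊤ := by simp

lemma isProbabilityMeasure_suspensionMeasure (hμ : ζ.IsInvariantMeasure μ) (hd0 : 0 < d)
    (hd : ∀ i, d ≤ s i) (hs1 : ∀ i, s i ≤ 1) :
    IsProbabilityMeasure (ζ.suspensionMeasure s μ) := by
  constructor
  rw [Substitution.suspensionMeasure, Measure.smul_apply, Measure.restrict_apply_univ, smul_eq_mul]
  refine ENNReal.inv_mul_cancel ?_ (measure_suspensionSpace_lt_top hμ hs1).ne
  exact (lt_of_lt_of_le (ENNReal.ofReal_pos.2 hd0) (le_measure_suspensionSpace hμ hd)).ne'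

lemma ae_mem_suspensionSpace (ζ : Substitution m) (s : Fin m → ℝ) (μ : Measure (ℤ → Fin m)) :
    ∀ᵐ p ∂(ζ.suspensionMeasure s μ), p ∈ ζ.suspensionSpace s :=
  Measure.ae_smul_measure (ae_restrict_mem (ζ.measurableSet_suspensionSpace s)) _

lemma cylindrical_eq_towerFun (hs : ∀ i, 0 < s i) (ψ : Fin m → ℝ → ℂ) {p : (ℤ → Fin m) × ℝ}
    (hp : p ∈ ζ.suspensionSpace s) : cylindrical ψ p = towerFun s ψ p.1 p.2 := by
  have h1 : roofSum s p.1 (0 + 1) = s (p.1 0) := by rw [roofSum_add_one, roofSum_zero, zero_add]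
  rw [towerFun_eq hs ψ (n := 0) (by rw [roofSum_zero]; exact hp.2.1) (by rw [h1]; exact hp.2.2),
    roofSum_zero, sub_zero, cylindrical]

variable {ψ : Fin m → ℝ → ℂ}

/-- By Fubini, integrating `f` over the fibre above `x` gives the zeroth Fourier coefficient of the
letter `x 0`. The normalizing factor is nonzero, so mean zero passes to the base. -/
lemma integral_letterCoeff_eq_zero (hμ : ζ.IsInvariantMeasure μ) (hd0 : 0 < d)
    (hd : ∀ i, d ≤ s i) (hs1 : ∀ i, s i ≤ 1) (hψ : IsLipCylindrical s ψ)
    (h0 : ∫ p, cylindrical ψ p ∂(ζ.suspensionMeasure s μ) = 0) :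
    ∫ x, letterCoeff s ψ 0 (x 0) ∂μ = 0 := by
  have := hμ.isProbabilityMeasure
  have hs : ∀ i, 0 < s i := fun i => hd0.trans_le (hd i)
  have hA := ζ.measurableSet_suspensionSpace s
  have htop := measure_suspensionSpace_lt_top hμ hs1
  have hpos : (μ.prod volume) (ζ.suspensionSpace s) ≠ 0 :=
    (lt_of_lt_of_le (ENNReal.ofReal_pos.2 hd0) (le_measure_suspensionSpace hμ hd)).ne'
  rw [Substitution.suspensionMeasure, integral_smul_measure, smul_eq_zero] at h0
  have h1 : ∫ p in ζ.suspensionSpace s, cylindrical ψ p ∂(μ.prod volume) = 0 := by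
    refine h0.resolve_left ?_
    rw [ENNReal.toReal_inv, inv_eq_zero]
    exact (ENNReal.toReal_pos hpos htop.ne).ne'
  rw [setIntegral_congr_fun hA fun p hp => cylindrical_eq_towerFun hs ψ hp,
    ← integral_indicator hA, integral_prod] at h1
  · rw [← h1]
    refine integral_congr_ae ?_
    filter_upwards [hμ.ae_mem_space] with x hx
    have h2 : (fun τ => (ζ.suspensionSpace s).indicator (fun p => towerFun s ψ p.1 p.2) (x, τ)) =
        (Ico 0 (s (x 0))).indicator fun τ => towerFun s ψ x τ := by
      rw [← prodMk_preimage_suspensionSpace hx]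
      rfl
    have h3 := integral_towerFun_letter hs ψ 0 x 0
    simp only [zero_mul, phase_zero, one_mul] at h3
    rw [h2, integral_indicator measurableSet_Ico, integral_Ico_eq_integral_Ioc,
      ← intervalIntegral.integral_of_le (hs _).le, ← h3, roofSum_add_one, roofSum_zero, zero_add]
  · rw [integrable_indicator_iff hA]
    exact Measure.integrableOn_of_bounded htop.ne
      (measurable_towerFun hd0 hd hψ.continuousOn).aestronglyMeasurable
      (Filter.Eventually.of_forall fun p =>
        norm_towerFun_le hd0 hd (fun a t ht => hψ.norm_le a ht) p.1 p.2)

/-- The strip has height at most `t` over each base point, and the total mass before normalization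
is at least `d`. -/
lemma measureReal_top_strip_le (hμ : ζ.IsInvariantMeasure μ) (hd0 : 0 < d)
    (hd : ∀ i, d ≤ s i) {t : ℝ} (ht : 0 ≤ t) :
    (ζ.suspensionMeasure s μ).real {p | p ∈ ζ.suspensionSpace s ∧ s (p.1 0) ≤ p.2 + t} ≤ t / d := by
  have := hμ.isProbabilityMeasure
  have hE : MeasurableSet {p : (ℤ → Fin m) × ℝ |
      p ∈ ζ.suspensionSpace s ∧ s (p.1 0) ≤ p.2 + t} :=
    (ζ.measurableSet_suspensionSpace s).inter (measurableSet_le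
      ((measurable_comp_apply s 0).comp measurable_fst) (measurable_snd.add_const t))
  set E := {p : (ℤ → Fin m) × ℝ | p ∈ ζ.suspensionSpace s ∧ s (p.1 0) ≤ p.2 + t}
  refine ENNReal.toReal_le_of_le_ofReal (by positivity) ?_
  rw [Substitution.suspensionMeasure, Measure.smul_apply, smul_eq_mul,
    ENNReal.ofReal_div_of_pos hd0, div_eq_mul_inv, mul_comm]
  refine mul_le_mul' ?_ (ENNReal.inv_le_inv.2 (le_measure_suspensionSpace hμ hd))
  refine (Measure.restrict_apply_le _ _).trans ?_
  rw [Measure.prod_apply hE]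
  calc _ ≤ ∫⁻ _x, ENNReal.ofReal t ∂μ := by
        refine lintegral_mono fun x => ?_
        calc volume (Prod.mk x ⁻¹' E) ≤ volume (Icc (s (x 0) - t) (s (x 0))) := by
              refine measure_mono fun τ hτ => ?_
              have h1 : s (x 0) ≤ τ + t := hτ.2
              have h2 : τ < s (x 0) := hτ.1.2.2
              exact ⟨by linarith, h2.le⟩
          _ = ENNReal.ofReal t := by rw [Real.volume_Icc]; congr 1; ring
    _ = _ := by simp

/-- Below the top strip both times lie over the same letter and the Lipschitz bound applies. On the
strip the function may jump, and only the sup bound `2L` is used against its mass `t/d`. -/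
lemma integral_norm_towerFun_sub_le (hμ : ζ.IsInvariantMeasure μ) (hd0 : 0 < d)
    (hd : ∀ i, d ≤ s i) (hs1 : ∀ i, s i ≤ 1) (hψ : IsLipCylindrical s ψ) {t : ℝ} (ht : 0 ≤ t) :
    ∫ p, ‖towerFun s ψ p.1 (p.2 + 0) - towerFun s ψ p.1 (p.2 + t)‖ ∂(ζ.suspensionMeasure s μ) ≤
      cylLipNorm s ψ * (t + 2 * (t / d)) := by
  have hs : ∀ i, 0 < s i := fun i => hd0.trans_le (hd i)
  have := isProbabilityMeasure_suspensionMeasure hμ hd0 hd hs1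
  have hL := cylLipNorm_nonneg s ψ
  set L := cylLipNorm s ψ
  have hE : MeasurableSet {p : (ℤ → Fin m) × ℝ |
      p ∈ ζ.suspensionSpace s ∧ s (p.1 0) ≤ p.2 + t} :=
    (ζ.measurableSet_suspensionSpace s).inter (measurableSet_le
      ((measurable_comp_apply s 0).comp measurable_fst) (measurable_snd.add_const t))
  have hstrip := measureReal_top_strip_le hμ hd0 hd ht
  set E := {p : (ℤ → Fin m) × ℝ | p ∈ ζ.suspensionSpace s ∧ s (p.1 0) ≤ p.2 + t}
  have hB := norm_towerFun_le hd0 hd fun a t ht => hψ.norm_le a ht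
  calc _ ≤ ∫ p, (L * t + E.indicator (fun _ => 2 * L) p) ∂(ζ.suspensionMeasure s μ) := by
        refine integral_mono_of_nonneg (Filter.Eventually.of_forall fun p => norm_nonneg _)
          ((integrable_const _).add ((integrable_const _).indicator hE)) ?_
        filter_upwards [ae_mem_suspensionSpace ζ s μ] with p hp
        by_cases hpE : p ∈ E
        · rw [indicator_of_mem hpE]
          have h1 := norm_sub_le (towerFun s ψ p.1 (p.2 + 0)) (towerFun s ψ p.1 (p.2 + t))
          have h2 := hB p.1 (p.2 + 0)
          have h3 := hB p.1 (p.2 + t)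
          have h4 : 0 ≤ L * t := by positivity
          linarith
        · rw [indicator_of_notMem hpE, add_zero, add_zero]
          have hlt : p.2 + t < s (p.1 0) := by
            by_contra! hcon
            exact hpE ⟨hp, hcon⟩
          have hp0 := hp.2.1
          have h1 : roofSum s p.1 (0 + 1) = s (p.1 0) := by
            rw [roofSum_add_one, roofSum_zero, zero_add]
          rw [towerFun_eq hs ψ (n := 0) (v := p.2) (by rw [roofSum_zero]; exact hp0)
              (by rw [h1]; exact hp.2.2),
            towerFun_eq hs ψ (n := 0) (v := p.2 + t) (by rw [roofSum_zero]; linarith)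
              (by rw [h1]; exact hlt), roofSum_zero, sub_zero, sub_zero]
          refine (hψ.norm_sub_le _ ⟨hp0, hp.2.2.le⟩ ⟨by linarith, hlt.le⟩).trans (le_of_eq ?_)
          rw [sub_add_cancel_left, abs_neg, abs_of_nonneg ht]
    _ = L * t + (ζ.suspensionMeasure s μ).real E * (2 * L) := by
        rw [integral_add (integrable_const _) ((integrable_const _).indicator hE),
          integral_indicator_const _ hE]
        simp
    _ ≤ _ := by
        have := mul_le_mul_of_nonneg_right hstrip (by positivity : 0 ≤ 2 * L)
        linarith

variable {σ : Measure ℝ}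

lemma IsSpectralMeasure.integral_phase_eq (hs : ∀ i, 0 < s i)
    (hσ : IsSpectralMeasure (ζ.suspensionMeasure s μ) (suspensionFlow s) (cylindrical ψ) σ)
    (t : ℝ) :
    ∫ x, phase (-(x * t)) ∂σ = ∫ p, towerFun s ψ p.1 (p.2 + t) *
      (starRingEnd ℂ) (towerFun s ψ p.1 (p.2 + 0)) ∂(ζ.suspensionMeasure s μ) := by
  have h1 : ∫ x, phase (-(x * t)) ∂σ =
      ∫ ω : ℝ, Complex.exp (2 * Real.pi * Complex.I * ω * t) ∂σ := by
    refine integral_congr_ae (Filter.Eventually.of_forall fun x => ?_)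
    simp only [phase]
    congr 1
    push_cast
    ring
  rw [h1, hσ.fourier t]
  refine integral_congr_ae ?_
  filter_upwards [ae_mem_suspensionSpace ζ s μ] with p hp
  rw [cylindrical_suspensionFlow, add_zero, cylindrical_eq_towerFun hs ψ hp]

lemma measurable_uncurry_towerFun (hd0 : 0 < d) (hd : ∀ i, d ≤ s i) (hψ : IsLipCylindrical s ψ) :
    Measurable (Function.uncurry fun (t : ℝ) (p : (ℤ → Fin m) × ℝ) =>
      towerFun s ψ p.1 (p.2 + t)) :=
  (measurable_towerFun hd0 hd hψ.continuousOn).comp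
    ((measurable_fst.comp measurable_snd).prodMk
      ((measurable_snd.comp measurable_snd).add measurable_fst))

/-- Balls of radius `1 / (2R)` have spectral measure bounded by twisted sums of any level. -/
lemma IsSpectralMeasure.measureReal_Icc_le {Λ : ℕ} (hΛ : 1 ≤ Λ)
    (hlen : ∀ n a, (ζ.iter n a).length ≤ Λ ^ n) (hμ : ζ.IsInvariantMeasure μ) (hd0 : 0 < d)
    (hd : ∀ i, d ≤ s i) (hs1 : ∀ i, s i ≤ 1) (hψ : IsLipCylindrical s ψ)
    (hσ : IsSpectralMeasure (ζ.suspensionMeasure s μ) (suspensionFlow s) (cylindrical ψ) σ)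
    (ω : ℝ) {R : ℝ} (hR : 1 ≤ R) (n : ℕ) :
    σ.real (Icc (ω - 1 / (2 * R)) (ω + 1 / (2 * R))) ≤
      cylLipNorm s ψ * (20 * cylLipNorm s ψ * Λ ^ n / R +
        10 * twistedRate s ω (letterCoeff s ψ ω) ζ n / d) := by
  have hs : ∀ i, 0 < s i := fun i => hd0.trans_le (hd i)
  have := hσ.isFiniteMeasure
  have := isProbabilityMeasure_suspensionMeasure hμ hd0 hd hs1
  have hL := cylLipNorm_nonneg s ψ
  set L := cylLipNorm s ψ
  have hR0 : 0 < R := by linarith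
  have hmain := spectral_measureReal_Icc_le (ν := ζ.suspensionMeasure s μ)
    (measurable_uncurry_towerFun hd0 hd hψ)
    (fun t p => norm_towerFun_le hd0 hd (fun a t ht => hψ.norm_le a ht) p.1 (p.2 + t))
    (hσ.integral_phase_eq hs) hR0 ω
    (S := 4 * L * Λ ^ n + twistedRate s ω (letterCoeff s ψ ω) ζ n * ((R + 1) / d)) (by
      filter_upwards [ae_mem_suspensionSpace ζ s μ] with p hp u hu huR
      exact norm_integral_towerFun_le hΛ hlen hd0 hd hs1 hψ.continuousOn hL
        (fun a t ht => hψ.norm_le a ht) ω hp.1 hp.2.1 (hp.2.2.le.trans (hs1 _)) hu huR n)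
  refine hmain.trans ?_
  have hr := twistedRate_nonneg s ω (letterCoeff s ψ ω) ζ n
  set ρ := twistedRate s ω (letterCoeff s ψ ω) ζ n
  -- The constants 20 and 10 come from `π²/2 ≤ 5` and `R + 1 ≤ 2R`.
  have hpi : Real.pi ^ 2 / 2 ≤ 5 := by
    have := Real.pi_lt_d2
    nlinarith [Real.pi_pos]
  calc Real.pi ^ 2 / 2 * (L * (4 * L * Λ ^ n + ρ * ((R + 1) / d)) / R)
      ≤ 5 * (L * (4 * L * Λ ^ n + ρ * ((R + R) / d)) / R) := by gcongr
    _ = _ := by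
        field_simp
        ring

lemma IsSpectralMeasure.measureReal_tail_le (hμ : ζ.IsInvariantMeasure μ) (hd0 : 0 < d)
    (hd : ∀ i, d ≤ s i) (hd1 : d ≤ 1) (hs1 : ∀ i, s i ≤ 1) (hψ : IsLipCylindrical s ψ)
    (hσ : IsSpectralMeasure (ζ.suspensionMeasure s μ) (suspensionFlow s) (cylindrical ψ) σ)
    {h : ℝ} (hh : 0 < h) :
    σ.real {x | 1 / h ≤ |x|} ≤ cylLipNorm s ψ * (6 * cylLipNorm s ψ * h / d) := by
  have hs : ∀ i, 0 < s i := fun i => hd0.trans_le (hd i)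
  have := hσ.isFiniteMeasure
  have := isProbabilityMeasure_suspensionMeasure hμ hd0 hd hs1
  have hL := cylLipNorm_nonneg s ψ
  refine (spectral_measureReal_tail_le (ν := ζ.suspensionMeasure s μ)
    (measurable_uncurry_towerFun hd0 hd hψ)
    (fun t p => norm_towerFun_le hd0 hd (fun a t ht => hψ.norm_le a ht) p.1 (p.2 + t))
    (hσ.integral_phase_eq hs) hh (ε := cylLipNorm s ψ * (3 * (h / d))) fun t ht hth => ?_).trans
    (le_of_eq (by ring))
  refine (integral_norm_towerFun_sub_le hμ hd0 hd hs1 hψ ht).trans ?_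
  refine mul_le_mul_of_nonneg_left ?_ hL
  have h1 : t / d ≤ h / d := by gcongr
  have h2 : h ≤ h / d := by
    rw [le_div_iff₀ hd0]
    exact mul_le_of_le_one_right hh.le hd1
  linarith

end SuspensionMeasure

/-! ### Hölder bounds for the spectral measures -/

section Main

variable {m : ℕ} {ζ : Substitution m}

lemma Substitution.wordLength_iterate_onWords (ζ : Substitution m) (s : Fin m → ℝ)
    (w : List (Fin m)) (n : ℕ) :
    wordLength s (ζ.onWords^[n] w) = ζ.iterLength (fun i => w.count i) s n := by
  simp only [wordLength_eq_sum, Substitution.iterLength, Substitution.count_iterate_onWords]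

/-- For almost every `s`, twisted sums over the words `ζ^n(b)` decay exponentially relative to the
length, uniformly for `ω` in exponentially growing ranges. -/
lemma Substitution.exists_twistedRate_le_exp (hprim : ζ.IsPrimitive)
    (hirr : ζ.HasIrreducibleCharpoly) (h2 : 1 < ζ.secondEigenvalueModulus) :
    ∃ (N : ℕ) (c κ : ℝ), 0 < c ∧ 0 < κ ∧ ∀ᵐ s ∂(simplexMeasure m), ∀ᶠ M : ℕ in Filter.atTop,
      ∀ ω : ℝ, Real.exp (-(κ * M)) ≤ |ω| → |ω| ≤ Real.exp (κ * M) →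
        ∀ (b : Fin m → ℂ) (L : ℝ), 0 ≤ L → (∀ a, ‖b a‖ ≤ L) →
          twistedRate s ω b ζ (M + N) ≤ L * Real.exp (-(c * M)) := by
  obtain ⟨q, a, v, hv⟩ := hprim.exists_returnWord (hirr.two_le h2)
  obtain ⟨K, hK, hlen⟩ := hprim.exists_length_iter_le_mul q
  have hq : 0 < q := by
    rcases Nat.eq_zero_or_pos q with rfl | hq
    · obtain ⟨P, Q, hPQ⟩ := hv a
      have := congrArg List.length hPQ
      simp [iter_zero] at this
      omega
    · exact hq
  have hℓ : (fun i => (a :: v).count i) ≠ 0 := by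
    intro h
    have := congrFun h a
    simp at this
  obtain ⟨ρ, δ, κ, hρ, hδ, hκ, hEK⟩ := hirr.erdos_kahane h2 hℓ
  have hK' : (0 : ℝ) < K := by exact_mod_cast hK
  have hq' : (0 : ℝ) < q := by exact_mod_cast hq
  -- No upper bound on `ρ` is known here, so the contraction factor might not be positive; the
  -- maximum with `1/2` keeps its logarithm meaningful.
  set η : ℝ := max (1 / 2) (1 - 4 * ρ ^ 2 / K) with hη
  have hη0 : 0 < η := lt_of_lt_of_le (by norm_num) (le_max_left _ _)
  have hη1 : η < 1 := max_lt (by norm_num) (by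
    have : 0 < 4 * ρ ^ 2 / K := by positivity
    linarith)
  have hlogη : Real.log η < 0 := Real.log_neg hη0 hη1
  refine ⟨m + q, -Real.log η * δ / q, κ, div_pos (mul_pos (by linarith) hδ) hq', hκ, ?_⟩
  filter_upwards [hEK] with s hs
  filter_upwards [hs] with M hM ω hω1 hω2 b L hL hb
  have hcard := hM ω hω1 hω2
  set T := (Finset.range (M + m)).filter fun n => ρ ≤
    |ω * ζ.iterLength (fun i => (a :: v).count i) s n -
      round (ω * ζ.iterLength (fun i => (a :: v).count i) s n)| with hT
  have hstep : ∀ n ∈ T, twistedRate s ω b ζ (n + q) ≤ η * twistedRate s ω b ζ n := by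
    intro n hn
    have hn' := (Finset.mem_filter.1 hn).2
    rw [← Substitution.wordLength_iterate_onWords] at hn'
    refine (twistedRate_add_le s ω b ζ hv hK hlen hρ.le n hn').trans ?_
    exact mul_le_mul_of_nonneg_right (le_max_right _ _) (twistedRate_nonneg _ _ _ _ _)
  have hpow := pow_le_of_antitone_of_mul_le (twistedRate_antitone s ω b ζ)
    (twistedRate_nonneg s ω b ζ) hη0.le hq (M + m) T hstep (Finset.filter_subset _ _)
  have hr0 := twistedRate_zero_le s ω b ζ hL hb
  -- There are at least `δM` contractions. Dividing the rate by `q` compensates for the `q`-th power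
  -- in `hpow`.
  have hexp : η ^ T.card ≤ Real.exp (-(-Real.log η * δ / q * M)) ^ q := by
    rw [← Real.exp_nat_mul, ← Real.exp_log (pow_pos hη0 T.card), Real.exp_le_exp, Real.log_pow]
    have h1 : (q : ℝ) * -(-Real.log η * δ / q * M) = Real.log η * (δ * M) := by
      field_simp
    rw [h1]
    nlinarith
  have hfin : twistedRate s ω b ζ (M + m + q) ^ q ≤
      (L * Real.exp (-(-Real.log η * δ / q * M))) ^ q := by
    rw [mul_pow]
    refine hpow.trans (mul_le_mul (pow_le_pow_left₀ (twistedRate_nonneg _ _ _ _ _) hr0 _) hexp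
      (by positivity) (by positivity))
  rw [← add_assoc]
  exact (pow_le_pow_iff_left₀ (twistedRate_nonneg _ _ _ _ _) (by positivity) hq.ne').1 hfin

lemma Substitution.exists_twistedRate_zero_le_exp [Nonempty (Fin m)] (hprim : ζ.IsPrimitive) :
    ∃ (p : ℕ) (c : ℝ), 0 < c ∧
      ∀ (s : Fin m → ℝ) (b : Fin m → ℂ) (L : ℝ), 0 ≤ L → (∀ a, ‖b a‖ ≤ L) →
        ∀ μ, ζ.IsInvariantMeasure μ → ∫ x, b (x 0) ∂μ = 0 → ∀ k : ℕ,
          twistedRate s 0 b ζ (p * k) ≤ 4 * L * Real.exp (-(c * k)) := by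
  obtain ⟨p, κ, hκ0, hκ1, H⟩ := hprim.exists_twistedRate_zero_le
  set η : ℝ := max (1 / 2) κ
  have hη0 : 0 < η := lt_of_lt_of_le (by norm_num) (le_max_left _ _)
  have hη1 : η < 1 := max_lt (by norm_num) hκ1
  refine ⟨p, -Real.log η, by linarith [Real.log_neg hη0 hη1], fun s b L hL hb μ hμ h0 k => ?_⟩
  refine (H s b L hL hb μ hμ h0 k).trans ?_
  have h1 : Real.exp (-(-Real.log η * k)) = η ^ k := by
    rw [neg_mul, neg_neg, mul_comm, Real.exp_nat_mul, Real.exp_log hη0]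
  rw [h1]
  exact mul_le_mul_of_nonneg_left (pow_le_pow_left₀ hκ0 (le_max_right _ _) k) (by positivity)

/-- An exponential bound along the scales `r ≈ e^{-lM}`, with a constant, gives a Hölder bound
without a constant for all small `r`. -/
lemma exists_scale_of_exp_bound {l c : ℝ} (hl : 0 < l) (hc : 0 < c) (A : ℝ) (M₀ : ℕ) :
    ∃ r₀ : ℝ, 0 < r₀ ∧ ∀ r : ℝ, 0 < r → r ≤ r₀ → ∃ M : ℕ, M₀ ≤ M ∧ r ≤ Real.exp (-(l * M)) ∧
      A * Real.exp (-(c * M)) ≤ r ^ (c / (2 * l)) := by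
  set A' : ℝ := max A 1 with hA'
  have hA1 : 1 ≤ A' := le_max_right _ _
  set g : ℝ := c / (2 * l) with hg
  have hg0 : 0 < g := by positivity
  have hlog : 0 ≤ Real.log A' := Real.log_nonneg hA1
  refine ⟨min (Real.exp (-(l * (M₀ + 1)))) (Real.exp (-((Real.log A' + c) / g))),
    lt_min (Real.exp_pos _) (Real.exp_pos _), fun r hr hr0 => ?_⟩
  have hr1 : Real.log r ≤ -(l * (M₀ + 1)) := by
    rw [Real.log_le_iff_le_exp hr]
    exact hr0.trans (min_le_left _ _)
  have hr2 : Real.log r ≤ -((Real.log A' + c) / g) := by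
    rw [Real.log_le_iff_le_exp hr]
    exact hr0.trans (min_le_right _ _)
  have hx0 : (M₀ : ℝ) + 1 ≤ -Real.log r / l := by
    rw [le_div_iff₀ hl]
    linarith
  have hx00 : (0 : ℝ) ≤ M₀ := Nat.cast_nonneg _
  have hfl := Nat.floor_le (by linarith : 0 ≤ -Real.log r / l)
  have hlt := Nat.lt_floor_add_one (-Real.log r / l)
  set M := ⌊-Real.log r / l⌋₊ with hM
  rw [le_div_iff₀ hl] at hfl
  rw [div_lt_iff₀ hl] at hlt
  refine ⟨M, ?_, ?_, ?_⟩
  · rw [hM, Nat.le_floor_iff (by linarith)]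
    linarith
  · rw [← Real.log_le_iff_le_exp hr]
    linarith
  · have h1 : A * Real.exp (-(c * M)) ≤ A' * Real.exp (-(c * M)) :=
      mul_le_mul_of_nonneg_right (le_max_left _ _) (Real.exp_pos _).le
    refine h1.trans ?_
    rw [Real.rpow_def_of_pos hr, ← Real.exp_log (by linarith : 0 < A'), ← Real.exp_add,
      Real.exp_le_exp]
    have h3 : c = 2 * g * l := by
      rw [hg]
      field_simp
    have h4 : Real.log A' + c ≤ -Real.log r * g := by
      have := mul_le_mul_of_nonneg_right hr2 hg0.le
      rw [neg_mul, div_mul_cancel₀ _ hg0.ne'] at this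
      linarith
    -- By maximality of `M`, `e^{-cM} ≤ e^c r^{2g}`. Half of this power is kept as the Hölder bound;
    -- the other half, small because `r ≤ r₀`, absorbs `A e^c`.
    have h5 : -(c * M) ≤ 2 * g * Real.log r + c := by
      rw [h3]
      nlinarith
    linarith

end Main

/-! ### Assembly of the three frequency ranges -/

theorem theorem2 :
    ∃ C : ℝ → ℝ, (∀ K, 0 < C K) ∧
      ∀ (m : ℕ) (ζ : Substitution m), ζ.IsPrimitive → ζ.IsAperiodic →
        ζ.HasIrreducibleCharpoly → 1 < ζ.secondEigenvalueModulus →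
        ∃ γ : ℝ, 0 < γ ∧
          ∀ᵐ s ∂(simplexMeasure m), ∃ r₀ : ℝ, 0 < r₀ ∧
            ∀ μ : Measure (ℤ → Fin m), ζ.IsInvariantMeasure μ →
            ∀ ψ : Fin m → ℝ → ℂ, IsLipCylindrical s ψ →
              ∫ p, cylindrical ψ p ∂(ζ.suspensionMeasure s μ) = 0 →
              ∀ σ : Measure ℝ,
                IsSpectralMeasure (ζ.suspensionMeasure s μ) (suspensionFlow s)
                  (cylindrical ψ) σ →
                ∀ ω r : ℝ, 0 < r → r ≤ r₀ →
                  σ.real (Icc (ω - r) (ω + r)) ≤ C (cylLipNorm s ψ) * r ^ γ := by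
  -- All estimates are quadratic in the norm. Constants depending on `s` go into `r₀`, so `C` is
  -- universal; the summand 1 keeps it positive at `K = 0`.
  refine ⟨fun K => 1 + K ^ 2, fun K => by positivity, fun m ζ hprim _ hirr h2 => ?_⟩
  have hm := hirr.two_le h2
  have : Nonempty (Fin m) := ⟨⟨0, by omega⟩⟩
  obtain ⟨Λ, hΛ2, hlen⟩ := ζ.exists_length_iter_le
  obtain ⟨N, c₁, κ₁, hc₁, hκ₁, hdecay⟩ := Substitution.exists_twistedRate_le_exp hprim hirr h2
  obtain ⟨p, c₀, hc₀, hzero⟩ := Substitution.exists_twistedRate_zero_le_exp hprim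
  have hΛ1 : 1 ≤ Λ := by omega
  have hΛ0 : (0 : ℝ) < Λ := by positivity
  set l : ℝ := Real.log Λ with hl
  have hl0 : 0 < l := Real.log_pos (by exact_mod_cast hΛ2)
  have hΛexp : ∀ n : ℕ, (Λ : ℝ) ^ n = Real.exp (l * n) := fun n => by
    rw [mul_comm, Real.exp_nat_mul, hl, Real.exp_log hΛ0]
  -- The cap `4l` gives `r ≤ e^{-4lM} ≤ e^{-κM}`, used for small frequencies.
  set κ : ℝ := min κ₁ (4 * l) with hκ
  have hκ0 : 0 < κ := lt_min hκ₁ (by positivity)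
  -- For small frequencies the level is `p⌊e₀M⌋`; this `e₀` keeps `Λ` to that level below
  -- `e^{κM/2}`, half the exponent of `R`.
  set e₀ : ℝ := κ / (2 * l * (p + 1)) with he₀
  have he₀0 : 0 < e₀ := by positivity
  -- The rates `3l` and `c₁` come from middle frequencies (ends of the block, twisted sums), `κ/2`
  -- and `c₀e₀` from small ones; the tail decays at the faster rate `κ`.
  set c : ℝ := min (min (3 * l) c₁) (min (κ / 2) (c₀ * e₀)) with hc
  have hc0 : 0 < c := lt_min (lt_min (by positivity) hc₁) (lt_min (by positivity) (by positivity))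
  have hc3l : c ≤ 3 * l := (min_le_left _ _).trans (min_le_left _ _)
  have hcc₁ : c ≤ c₁ := (min_le_left _ _).trans (min_le_right _ _)
  have hcκ : c ≤ κ / 2 := (min_le_right _ _).trans (min_le_left _ _)
  have hce₀ : c ≤ c₀ * e₀ := (min_le_right _ _).trans (min_le_right _ _)
  refine ⟨c / (2 * (4 * l)), by positivity, ?_⟩
  have hae : ∀ᵐ s ∂(simplexMeasure m), s ∈ positiveSimplex m :=
    ae_restrict_mem (measurableSet_positiveSimplex m)
  filter_upwards [hae, hdecay] with s hsimplex hs
  obtain ⟨M₁, hM₁⟩ := Filter.eventually_atTop.1 hs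
  obtain ⟨hspos, hssum⟩ := hsimplex
  have hs1 : ∀ i, s i ≤ 1 := fun j => by
    rw [← hssum]
    exact Finset.single_le_sum (f := s) (fun i _ => (hspos i).le) (Finset.mem_univ j)
  obtain ⟨i₀, hi₀⟩ := Finite.exists_min s
  set d : ℝ := s i₀ with hd
  have hd0 : 0 < d := hspos i₀
  have hd1 : d ≤ 1 := hs1 i₀
  set A : ℝ := (40 * Λ ^ N + 10 / d) + 12 / d + (80 + 40 / d * Real.exp c₀) with hA
  have hA₁ : 0 ≤ 40 * (Λ : ℝ) ^ N + 10 / d := by positivity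
  have hA₂ : 0 ≤ 12 / d := by positivity
  have hA₃ : 0 ≤ 80 + 40 / d * Real.exp c₀ := by positivity
  obtain ⟨M₂, hM₂⟩ := exists_nat_gt (Real.log 4 / κ)
  rw [div_lt_iff₀ hκ0] at hM₂
  obtain ⟨r₀, hr₀, hscale⟩ := exists_scale_of_exp_bound (by positivity : 0 < 4 * l) hc0 A
    (max M₁ M₂)
  refine ⟨min r₀ (1 / 2), lt_min hr₀ (by norm_num), fun μ hμ ψ hψ hmean σ hσ ω r hr hrr₀ => ?_⟩
  obtain ⟨M, hM, hrM, hAM⟩ := hscale r hr (hrr₀.trans (min_le_left _ _))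
  have hr2 : r ≤ 1 / 2 := hrr₀.trans (min_le_right _ _)
  have hL := cylLipNorm_nonneg s ψ
  set L := cylLipNorm s ψ
  have hcoeff := fun ω => norm_letterCoeff_le hspos hs1 hL (fun a t ht => hψ.norm_le a ht) ω
  have hfin := hσ.isFiniteMeasure
  have hexp4 : 4 ≤ Real.exp (κ * M) := by
    rw [← Real.log_le_iff_le_exp (by norm_num)]
    have h1 : (M₂ : ℝ) ≤ M := by exact_mod_cast (le_max_right _ _).trans hM
    have h3 := mul_le_mul_of_nonneg_right h1 hκ0.le
    linarith
  have hMnn : (0 : ℝ) ≤ M := Nat.cast_nonneg _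
  have hmono : ∀ x, c ≤ x → Real.exp (-(x * M)) ≤ Real.exp (-(c * M)) := fun x hx => by
    rw [Real.exp_le_exp]
    have h1 := mul_le_mul_of_nonneg_right hx hMnn
    linarith
  suffices hbound : σ.real (Icc (ω - r) (ω + r)) ≤ L * (L * (A * Real.exp (-(c * M)))) by
    calc σ.real (Icc (ω - r) (ω + r)) ≤ L * (L * (A * Real.exp (-(c * M)))) := hbound
      _ ≤ L * (L * r ^ (c / (2 * (4 * l)))) := by gcongr
      _ ≤ (1 + L ^ 2) * r ^ (c / (2 * (4 * l))) := by
          have : 0 ≤ r ^ (c / (2 * (4 * l))) := by positivity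
          rw [add_mul, one_mul, pow_two, mul_assoc L L]
          exact le_add_of_nonneg_left this
  have hE := Real.exp_pos (-(c * M))
  rcases lt_or_ge (Real.exp (κ * M)) |ω| with hbig | hbig
  -- Large frequencies: since `r ≤ 1/2` and `e^{κM} ≥ 4`, the interval stays beyond `e^{κM}/2` and
  -- lies in the tail.
  · have hsub : Icc (ω - r) (ω + r) ⊆ {x | 1 / (2 * Real.exp (-(κ * M))) ≤ |x|} := by
      intro x hx
      have h1 : |ω - x| ≤ r := abs_le.2 ⟨by linarith [hx.2], by linarith [hx.1]⟩
      have h3 := abs_sub_abs_le_abs_sub ω x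
      have h4 : 1 / (2 * Real.exp (-(κ * M))) = Real.exp (κ * M) / 2 := by
        rw [Real.exp_neg]
        field_simp
      rw [mem_ofPred_eq, h4]
      linarith
    refine (measureReal_mono hsub).trans ((hσ.measureReal_tail_le hμ hd0 hi₀ hd1 hs1 hψ
      (by positivity)).trans ?_)
    refine mul_le_mul_of_nonneg_left ?_ hL
    calc 6 * L * (2 * Real.exp (-(κ * M))) / d = L * (12 / d * Real.exp (-(κ * M))) := by ring
      _ ≤ L * (A * Real.exp (-(c * M))) := by
          gcongr
          · linarith
          · linarith
  rcases lt_or_ge |ω| (Real.exp (-(κ * M))) with hsmall | hsmall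
  · have hrκ : r ≤ Real.exp (-(κ * M)) := hrM.trans (by
      rw [Real.exp_le_exp]
      have h1 := mul_le_mul_of_nonneg_right (min_le_right κ₁ (4 * l)) hMnn
      linarith)
    -- Small frequencies: `R` is chosen so that the ball of radius `1/(2R) = 2e^{-κM}` about 0
    -- swallows the interval, as `|ω|` and `r` are both at most `e^{-κM}`.
    set R : ℝ := Real.exp (κ * M) / 4 with hR
    have hR1 : 1 ≤ R := by rw [hR]; linarith
    have hRinv : 1 / (2 * R) = 2 * Real.exp (-(κ * M)) := by
      rw [hR, Real.exp_neg]
      field_simp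
      norm_num
    have hsub : Icc (ω - r) (ω + r) ⊆ Icc (0 - 1 / (2 * R)) (0 + 1 / (2 * R)) := by
      have := abs_lt.1 hsmall
      rw [hRinv]
      exact Icc_subset_Icc (by linarith) (by linarith)
    set k : ℕ := ⌊e₀ * M⌋₊ with hk
    have hk1 : (k : ℝ) ≤ e₀ * M := Nat.floor_le (by positivity)
    have hk2 : e₀ * M < k + 1 := Nat.lt_floor_add_one _
    have hmain := hσ.measureReal_Icc_le hΛ1 hlen hμ hd0 hi₀ hs1 hψ 0 hR1 (p * k)
    have hrate := hzero s (letterCoeff s ψ 0) L hL (hcoeff 0) μ hμ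
      (integral_letterCoeff_eq_zero hμ hd0 hi₀ hs1 hψ hmean) k
    refine (measureReal_mono hsub).trans (hmain.trans (mul_le_mul_of_nonneg_left ?_ hL))
    have hΛk : (Λ : ℝ) ^ (p * k) ≤ Real.exp (κ / 2 * M) := by
      rw [hΛexp, Real.exp_le_exp]
      push_cast
      have h1 : e₀ * (2 * l * (p + 1)) = κ := div_mul_cancel₀ _ (by positivity)
      have h3 : (p : ℝ) * k ≤ (p + 1) * (e₀ * M) :=
        mul_le_mul (by linarith) hk1 (Nat.cast_nonneg _) (by positivity)
      calc l * (p * k) ≤ l * ((p + 1) * (e₀ * M)) := by gcongr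
        _ = (e₀ * (2 * l * (p + 1))) / 2 * M := by ring
        _ = _ := by rw [h1]
    have hfirst : (Λ : ℝ) ^ (p * k) / R ≤ 4 * Real.exp (-(c * M)) := by
      calc (Λ : ℝ) ^ (p * k) / R ≤ Real.exp (κ / 2 * M) / R := by gcongr
        _ = 4 * Real.exp (-(κ / 2 * M)) := by
            rw [hR, div_div_eq_mul_div, mul_comm, mul_div_assoc, ← Real.exp_sub]
            congr 2
            ring
        _ ≤ _ := by
            have := hmono _ hcκ
            linarith
    have hsecond : Real.exp (-(c₀ * k)) ≤ Real.exp c₀ * Real.exp (-(c * M)) := by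
      rw [← Real.exp_add, Real.exp_le_exp]
      have h1 := mul_le_mul_of_nonneg_right hce₀ hMnn
      have h3 := mul_le_mul_of_nonneg_left hk2.le hc₀.le
      linarith
    calc 20 * L * Λ ^ (p * k) / R + 10 * twistedRate s 0 (letterCoeff s ψ 0) ζ (p * k) / d
        = L * (20 * (Λ ^ (p * k) / R)) +
          10 * twistedRate s 0 (letterCoeff s ψ 0) ζ (p * k) / d := by ring
      _ ≤ L * (20 * (4 * Real.exp (-(c * M)))) +
          10 * (4 * L * (Real.exp c₀ * Real.exp (-(c * M)))) / d := by
          gcongr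
          refine hrate.trans ?_
          gcongr
      _ = L * ((80 + 40 / d * Real.exp c₀) * Real.exp (-(c * M))) := by ring
      _ ≤ _ := by
          gcongr
          linarith
  · have hκκ₁ : κ * M ≤ κ₁ * M := mul_le_mul_of_nonneg_right (min_le_left _ _) hMnn
    have hrate := hM₁ M ((le_max_left _ _).trans hM) ω
      (le_trans (by rw [Real.exp_le_exp]; linarith) hsmall)
      (hbig.trans (by rw [Real.exp_le_exp]; exact hκκ₁)) (letterCoeff s ψ ω) L hL (hcoeff ω)
    set R : ℝ := 1 / (2 * r) with hR
    have hR1 : 1 ≤ R := by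
      rw [hR, le_div_iff₀ (by positivity)]
      linarith
    have hRr : 1 / (2 * R) = r := by
      rw [hR]
      field_simp
    have hmain := hσ.measureReal_Icc_le hΛ1 hlen hμ hd0 hi₀ hs1 hψ ω hR1 (M + N)
    rw [hRr] at hmain
    refine hmain.trans (mul_le_mul_of_nonneg_left ?_ hL)
    -- Middle frequencies: the scale `r ≤ e^{-4lM}` makes the end pieces of length `Λ^(M+N)`
    -- negligible against `R = 1/(2r)`, with `e^{-3lM}` to spare.
    have hfirst : (Λ : ℝ) ^ (M + N) / R ≤ 2 * Λ ^ N * Real.exp (-(c * M)) := by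
      calc (Λ : ℝ) ^ (M + N) / R = 2 * Λ ^ N * (Λ ^ M * r) := by
            rw [hR, pow_add]
            field_simp
        _ ≤ 2 * Λ ^ N * (Real.exp (l * M) * Real.exp (-(4 * l * M))) := by
            rw [hΛexp M]
            gcongr
        _ ≤ _ := by
            rw [← Real.exp_add]
            have h1 := mul_le_mul_of_nonneg_right hc3l hMnn
            gcongr
            linarith
    calc 20 * L * Λ ^ (M + N) / R + 10 * twistedRate s ω (letterCoeff s ψ ω) ζ (M + N) / d
        = L * (20 * (Λ ^ (M + N) / R)) +
          10 * twistedRate s ω (letterCoeff s ψ ω) ζ (M + N) / d := by ring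
      _ ≤ L * (20 * (2 * Λ ^ N * Real.exp (-(c * M)))) +
          10 * (L * Real.exp (-(c * M))) / d := by
          gcongr
          exact hrate.trans (mul_le_mul_of_nonneg_left (hmono _ hcc₁) hL)
      _ = L * ((40 * Λ ^ N + 10 / d) * Real.exp (-(c * M))) := by ring
      _ ≤ _ := by
          gcongr
          linarith
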